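/- All algebras are associative algebras over $\mathbb{C}$, with or without identity. For such an algebra $A$ with non-degenerate product, $M(A)$ denotes its multiplier algebra, and $A\otimes M(A)$ is regarded as a subspace of $M(A\otimes A)$. A multiplier Hopf algebra is a pair $(A,\Delta)$ where $A$ has non-degenerate product and $\Delta:A\to M(A\otimes A)$ is a homomorphism such that $a\otimes b\mapsto\Delta(a)(1\otimes b)$ and $a\otimes b\mapsto(a\otimes 1)\Delta(b)$ are bijections of $A\otimes A$ onto $A\otimes A\subseteq M(A\otimes A)$ and $(a\otimes1\otimes1)(\Delta\otimes\iota)(\Delta(b)(1\otimes c))=(\iota\otimes\Delta)((a\otimes1)\Delta(b))(1\otimes1\otimes c)$ for all $a,b,c\in A$. It is regular if $(A,\Delta^{cop})$, with $\Delta^{cop}=\sigma\circ\Delta$ and $\sigma$ the flip, is also a multiplier Hopf algebra; then it has a bijective antipode $S:A\to A$. Non-degenerate homomorphisms, the flip $\sigma$ and the antipode $S$ are extended to multiplier algebras and denoted by the same symbols. Let $(A,\Delta)$ be a regular multiplier Hopf algebra which is quasitriangular with generalized $R$-matrix $R$; that is, $R\in M(A\otimes A)$ is an invertible multiplier such that 1.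 $R\Delta(a)=\Delta^{cop}(a)R$ for all $a\in A$; 2. $(\Delta\otimes\iota)(R)=R^{13}R^{23}$ and $(\iota\otimes\Delta)(R)=R^{13}R^{12}$ in $M(A\otimes A\otimes A)$; 3. $R(a\otimes 1)$ and $(a\otimes1)R$ belong to $A\otimes M(A)$ for all $a\in A$. Write $R(a\otimes1)=\sum R^{(1)}a\otimes R^{(2)}$ in $A\otimes M(A)$. Then there is exactly one multiplier $u\in M(A)$ with $$ua=\sum S(R^{(2)})R^{(1)}a\qquad\text{for all }a\in A,$$ and $u$ and $S(u)$ are invertible in $M(A)$. Moreover, in $M(A\otimes A)$, $$\sigma(R)R\,\Delta(u)=\Delta(u)\,\sigma(R)R=u\otimes u,$$ the invertible multiplier $g=uS(u)^{-1}\in M(A)$ is grouplike, that is, $\Delta(g)=g\otimes g$, and $$S^4(a)=gag^{-1}\qquad\text{for all }a\in A.$$ -/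

import Mathlib

open scoped TensorProduct

/-! # Multiplier algebras, multiplier Hopf algebras and generalized `R`-matrices

All algebras are associative algebras over `ℂ`, with or without identity. -/

namespace MultiplierHopf

noncomputable section

section Multipliers

variable (A : Type*) [NonUnitalRing A] [Module ℂ A] [IsScalarTower ℂ A A] [SMulCommClass ℂ A A]

/-- The product of `A`, viewed as a bilinear form, is non-degenerate. -/
def NondegenerateProduct : Prop :=
  (∀ a : A, (∀ b : A, a * b = 0) → a = 0) ∧ (∀ a : A, (∀ b : A, b * a = 0) → a = 0)

/-- The multiplier algebra `M(A)`: pairs `(l, r)` of linear maps `A → A` such that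
`a * l b = r a * b`. Here `l` is left multiplication and `r` is right multiplication by the
multiplier; the opposite algebra in the second component gives the product
`(l, r) (l', r') = (l ∘ l', r' ∘ r)`. -/
def multiplierAlgebra : Subalgebra ℂ (Module.End ℂ A × (Module.End ℂ A)ᵐᵒᵖ) where
  carrier := {p | ∀ a b : A, a * p.1 b = p.2.unop a * b}
  mul_mem' := by
    intro p q hp hq a b
    simp only [Set.mem_ofPred_eq] at hp hq
    simp [hp, hq]
  add_mem' := by
    intro p q hp hq a b
    simp only [Set.mem_ofPred_eq] at hp hq
    simp [mul_add, add_mul, hp, hq]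
  algebraMap_mem' := by
    intro c a b
    simp [Module.algebraMap_end_apply, mul_smul_comm, smul_mul_assoc]

/-- The multiplier algebra as a type; it is a unital algebra over `ℂ`. -/
abbrev M : Type _ := multiplierAlgebra A

variable {A}

namespace M

/-- Left multiplication `a ↦ m a` by a multiplier. -/
def l (m : M A) : A →ₗ[ℂ] A := m.1.1

/-- Right multiplication `a ↦ a m` by a multiplier. -/
def r (m : M A) : A →ₗ[ℂ] A := m.1.2.unop

/-- The multiplier with given left and right multiplication maps. -/
def mk (f g : A →ₗ[ℂ] A) (h : ∀ a b : A, a * f b = g a * b) : M A :=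
  ⟨(f, MulOpposite.op g), h⟩

theorem mul_l (m : M A) (a b : A) : a * m.l b = m.r a * b := m.2 a b

theorem ext' {m n : M A} (hl : ∀ a, m.l a = n.l a) (hr : ∀ a, m.r a = n.r a) : m = n := by
  apply Subtype.ext
  refine Prod.ext (LinearMap.ext hl) (MulOpposite.unop_injective (LinearMap.ext hr))

end M

/-- The canonical map `A → M(A)`. -/
def ι : A →ₗ[ℂ] M A where
  toFun a := M.mk (LinearMap.mulLeft ℂ a) (LinearMap.mulRight ℂ a) (by simp [mul_assoc])
  map_add' a b := M.ext' (fun c => add_mul a b c) (fun c => mul_add c a b)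
  map_smul' z a := M.ext' (fun c => smul_mul_assoc z a c) (fun c => mul_smul_comm z c a)

variable {B : Type*} [NonUnitalRing B] [Module ℂ B] [IsScalarTower ℂ B B] [SMulCommClass ℂ B B]

/-- The isomorphism `M(A) → M(B)` (as a map) induced by an isomorphism of algebras `A ≃ B`. -/
def transport (e : A ≃ₗ[ℂ] B) (he : ∀ x y, e (x * y) = e x * e y) (m : M A) : M B :=
  M.mk (e.toLinearMap ∘ₗ m.l ∘ₗ e.symm.toLinearMap) (e.toLinearMap ∘ₗ m.r ∘ₗ e.symm.toLinearMap)
    (by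
      intro a b
      obtain ⟨a, rfl⟩ := e.surjective a
      obtain ⟨b, rfl⟩ := e.surjective b
      simp [← he, M.mul_l])

/-- The multiplier `m ⊗ n` of `A ⊗ B`, for multipliers `m` of `A` and `n` of `B`. -/
def tmul (m : M A) (n : M B) : M (A ⊗[ℂ] B) :=
  M.mk (TensorProduct.map m.l n.l) (TensorProduct.map m.r n.r) (by
    intro x y
    induction x with
    | zero => simp
    | add x x' hx hx' => simp [add_mul, hx, hx']
    | tmul a b =>
      induction y with
      | zero => simp
      | add y y' hy hy' => simp only [mul_add, map_add, hy, hy']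
      | tmul a' b' => simp [M.mul_l])

/-- The canonical map `M(A) ⊗ M(B) → M(A ⊗ B)`. -/
def tmulLin : M A ⊗[ℂ] M B →ₗ[ℂ] M (A ⊗[ℂ] B) :=
  TensorProduct.lift (LinearMap.mk₂ ℂ tmul
    (fun m m' n => M.ext'
      (fun x => LinearMap.congr_fun (TensorProduct.map_add_left m.l m'.l n.l) x)
      (fun x => LinearMap.congr_fun (TensorProduct.map_add_left m.r m'.r n.r) x))
    (fun c m n => M.ext'
      (fun x => LinearMap.congr_fun (TensorProduct.map_smul_left c m.l n.l) x)
      (fun x => LinearMap.congr_fun (TensorProduct.map_smul_left c m.r n.r) x))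
    (fun m n n' => M.ext'
      (fun x => LinearMap.congr_fun (TensorProduct.map_add_right m.l n.l n'.l) x)
      (fun x => LinearMap.congr_fun (TensorProduct.map_add_right m.r n.r n'.r) x))
    (fun c m n => M.ext'
      (fun x => LinearMap.congr_fun (TensorProduct.map_smul_right c m.l n.l) x)
      (fun x => LinearMap.congr_fun (TensorProduct.map_smul_right c m.r n.r) x)))

/-- The canonical map `A ⊗ M(B) → M(A ⊗ B)`; its range is the subspace called `A ⊗ M(B)`. -/
def legs : A ⊗[ℂ] M B →ₗ[ℂ] M (A ⊗[ℂ] B) :=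
  tmulLin ∘ₗ TensorProduct.map ι LinearMap.id

/-- `φ ⊗ ψ : A ⊗ B → M(C ⊗ D)` for `φ : A → M(C)` and `ψ : B → M(D)`. -/
def tensorMap {C D : Type*} [NonUnitalRing C] [Module ℂ C] [IsScalarTower ℂ C C]
    [SMulCommClass ℂ C C] [NonUnitalRing D] [Module ℂ D] [IsScalarTower ℂ D D]
    [SMulCommClass ℂ D D] (φ : A →ₗ[ℂ] M C) (ψ : B →ₗ[ℂ] M D) :
    A ⊗[ℂ] B →ₗ[ℂ] M (C ⊗[ℂ] D) :=
  tmulLin ∘ₗ TensorProduct.map φ ψ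

/-- The extension to multiplier algebras `M(A) → M(B)` of a non-degenerate homomorphism
`φ : A → M(B)`. It is the unique map with `φ(m) φ(a) = φ(m a)` and `φ(a) φ(m) = φ(a m)`, see
`existsUnique_extension`. -/
def extend (φ : A →ₗ[ℂ] M B) : M A →ₗ[ℂ] M B :=
  Classical.epsilon fun F : M A →ₗ[ℂ] M B =>
    ∀ (m : M A) (a : A), F m * φ a = φ (m.l a) ∧ φ a * F m = φ (m.r a)

/-- The extension to multiplier algebras `M(A) → M(B)` of a bijective anti-homomorphism
`S : A → B`. It is the unique map with `S(m) S(a) = S(a m)` and `S(a) S(m) = S(m a)`, see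
`existsUnique_extensionAnti`. -/
def extendAnti (S : A →ₗ[ℂ] B) : M A →ₗ[ℂ] M B :=
  Classical.epsilon fun F : M A →ₗ[ℂ] M B =>
    ∀ (m : M A) (a : A), F m * ι (S a) = ι (S (m.r a)) ∧ ι (S a) * F m = ι (S (m.l a))

theorem M.eq_of_l (hB : NondegenerateProduct B) {m n : M B} (h : ∀ b, m.l b = n.l b) : m = n := by
  refine M.ext' h fun a => ?_
  refine sub_eq_zero.1 (hB.1 _ fun b => ?_)
  rw [sub_mul, ← M.mul_l, ← M.mul_l, h, sub_self]

theorem M.mul_l_apply (m n : M A) (a : A) : (m * n).l a = m.l (n.l a) := rfl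

theorem M.mul_r_apply (m n : M A) (a : A) : (m * n).r a = n.r (m.r a) := rfl

/-- A non-degenerate homomorphism `φ : A → M(B)` has exactly one extension to `M(A)`. -/
theorem existsUnique_extension (hB : NondegenerateProduct B) (φ : A →ₗ[ℂ] M B)
    (hmul : ∀ a b, φ (a * b) = φ a * φ b)
    (hl : Submodule.span ℂ {x : B | ∃ a b, (φ a).l b = x} = ⊤)
    (hr : Submodule.span ℂ {x : B | ∃ a b, (φ a).r b = x} = ⊤) :
    ∃! F : M A →ₗ[ℂ] M B,
      ∀ (m : M A) (a : A), F m * φ a = φ (m.l a) ∧ φ a * F m = φ (m.r a) := by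
  let L : M B →ₗ[ℂ] (B →ₗ[ℂ] B) :=
    { toFun := M.l, map_add' := fun _ _ => rfl, map_smul' := fun _ _ => rfl }
  let K : M B →ₗ[ℂ] (B →ₗ[ℂ] B) :=
    { toFun := M.r, map_add' := fun _ _ => rfl, map_smul' := fun _ _ => rfl }
  let P : A ⊗[ℂ] B →ₗ[ℂ] B := TensorProduct.lift (L ∘ₗ φ)
  let Q : A ⊗[ℂ] B →ₗ[ℂ] B := TensorProduct.lift (K ∘ₗ φ)
  have hP : ∀ a b, P (a ⊗ₜ b) = (φ a).l b := fun a b => rfl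
  have hQ : ∀ a b, Q (a ⊗ₜ b) = (φ a).r b := fun a b => rfl
  have hPs : LinearMap.range P = ⊤ := by
    rw [← top_le_iff, ← hl, Submodule.span_le]
    rintro _ ⟨a, b, rfl⟩
    exact ⟨a ⊗ₜ b, rfl⟩
  have hQs : LinearMap.range Q = ⊤ := by
    rw [← top_le_iff, ← hr, Submodule.span_le]
    rintro _ ⟨a, b, rfl⟩
    exact ⟨a ⊗ₜ b, rfl⟩
  obtain ⟨s, hs⟩ := P.exists_rightInverse_of_surjective hPs
  obtain ⟨t, ht⟩ := Q.exists_rightInverse_of_surjective hQs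
  have hs' : ∀ b, P (s b) = b := fun b => LinearMap.congr_fun hs b
  have ht' : ∀ b, Q (t b) = b := fun b => LinearMap.congr_fun ht b
  -- left and right multiplication by `m` on the first leg
  let Pm : M A → A ⊗[ℂ] B →ₗ[ℂ] B := fun m => P ∘ₗ TensorProduct.map m.l LinearMap.id
  let Qm : M A → A ⊗[ℂ] B →ₗ[ℂ] B := fun m => Q ∘ₗ TensorProduct.map m.r LinearMap.id
  have key : ∀ (m : M A) (x y : A ⊗[ℂ] B), Q x * Pm m y = Qm m x * P y := by
    intro m x y
    induction x with
    | zero => simp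
    | add x x' hx hx' => simp [add_mul, hx, hx']
    | tmul a b =>
      induction y with
      | zero => simp
      | add y y' hy hy' => simp only [mul_add, map_add, hy, hy']
      | tmul a' b' =>
        change (φ a).r b * (φ (m.l a')).l b' = (φ (m.r a)).r b * (φ a').l b'
        rw [← M.mul_l (φ a), ← M.mul_l (φ (m.r a)), ← M.mul_l_apply, ← M.mul_l_apply, ← hmul,
          ← hmul, M.mul_l m]
  let F : M A →ₗ[ℂ] M B :=
    { toFun := fun m => M.mk (Pm m ∘ₗ s) (Qm m ∘ₗ t) (by
        intro a b
        have := key m (t a) (s b)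
        rwa [hs', ht'] at this)
      map_add' := fun m n => M.ext'
        (fun x => by
          change P (TensorProduct.map (m.l + n.l) _ (s x)) = _
          rw [TensorProduct.map_add_left, LinearMap.add_apply, map_add]; rfl)
        (fun x => by
          change Q (TensorProduct.map (m.r + n.r) _ (t x)) = _
          rw [TensorProduct.map_add_left, LinearMap.add_apply, map_add]; rfl)
      map_smul' := fun c m => M.ext'
        (fun x => by
          change P (TensorProduct.map (c • m.l) _ (s x)) = _
          rw [TensorProduct.map_smul_left, LinearMap.smul_apply, map_smul]; rfl)
        (fun x => by
          change Q (TensorProduct.map (c • m.r) _ (t x)) = _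
          rw [TensorProduct.map_smul_left, LinearMap.smul_apply, map_smul]; rfl) }
  have hFl : ∀ m y, (F m).l (P y) = Pm m y := by
    intro m y
    refine sub_eq_zero.1 (hB.2 _ fun b => ?_)
    have h1 := key m (t b) y
    have h2 := key m (t b) (s (P y))
    rw [hs'] at h2
    rw [ht'] at h1 h2
    rw [mul_sub, h1, sub_eq_zero]
    exact h2
  have hspec : ∀ (m : M A) (a : A), F m * φ a = φ (m.l a) ∧ φ a * F m = φ (m.r a) := by
    intro m a
    refine ⟨M.eq_of_l hB fun b => hFl m (a ⊗ₜ b), M.eq_of_l hB fun b => ?_⟩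
    rw [M.mul_l_apply, ← hs' b, hFl]
    induction s b with
    | zero => simp
    | add x y hx hy => simp only [map_add, hx, hy]
    | tmul a' b' =>
      change (φ a).l ((φ (m.l a')).l b') = (φ (m.r a)).l ((φ a').l b')
      rw [← M.mul_l_apply, ← M.mul_l_apply, ← hmul, ← hmul, M.mul_l]
  refine ⟨F, hspec, fun G hG => LinearMap.ext fun m => M.eq_of_l hB fun b => ?_⟩
  rw [← hs' b]
  induction s b with
  | zero => simp
  | add x y hx hy => simp only [map_add, hx, hy]
  | tmul a' b' =>
    rw [hP, ← M.mul_l_apply, ← M.mul_l_apply, (hG m a').1, (hspec m a').1]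

/-- A bijective anti-homomorphism `S : A → B` has exactly one extension to `M(A)`. -/
theorem existsUnique_extensionAnti (hB : NondegenerateProduct B) (S : A →ₗ[ℂ] B)
    (hmul : ∀ a b, S (a * b) = S b * S a) (hS : Function.Bijective S) :
    ∃! F : M A →ₗ[ℂ] M B,
      ∀ (m : M A) (a : A), F m * ι (S a) = ι (S (m.r a)) ∧ ι (S a) * F m = ι (S (m.l a)) := by
  obtain ⟨e, rfl⟩ : ∃ e : A ≃ₗ[ℂ] B, e.toLinearMap = S := ⟨LinearEquiv.ofBijective S hS, rfl⟩
  simp only [LinearEquiv.coe_coe] at hmul ⊢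
  let F : M A →ₗ[ℂ] M B :=
    { toFun := fun m => M.mk (e.toLinearMap ∘ₗ m.r ∘ₗ e.symm.toLinearMap)
        (e.toLinearMap ∘ₗ m.l ∘ₗ e.symm.toLinearMap) (by
          intro a b
          obtain ⟨a, rfl⟩ := e.surjective a
          obtain ⟨b, rfl⟩ := e.surjective b
          simp [← hmul, M.mul_l])
      map_add' := fun m n => M.ext' (fun x => map_add e (m.r (e.symm x)) (n.r (e.symm x)))
        (fun x => map_add e (m.l (e.symm x)) (n.l (e.symm x)))
      map_smul' := fun c m => M.ext' (fun x => map_smul e c (m.r (e.symm x)))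
        (fun x => map_smul e c (m.l (e.symm x))) }
  have hFl : ∀ m a, (F m).l (e a) = e (m.r a) := fun m a => by
    change e (m.r (e.symm (e a))) = _
    rw [e.symm_apply_apply]
  have hspec : ∀ (m : M A) (a : A),
      F m * ι (e a) = ι (e (m.r a)) ∧ ι (e a) * F m = ι (e (m.l a)) := by
    intro m a
    refine ⟨M.eq_of_l hB fun b => ?_, M.eq_of_l hB fun b => ?_⟩ <;>
      obtain ⟨b, rfl⟩ := e.surjective b
    · change (F m).l (e a * e b) = e (m.r a) * e b
      rw [← hmul, hFl, ← hmul]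
      congr 1
      apply e.injective
      refine sub_eq_zero.1 (hB.2 _ fun c => ?_)
      obtain ⟨c, rfl⟩ := e.surjective c
      rw [mul_sub, sub_eq_zero, ← hmul, ← hmul, ← M.mul_l, mul_assoc, mul_assoc, M.mul_l]
    · change e a * (F m).l (e b) = e (m.l a) * e b
      rw [hFl, ← hmul, ← hmul, M.mul_l]
  refine ⟨F, hspec, fun G hG => LinearMap.ext fun m => M.eq_of_l hB fun b => ?_⟩
  obtain ⟨b, rfl⟩ := e.surjective b
  refine sub_eq_zero.1 (hB.1 _ fun c => ?_)
  have h1 : (G m).l (e b * c) = (F m).l (e b * c) :=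
    congrArg (fun n : M B => n.l c) ((hG m b).1.trans (hspec m b).1.symm)
  have h2 : ∀ n : M B, n.l (e b) * c = n.l (e b * c) := fun n => by
    refine sub_eq_zero.1 (hB.2 _ fun d => ?_)
    rw [mul_sub, sub_eq_zero, ← mul_assoc, M.mul_l, M.mul_l, mul_assoc]
  rw [sub_mul, h2, h2, h1, sub_self]

end Multipliers

section HopfStructure

variable {A : Type*} [NonUnitalRing A] [Module ℂ A] [IsScalarTower ℂ A A] [SMulCommClass ℂ A A]

theorem comm_mul (x y : A ⊗[ℂ] A) : TensorProduct.comm ℂ A A (x * y) =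
    TensorProduct.comm ℂ A A x * TensorProduct.comm ℂ A A y := by
  induction x with
  | zero => simp
  | add x x' hx hx' => simp [add_mul, hx, hx']
  | tmul a b =>
    induction y with
    | zero => simp
    | add y y' hy hy' => simp only [mul_add, map_add, hy, hy']
    | tmul a' b' => simp

theorem rightComm_mul (x y : (A ⊗[ℂ] A) ⊗[ℂ] A) : TensorProduct.rightComm ℂ A A A (x * y) =
    TensorProduct.rightComm ℂ A A A x * TensorProduct.rightComm ℂ A A A y := by
  induction x with
  | zero => simp
  | add x x' hx hx' => simp only [add_mul, map_add, hx, hx']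
  | tmul t c =>
    induction t with
    | zero => simp
    | add t t' ht ht' => simp only [TensorProduct.add_tmul, add_mul, map_add, ht, ht']
    | tmul a b =>
      induction y with
      | zero => simp
      | add y y' hy hy' => simp only [mul_add, map_add, hy, hy']
      | tmul s c' =>
        induction s with
        | zero => simp
        | add s s' hs hs' => simp only [TensorProduct.add_tmul, mul_add, map_add, hs, hs']
        | tmul a' b' => simp

theorem assoc_symm_mul (x y : A ⊗[ℂ] (A ⊗[ℂ] A)) : (TensorProduct.assoc ℂ A A A).symm (x * y) =
    (TensorProduct.assoc ℂ A A A).symm x * (TensorProduct.assoc ℂ A A A).symm y := by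
  induction x with
  | zero => simp
  | add x x' hx hx' => simp only [add_mul, map_add, hx, hx']
  | tmul c t =>
    induction t with
    | zero => simp
    | add t t' ht ht' => simp only [TensorProduct.tmul_add, add_mul, map_add, ht, ht']
    | tmul a b =>
      induction y with
      | zero => simp
      | add y y' hy hy' => simp only [mul_add, map_add, hy, hy']
      | tmul c' s =>
        induction s with
        | zero => simp
        | add s s' hs hs' => simp only [TensorProduct.tmul_add, mul_add, map_add, hs, hs']
        | tmul a' b' => simp

/-- The flip `σ` on `A ⊗ A`, extended to `M(A ⊗ A)`. -/
def flip (m : M (A ⊗[ℂ] A)) : M (A ⊗[ℂ] A) := transport (TensorProduct.comm ℂ A A) comm_mul m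

/-- The identification of `M(A ⊗ (A ⊗ A))` with `M((A ⊗ A) ⊗ A)`. -/
def reassoc (m : M (A ⊗[ℂ] (A ⊗[ℂ] A))) : M ((A ⊗[ℂ] A) ⊗[ℂ] A) :=
  transport (TensorProduct.assoc ℂ A A A).symm assoc_symm_mul m

/-- `R¹² = R ⊗ 1`. -/
def leg12 (R : M (A ⊗[ℂ] A)) : M ((A ⊗[ℂ] A) ⊗[ℂ] A) := tmul R 1

/-- `R²³ = 1 ⊗ R`. -/
def leg23 (R : M (A ⊗[ℂ] A)) : M ((A ⊗[ℂ] A) ⊗[ℂ] A) := reassoc (tmul 1 R)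

/-- `R¹³`, obtained from `R¹²` by interchanging the last two legs. -/
def leg13 (R : M (A ⊗[ℂ] A)) : M ((A ⊗[ℂ] A) ⊗[ℂ] A) :=
  transport (TensorProduct.rightComm ℂ A A A) rightComm_mul (leg12 R)

/-- The map `Δ ⊗ id : A ⊗ A → M(A ⊗ A ⊗ A)`. -/
def comulLeft (Δ : A →ₗ[ℂ] M (A ⊗[ℂ] A)) : A ⊗[ℂ] A →ₗ[ℂ] M ((A ⊗[ℂ] A) ⊗[ℂ] A) :=
  tensorMap Δ ι

/-- The map `id ⊗ Δ : A ⊗ A → M(A ⊗ A ⊗ A)`. -/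
def comulRight (Δ : A →ₗ[ℂ] M (A ⊗[ℂ] A)) : A ⊗[ℂ] A →ₗ[ℂ] M ((A ⊗[ℂ] A) ⊗[ℂ] A) where
  toFun x := reassoc (tensorMap ι Δ x)
  map_add' x y := by
    rw [map_add]
    exact M.ext' (fun z => map_add (TensorProduct.assoc ℂ A A A).symm _ _)
      (fun z => map_add (TensorProduct.assoc ℂ A A A).symm _ _)
  map_smul' c x := by
    rw [map_smul]
    exact M.ext' (fun z => map_smul (TensorProduct.assoc ℂ A A A).symm c _)
      (fun z => map_smul (TensorProduct.assoc ℂ A A A).symm c _)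

/-- The opposite comultiplication `Δᶜᵒᵖ = σ ∘ Δ`. -/
def cop (Δ : A →ₗ[ℂ] M (A ⊗[ℂ] A)) : A →ₗ[ℂ] M (A ⊗[ℂ] A) where
  toFun a := flip (Δ a)
  map_add' a b := by
    rw [map_add]
    exact M.ext' (fun z => map_add (TensorProduct.comm ℂ A A) _ _)
      (fun z => map_add (TensorProduct.comm ℂ A A) _ _)
  map_smul' c a := by
    rw [map_smul]
    exact M.ext' (fun z => map_smul (TensorProduct.comm ℂ A A) c _)
      (fun z => map_smul (TensorProduct.comm ℂ A A) c _)

/-- The linear map `a ⊗ b ↦ Δ(a)(1 ⊗ b)`, with values in `M(A ⊗ A)`. -/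
def T₁ (Δ : A →ₗ[ℂ] M (A ⊗[ℂ] A)) : A ⊗[ℂ] A →ₗ[ℂ] M (A ⊗[ℂ] A) :=
  TensorProduct.lift ((LinearMap.mul ℂ (M (A ⊗[ℂ] A))).compl₁₂ Δ
    (tmulLin ∘ₗ TensorProduct.mk ℂ (M A) (M A) 1 ∘ₗ ι))

/-- The linear map `a ⊗ b ↦ (a ⊗ 1)Δ(b)`, with values in `M(A ⊗ A)`. -/
def T₂ (Δ : A →ₗ[ℂ] M (A ⊗[ℂ] A)) : A ⊗[ℂ] A →ₗ[ℂ] M (A ⊗[ℂ] A) :=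
  TensorProduct.lift ((LinearMap.mul ℂ (M (A ⊗[ℂ] A))).compl₁₂
    (tmulLin ∘ₗ (TensorProduct.mk ℂ (M A) (M A)).flip 1 ∘ₗ ι) Δ)

theorem T₁_tmul (Δ : A →ₗ[ℂ] M (A ⊗[ℂ] A)) (a b : A) :
    T₁ Δ (a ⊗ₜ b) = Δ a * tmul 1 (ι b) := rfl

theorem T₂_tmul (Δ : A →ₗ[ℂ] M (A ⊗[ℂ] A)) (a b : A) :
    T₂ Δ (a ⊗ₜ b) = tmul (ι a) 1 * Δ b := rfl

/-- `(A, Δ)` is a multiplier Hopf algebra: the product of `A` is non-degenerate, `Δ` is a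
homomorphism `A → M(A ⊗ A)`, the maps `a ⊗ b ↦ Δ(a)(1 ⊗ b)` and `a ⊗ b ↦ (a ⊗ 1)Δ(b)` are
bijections of `A ⊗ A` onto `A ⊗ A ⊆ M(A ⊗ A)`, and
`(a ⊗ 1 ⊗ 1)(Δ ⊗ id)(Δ(b)(1 ⊗ c)) = (id ⊗ Δ)((a ⊗ 1)Δ(b))(1 ⊗ 1 ⊗ c)`. -/
structure IsMultiplierHopfAlgebra (Δ : A →ₗ[ℂ] M (A ⊗[ℂ] A)) : Prop where
  nondegenerate : NondegenerateProduct A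
  map_mul : ∀ a b : A, Δ (a * b) = Δ a * Δ b
  T₁_injective : Function.Injective (T₁ Δ)
  T₁_range : LinearMap.range (T₁ Δ) = LinearMap.range (ι (A := A ⊗[ℂ] A))
  T₂_injective : Function.Injective (T₂ Δ)
  T₂_range : LinearMap.range (T₂ Δ) = LinearMap.range (ι (A := A ⊗[ℂ] A))
  coassoc : ∀ (a b c : A) (x y : A ⊗[ℂ] A),
    ι x = Δ b * tmul 1 (ι c) → ι y = tmul (ι a) 1 * Δ b →
      tmul (tmul (ι a) 1) 1 * comulLeft Δ x = comulRight Δ y * tmul 1 (ι c)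

/-- `(A, Δ)` is a regular multiplier Hopf algebra: both `(A, Δ)` and `(A, Δᶜᵒᵖ)` are multiplier
Hopf algebras. -/
structure IsRegular (Δ : A →ₗ[ℂ] M (A ⊗[ℂ] A)) : Prop where
  isMultiplierHopfAlgebra : IsMultiplierHopfAlgebra Δ
  cop : IsMultiplierHopfAlgebra (cop Δ)

/-- `ε` is a counit: `(ε ⊗ id)(Δ(a)(1 ⊗ b)) = ab` and `(id ⊗ ε)((a ⊗ 1)Δ(b)) = ab`. -/
def IsCounit (Δ : A →ₗ[ℂ] M (A ⊗[ℂ] A)) (ε : A →ₗ[ℂ] ℂ) : Prop :=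
  (∀ (a b : A) (x : A ⊗[ℂ] A), ι x = Δ a * tmul 1 (ι b) →
    TensorProduct.lid ℂ A (TensorProduct.map ε LinearMap.id x) = a * b) ∧
  (∀ (a b : A) (x : A ⊗[ℂ] A), ι x = tmul (ι a) 1 * Δ b →
    TensorProduct.rid ℂ A (TensorProduct.map LinearMap.id ε x) = a * b)

/-- The counit of a multiplier Hopf algebra `(A, Δ)`; it exists, and it is unique if `A ≠ 0`. -/
def counit (Δ : A →ₗ[ℂ] M (A ⊗[ℂ] A)) : A →ₗ[ℂ] ℂ :=
  Classical.epsilon (IsCounit Δ)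

/-- `S : A → A` is an antipode: `m(S ⊗ id)(Δ(a)(1 ⊗ b)) = ε(a)b` and
`m(id ⊗ S)((a ⊗ 1)Δ(b)) = ε(b)a`, where `m` is the product of `A` and `ε` the counit. -/
def IsAntipode (Δ : A →ₗ[ℂ] M (A ⊗[ℂ] A)) (S : A →ₗ[ℂ] A) : Prop :=
  (∀ (a b : A) (x : A ⊗[ℂ] A), ι x = Δ a * tmul 1 (ι b) →
    LinearMap.mul' ℂ A (TensorProduct.map S LinearMap.id x) = counit Δ a • b) ∧
  (∀ (a b : A) (x : A ⊗[ℂ] A), ι x = tmul (ι a) 1 * Δ b →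
    LinearMap.mul' ℂ A (TensorProduct.map LinearMap.id S x) = counit Δ b • a)

/-- The antipode `S : A → A` of a regular multiplier Hopf algebra `(A, Δ)`; it exists, is unique,
and is a bijective anti-homomorphism. -/
def antipode (Δ : A →ₗ[ℂ] M (A ⊗[ℂ] A)) : A →ₗ[ℂ] A :=
  Classical.epsilon (IsAntipode Δ)

/-- The antipode extended to the multiplier algebra `M(A)`. -/
def antipodeM (Δ : A →ₗ[ℂ] M (A ⊗[ℂ] A)) : M A →ₗ[ℂ] M A := extendAnti (antipode Δ)

/-- `R` is a generalized `R`-matrix for `(A, Δ)`: an invertible multiplier of `A ⊗ A` with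
`RΔ(a) = Δᶜᵒᵖ(a)R`, `(Δ ⊗ id)(R) = R¹³R²³` and `(id ⊗ Δ)(R) = R¹³R¹²`, such that `R(a ⊗ 1)` and
`(a ⊗ 1)R` lie in `A ⊗ M(A)` for all `a`. -/
structure IsRMatrix (Δ : A →ₗ[ℂ] M (A ⊗[ℂ] A)) (R : M (A ⊗[ℂ] A)) : Prop where
  isUnit : IsUnit R
  mul_comul : ∀ a : A, R * Δ a = cop Δ a * R
  comul_id : extend (comulLeft Δ) R = leg13 R * leg23 R
  id_comul : extend (comulRight Δ) R = leg13 R * leg12 R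
  mul_mem : ∀ a : A, R * tmul (ι a) 1 ∈ LinearMap.range (legs (A := A) (B := A))
  mem_mul : ∀ a : A, tmul (ι a) 1 * R ∈ LinearMap.range (legs (A := A) (B := A))

/-- `u` is the multiplier given by `u a = ∑ S(R⁽²⁾) R⁽¹⁾ a`, where
`R(a ⊗ 1) = ∑ R⁽¹⁾ a ⊗ R⁽²⁾` in `A ⊗ M(A)`: if `R(a ⊗ 1)` is the image of
`t = ∑ xᵢ ⊗ mᵢ ∈ A ⊗ M(A)`, then `u a = ∑ S(mᵢ) xᵢ`. -/
def IsDrinfeldMultiplier (Δ : A →ₗ[ℂ] M (A ⊗[ℂ] A)) (R : M (A ⊗[ℂ] A)) (u : M A) : Prop :=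
  ∀ (a : A) (t : A ⊗[ℂ] M A), legs t = R * tmul (ι a) 1 →
    ι (u.l a) = LinearMap.mul' ℂ (M A)
      (TensorProduct.map (antipodeM Δ) ι (TensorProduct.comm ℂ A (M A) t))

/-- An invertible multiplier `g` is grouplike if `Δ(g) = g ⊗ g` in `M(A ⊗ A)`. -/
def IsGrouplike (Δ : A →ₗ[ℂ] M (A ⊗[ℂ] A)) (g : (M A)ˣ) : Prop :=
  extend Δ (g : M A) = tmul (g : M A) (g : M A)

end HopfStructure

end

end MultiplierHopf

/-! # The Drinfeld multiplier of a quasitriangular multiplier Hopf algebra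

The whole argument takes place with linear operators on tensor powers of `A`; multipliers enter
through their left actions. The comultiplication is replaced by the Galois maps
`W(a ⊗ b) = Δ(a)(1 ⊗ b)` and `V(a ⊗ b) = (a ⊗ 1)Δ(b)`, which are automorphisms of `A ⊗ A`. In these
terms `Δ(m) = W(m ⊗ 1)W⁻¹` for `m ∈ M(A)` (`extend_comul_l`), coassociativity is `V₁₂W₂₃ = W₂₃V₁₂`
(`V₁₂_W₂₃`) or the pentagon equation (`pentagon`), the counit is determined by `m W⁻¹ = ε ⊗ id`, and
the antipode by `θ = (ε ⊗ id)W⁻¹` for `θ(a ⊗ b) = S(a)b`. Since `θ` is `Δ`-invariant,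
`θ(Δ(b)z) = ε(b)θ(z)`, and any `Δ`-invariant map `F` satisfies `F(ba ⊗ c) = F(a ⊗ S(b)c)`
(`apply_mul_tmul_of_invariant`), one obtains that `S` is an anti-homomorphism and that the antipode
of `Δᶜᵒᵖ` is its inverse.

The axioms of the `R`-matrix become `W₁₂R₁₃ = R₁₃R₂₃W₁₂` and `W₂₃R₁₂ = R₁₃R₁₂W₂₃`. Applying the
counit gives `(ε ⊗ id)(R) = 1 = (id ⊗ ε)(R)`, and applying `θ` gives `θ₁₂R₁₃R₂₃ = θ₁₂` and
`θ₂₃R₁₃R₁₂ = θ₂₃` (`contract₁₂_antiMul`, `contract₂₃_antiMul`), the operator form of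
`(S ⊗ id)(R) = R⁻¹` and `(id ⊗ S)(R⁻¹) = R`. Hence `(S ⊗ S)(R) = R` (`r_map_antipode`). The relation
`RΔ = ΔᶜᵒᵖR` yields the Yang-Baxter equation (`yang_baxter`).

The multiplier `u` is characterized by `S(c)ua = ∑ S(R⁽²⁾c)R⁽¹⁾a`, whose right side is a linear map
applied to `R(a ⊗ c) ∈ A ⊗ A`. That map is `Δ`-invariant, so `u(ba) = S²(b)ua`; this makes `u` a
multiplier implementing `S²`. It acts surjectively because `R` does, and injectively because
`R⁻¹` provides an invariant map for `Δᶜᵒᵖ` from which `S⁻¹(c)a` is recovered (`exists_drinfeld`).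

For the comultiplication of `u`, consider `f(p, q, r, s) = S(s)p ⊗ S(r)q` on four legs. The
relations above give `f R₂₁R₁₂W₁₂W₃₄R₁₃ = f R₁₄R₂₃W₁₂W₃₄`. As `S` reverses the comultiplication
(`antipodeFlip_W`) and `σ(R)R` commutes with `Δ(A)`, this identity reads `σ(R)RΔ(u) = u ⊗ u`
(`flip_mul_extend_drinfeld`). The anti-automorphism `(S ⊗ S)σ` exchanges `R` and `σ(R)` and takes it
to `Δ(S(u))σ(R)R = S(u) ⊗ S(u)`. Dividing the two gives `Δ(g) = g ⊗ g` for `g = uS(u)⁻¹`, and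
`S⁴(a) = gag⁻¹` follows from `S²(a)u = ua` and its image under `S`.
-/

namespace MultiplierHopf
noncomputable section

set_option linter.unusedSectionVars false

/-! ### Joint injectivity on tensor products -/

section Slices

variable {U V W : Type*} [AddCommGroup U] [Module ℂ U] [AddCommGroup V] [Module ℂ V]
  [AddCommGroup W] [Module ℂ W]

/-- The slices `id ⊗ η`, for linear functionals `η`, separate the points of a tensor product. -/
theorem tensor_eq_zero_of_slices (t : U ⊗[ℂ] V)
    (h : ∀ η : V →ₗ[ℂ] ℂ, TensorProduct.rid ℂ U (LinearMap.lTensor U η t) = 0) : t = 0 := by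
  classical
  let b := Module.Basis.ofVectorSpace ℂ V
  refine (TensorProduct.equivFinsuppOfBasisRight (M := U) b).injective ?_
  ext i
  rw [TensorProduct.equivFinsuppOfBasisRight_apply, map_zero, Finsupp.zero_apply]
  exact h (b.coord i)

/-- A jointly injective family of linear maps stays jointly injective after tensoring with `V`.
This is how identities in `A ⊗ A` and `A ⊗ A ⊗ A` are tested on products. -/
theorem eq_zero_of_rTensor {κ : Sort*} (f : κ → U →ₗ[ℂ] W) (hf : ∀ u, (∀ i, f i u = 0) → u = 0)
    (t : U ⊗[ℂ] V) (h : ∀ i, LinearMap.rTensor V (f i) t = 0) : t = 0 := by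
  refine tensor_eq_zero_of_slices t fun η => hf _ fun i => ?_
  have h1 : ∀ t : U ⊗[ℂ] V, f i (TensorProduct.rid ℂ U (LinearMap.lTensor U η t)) =
      TensorProduct.rid ℂ W (LinearMap.lTensor W η (LinearMap.rTensor V (f i) t)) := by
    intro t
    induction t with
    | zero => simp
    | add x y hx hy => simp only [map_add, hx, hy]
    | tmul x y => simp
  rw [h1, h i, map_zero, map_zero]

theorem eq_zero_of_lTensor {κ : Sort*} (f : κ → V →ₗ[ℂ] W) (hf : ∀ u, (∀ i, f i u = 0) → u = 0)
    (t : U ⊗[ℂ] V) (h : ∀ i, LinearMap.lTensor U (f i) t = 0) : t = 0 := by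
  refine (TensorProduct.comm ℂ U V).injective ?_
  rw [map_zero]
  refine eq_zero_of_rTensor f hf _ fun i => ?_
  rw [← LinearMap.comm_comp_lTensor_comp_comm_eq]
  simp [h i]

theorem eq_zero_of_map {κ κ' : Sort*} {W' : Type*} [AddCommGroup W'] [Module ℂ W']
    (f : κ → U →ₗ[ℂ] W) (hf : ∀ u, (∀ i, f i u = 0) → u = 0)
    (g : κ' → V →ₗ[ℂ] W') (hg : ∀ u, (∀ i, g i u = 0) → u = 0)
    (t : U ⊗[ℂ] V) (h : ∀ i j, TensorProduct.map (f i) (g j) t = 0) : t = 0 := by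
  refine eq_zero_of_lTensor g hg t fun j => eq_zero_of_rTensor f hf _ fun i => ?_
  rw [← LinearMap.comp_apply, LinearMap.rTensor_comp_lTensor]
  exact h i j

end Slices

/-! ### Calculus of multipliers -/

section Calculus

variable {A : Type*} [NonUnitalRing A] [Module ℂ A] [IsScalarTower ℂ A A] [SMulCommClass ℂ A A]
variable {B : Type*} [NonUnitalRing B] [Module ℂ B] [IsScalarTower ℂ B B] [SMulCommClass ℂ B B]

theorem mul_tmul_eq_map (x : A ⊗[ℂ] B) (a : A) (b : B) : x * a ⊗ₜ b =
    TensorProduct.map (LinearMap.mulRight ℂ a) (LinearMap.mulRight ℂ b) x := by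
  induction x with
  | zero => simp
  | add x y hx hy => simp only [add_mul, map_add, hx, hy]
  | tmul x y => simp

theorem tmul_mul_eq_map (x : A ⊗[ℂ] B) (a : A) (b : B) : a ⊗ₜ b * x =
    TensorProduct.map (LinearMap.mulLeft ℂ a) (LinearMap.mulLeft ℂ b) x := by
  induction x with
  | zero => simp
  | add x y hx hy => simp only [mul_add, map_add, hx, hy]
  | tmul x y => simp

theorem NondegenerateProduct.tensor (hA : NondegenerateProduct A) (hB : NondegenerateProduct B) :
    NondegenerateProduct (A ⊗[ℂ] B) := by
  constructor
  · intro x hx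
    refine eq_zero_of_map (fun a : A => LinearMap.mulRight ℂ a) (fun u h => hA.1 u h)
      (fun b : B => LinearMap.mulRight ℂ b) (fun u h => hB.1 u h) x fun a b => ?_
    rw [← mul_tmul_eq_map, hx]
  · intro x hx
    refine eq_zero_of_map (fun a : A => LinearMap.mulLeft ℂ a) (fun u h => hA.2 u h)
      (fun b : B => LinearMap.mulLeft ℂ b) (fun u h => hB.2 u h) x fun a b => ?_
    rw [← tmul_mul_eq_map, hx]

theorem NondegenerateProduct.eq_of_mul_right (hA : NondegenerateProduct A) {x y : A}
    (h : ∀ a, x * a = y * a) : x = y :=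
  sub_eq_zero.1 (hA.1 _ fun a => by rw [sub_mul, h, sub_self])

theorem NondegenerateProduct.eq_of_mul_left (hA : NondegenerateProduct A) {x y : A}
    (h : ∀ a, a * x = a * y) : x = y :=
  sub_eq_zero.1 (hA.2 _ fun a => by rw [mul_sub, h, sub_self])

theorem NondegenerateProduct.eq_of_mul_tmul (h : NondegenerateProduct (A ⊗[ℂ] B))
    {x y : A ⊗[ℂ] B} (hxy : ∀ a b, x * a ⊗ₜ b = y * a ⊗ₜ b) : x = y :=
  h.eq_of_mul_right fun w => by
    induction w with
    | zero => simp
    | add p q hp hq => simp only [mul_add, hp, hq]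
    | tmul a b => exact hxy a b

theorem NondegenerateProduct.eq_of_tmul_mul (h : NondegenerateProduct (A ⊗[ℂ] B))
    {x y : A ⊗[ℂ] B} (hxy : ∀ a b, a ⊗ₜ b * x = a ⊗ₜ b * y) : x = y :=
  h.eq_of_mul_left fun w => by
    induction w with
    | zero => simp
    | add p q hp hq => simp only [add_mul, hp, hq]
    | tmul a b => exact hxy a b

theorem rTensor_mulRight_mul (z : A ⊗[ℂ] B) (a p : A) (q : B) :
    LinearMap.rTensor B (LinearMap.mulRight ℂ a) z * p ⊗ₜ q = z * (a * p) ⊗ₜ q := by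
  induction z with
  | zero => simp
  | add x y hx hy => simp only [map_add, add_mul, hx, hy]
  | tmul x y => simp [mul_assoc]

theorem lTensor_mulRight_mul (z : A ⊗[ℂ] B) (b : B) (p : A) (q : B) :
    LinearMap.lTensor A (LinearMap.mulRight ℂ b) z * p ⊗ₜ q = z * p ⊗ₜ (b * q) := by
  induction z with
  | zero => simp
  | add x y hx hy => simp only [map_add, add_mul, hx, hy]
  | tmul x y => simp [mul_assoc]

theorem mul_lTensor_mulLeft (z : A ⊗[ℂ] B) (b : B) (p : A) (q : B) :
    p ⊗ₜ q * LinearMap.lTensor A (LinearMap.mulLeft ℂ b) z = p ⊗ₜ (q * b) * z := by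
  induction z with
  | zero => simp
  | add x y hx hy => simp only [map_add, mul_add, hx, hy]
  | tmul x y => simp [mul_assoc]

theorem rTensor_mulLeft_mul (z w : A ⊗[ℂ] B) (a : A) :
    LinearMap.rTensor B (LinearMap.mulLeft ℂ a) z * w =
      LinearMap.rTensor B (LinearMap.mulLeft ℂ a) (z * w) := by
  induction z with
  | zero => simp
  | add x y hx hy => simp only [map_add, add_mul, hx, hy]
  | tmul x y =>
    induction w with
    | zero => simp
    | add p q hp hq => simp only [map_add, mul_add, hp, hq]
    | tmul p q => simp [mul_assoc]

theorem M.l_mul (hA : NondegenerateProduct A) (m : M A) (a b : A) : m.l (a * b) = m.l a * b :=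
  hA.eq_of_mul_left fun c => by rw [M.mul_l, ← mul_assoc c, M.mul_l, mul_assoc]

theorem M.r_mul (hA : NondegenerateProduct A) (m : M A) (a b : A) : m.r (a * b) = a * m.r b :=
  hA.eq_of_mul_right fun c => by rw [← M.mul_l, mul_assoc, mul_assoc, M.mul_l]

theorem M.eq_of_r (hA : NondegenerateProduct A) {m n : M A} (h : ∀ b, m.r b = n.r b) : m = n :=
  M.eq_of_l hA fun a => hA.eq_of_mul_left fun c => by rw [M.mul_l, M.mul_l, h]

theorem mul_ι (hA : NondegenerateProduct A) (m : M A) (a : A) : m * ι a = ι (m.l a) :=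
  M.eq_of_l hA fun b => M.l_mul hA m a b

theorem ι_mul (hA : NondegenerateProduct A) (m : M A) (a : A) : ι a * m = ι (m.r a) :=
  M.eq_of_l hA fun b => M.mul_l m a b

theorem ι_mul_ι (a b : A) : (ι a * ι b : M A) = ι (a * b) :=
  M.ext' (fun c => (mul_assoc a b c).symm) (fun c => mul_assoc c a b)

theorem ι_injective (hA : NondegenerateProduct A) : Function.Injective (ι (A := A)) := by
  intro x y h
  exact hA.eq_of_mul_right fun a => congrArg (fun m : M A => m.l a) h

theorem ι_l (a b : A) : (ι a).l b = a * b := rfl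

theorem ι_r (a b : A) : (ι a).r b = b * a := rfl

theorem M.one_l (a : A) : (1 : M A).l a = a := rfl

theorem M.one_r (a : A) : (1 : M A).r a = a := rfl

theorem tmul_l (m : M A) (n : M B) : (tmul m n).l = TensorProduct.map m.l n.l := rfl

theorem tmul_r (m : M A) (n : M B) : (tmul m n).r = TensorProduct.map m.r n.r := rfl

theorem M.l_comp (m n : M A) : (m * n).l = m.l ∘ₗ n.l := rfl

theorem M.r_comp (m n : M A) : (m * n).r = n.r ∘ₗ m.r := rfl

theorem tmul_mul_tmul (m m' : M A) (n n' : M B) :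
    tmul m n * tmul m' n' = tmul (m * m') (n * n') := by
  refine M.ext' (fun x => ?_) (fun x => ?_)
  · rw [M.l_comp, tmul_l, tmul_l, tmul_l, M.l_comp, M.l_comp, TensorProduct.map_comp]
  · rw [M.r_comp, tmul_r, tmul_r, tmul_r, M.r_comp, M.r_comp, TensorProduct.map_comp]

theorem tmul_one_one : tmul (1 : M A) (1 : M B) = 1 :=
  M.ext' (fun x => LinearMap.congr_fun TensorProduct.map_id x)
    (fun x => LinearMap.congr_fun TensorProduct.map_id x)

theorem ι_tmul (a : A) (b : B) : ι (a ⊗ₜ[ℂ] b) = tmul (ι a) (ι b) :=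
  M.ext' (fun x => tmul_mul_eq_map x a b) (fun x => mul_tmul_eq_map x a b)

theorem transport_l (e : A ≃ₗ[ℂ] B) (he : ∀ x y, e (x * y) = e x * e y) (m : M A) (x : A) :
    (transport e he m).l (e x) = e (m.l x) := by
  change e (m.l (e.symm (e x))) = _
  rw [e.symm_apply_apply]

theorem transport_r (e : A ≃ₗ[ℂ] B) (he : ∀ x y, e (x * y) = e x * e y) (m : M A) (x : A) :
    (transport e he m).r (e x) = e (m.r x) := by
  change e (m.r (e.symm (e x))) = _
  rw [e.symm_apply_apply]

theorem transport_mul (e : A ≃ₗ[ℂ] B) (he : ∀ x y, e (x * y) = e x * e y) (m n : M A) :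
    transport e he (m * n) = transport e he m * transport e he n := by
  refine M.ext' (fun x => ?_) (fun x => ?_) <;> obtain ⟨x, rfl⟩ := e.surjective x
  · rw [M.mul_l_apply, transport_l, transport_l, transport_l, M.mul_l_apply]
  · rw [M.mul_r_apply, transport_r, transport_r, transport_r, M.mul_r_apply]

theorem transport_ι (e : A ≃ₗ[ℂ] B) (he : ∀ x y, e (x * y) = e x * e y) (a : A) :
    transport e he (ι a) = ι (e a) := by
  refine M.ext' (fun x => ?_) (fun x => ?_) <;> obtain ⟨x, rfl⟩ := e.surjective x
  · rw [transport_l, ι_l, ι_l, he]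
  · rw [transport_r, ι_r, ι_r, he]

/-- A multiplier acting bijectively from both sides is invertible. -/
theorem M.isUnit_of_bijective (m : M A) (hl : Function.Bijective m.l)
    (hr : Function.Bijective m.r) : IsUnit m := by
  let el := LinearEquiv.ofBijective m.l hl
  let er := LinearEquiv.ofBijective m.r hr
  have hel : ∀ x, el x = m.l x := fun _ => rfl
  have her : ∀ x, er x = m.r x := fun _ => rfl
  let n : M A := M.mk el.symm.toLinearMap er.symm.toLinearMap (by
    intro a b
    obtain ⟨a, rfl⟩ := er.surjective a
    obtain ⟨b, rfl⟩ := el.surjective b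
    simp only [LinearEquiv.coe_coe, LinearEquiv.symm_apply_apply]
    rw [hel, her, M.mul_l])
  exact ⟨⟨m, n, M.ext' (fun x => el.apply_symm_apply x) (fun x => er.symm_apply_apply x),
    M.ext' (fun x => el.symm_apply_apply x) (fun x => er.apply_symm_apply x)⟩, rfl⟩

end Calculus

/-! ### Operators in two of three legs -/

section Legs

variable {A : Type*} [AddCommGroup A] [Module ℂ A]

/-- The operator `X ⊗ id` acting in the first two legs of `A ⊗ A ⊗ A`. -/
def op₁₂ (X : A ⊗[ℂ] A →ₗ[ℂ] A ⊗[ℂ] A) : (A ⊗[ℂ] A) ⊗[ℂ] A →ₗ[ℂ] (A ⊗[ℂ] A) ⊗[ℂ] A :=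
  LinearMap.rTensor A X

/-- The operator `id ⊗ X` acting in the last two legs of `A ⊗ A ⊗ A`. -/
def op₂₃ (X : A ⊗[ℂ] A →ₗ[ℂ] A ⊗[ℂ] A) : (A ⊗[ℂ] A) ⊗[ℂ] A →ₗ[ℂ] (A ⊗[ℂ] A) ⊗[ℂ] A :=
  (TensorProduct.assoc ℂ A A A).symm.toLinearMap ∘ₗ LinearMap.lTensor A X ∘ₗ
    (TensorProduct.assoc ℂ A A A).toLinearMap

/-- The operator acting as `X` in the outer two legs of `A ⊗ A ⊗ A`. -/
def op₁₃ (X : A ⊗[ℂ] A →ₗ[ℂ] A ⊗[ℂ] A) : (A ⊗[ℂ] A) ⊗[ℂ] A →ₗ[ℂ] (A ⊗[ℂ] A) ⊗[ℂ] A :=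
  (TensorProduct.rightComm ℂ A A A).toLinearMap ∘ₗ LinearMap.rTensor A X ∘ₗ
    (TensorProduct.rightComm ℂ A A A).toLinearMap

theorem op₁₂_tmul (X : A ⊗[ℂ] A →ₗ[ℂ] A ⊗[ℂ] A) (t : A ⊗[ℂ] A) (c : A) :
    op₁₂ X (t ⊗ₜ c) = X t ⊗ₜ c := rfl

theorem op₂₃_tmul (X : A ⊗[ℂ] A →ₗ[ℂ] A ⊗[ℂ] A) (a b c : A) :
    op₂₃ X ((a ⊗ₜ b) ⊗ₜ c) = (TensorProduct.assoc ℂ A A A).symm (a ⊗ₜ X (b ⊗ₜ c)) := rfl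

theorem op₁₃_tmul (X : A ⊗[ℂ] A →ₗ[ℂ] A ⊗[ℂ] A) (a b c : A) :
    op₁₃ X ((a ⊗ₜ b) ⊗ₜ c) = TensorProduct.rightComm ℂ A A A (X (a ⊗ₜ c) ⊗ₜ b) := rfl

theorem op₂₃_assoc_symm (X : A ⊗[ℂ] A →ₗ[ℂ] A ⊗[ℂ] A) (a : A) (t : A ⊗[ℂ] A) :
    op₂₃ X ((TensorProduct.assoc ℂ A A A).symm (a ⊗ₜ t)) =
      (TensorProduct.assoc ℂ A A A).symm (a ⊗ₜ X t) := by
  simp [op₂₃]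

theorem op₁₃_rightComm (X : A ⊗[ℂ] A →ₗ[ℂ] A ⊗[ℂ] A) (t : A ⊗[ℂ] A) (b : A) :
    op₁₃ X (TensorProduct.rightComm ℂ A A A (t ⊗ₜ b)) =
      TensorProduct.rightComm ℂ A A A (X t ⊗ₜ b) := by
  have : ∀ y, TensorProduct.rightComm ℂ A A A (TensorProduct.rightComm ℂ A A A y) = y := fun y =>
    (TensorProduct.rightComm ℂ A A A).apply_symm_apply y
  simp [op₁₃, this]

theorem tensor₃_induction {P : (A ⊗[ℂ] A) ⊗[ℂ] A → Prop} (h0 : P 0)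
    (hadd : ∀ x y, P x → P y → P (x + y)) (htmul : ∀ a b c, P ((a ⊗ₜ b) ⊗ₜ c)) (z) : P z := by
  induction z with
  | zero => exact h0
  | add x y hx hy => exact hadd x y hx hy
  | tmul t c =>
    induction t with
    | zero => rwa [TensorProduct.zero_tmul]
    | add x y hx hy => rw [TensorProduct.add_tmul]; exact hadd _ _ hx hy
    | tmul a b => exact htmul a b c

end Legs

/-! ### The Galois maps -/

section Hopf

variable {A : Type*} [NonUnitalRing A] [Module ℂ A] [IsScalarTower ℂ A A] [SMulCommClass ℂ A A]
variable {Δ : A →ₗ[ℂ] M (A ⊗[ℂ] A)}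

/-- The slice `ω ⊗ id : A ⊗ A → A`. -/
def sliceL (ω : A →ₗ[ℂ] ℂ) : A ⊗[ℂ] A →ₗ[ℂ] A :=
  (TensorProduct.lid ℂ A).toLinearMap ∘ₗ TensorProduct.map ω LinearMap.id

/-- The slice `id ⊗ ω : A ⊗ A → A`. -/
def sliceR (ω : A →ₗ[ℂ] ℂ) : A ⊗[ℂ] A →ₗ[ℂ] A :=
  (TensorProduct.rid ℂ A).toLinearMap ∘ₗ TensorProduct.map LinearMap.id ω

theorem sliceL_tmul (ω : A →ₗ[ℂ] ℂ) (a b : A) : sliceL ω (a ⊗ₜ b) = ω a • b := rfl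

theorem sliceR_tmul (ω : A →ₗ[ℂ] ℂ) (a b : A) : sliceR ω (a ⊗ₜ b) = ω b • a := rfl

namespace IsMultiplierHopfAlgebra

variable (h : IsMultiplierHopfAlgebra Δ)

include h in
theorem nondegenerate₂ : NondegenerateProduct (A ⊗[ℂ] A) :=
  h.nondegenerate.tensor h.nondegenerate

include h in
theorem nondegenerate₃ : NondegenerateProduct ((A ⊗[ℂ] A) ⊗[ℂ] A) :=
  h.nondegenerate₂.tensor h.nondegenerate

/-- The linear automorphism `a ⊗ b ↦ Δ(a)(1 ⊗ b)` of `A ⊗ A`. -/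
def W : A ⊗[ℂ] A ≃ₗ[ℂ] A ⊗[ℂ] A :=
  (LinearEquiv.ofInjective (T₁ Δ) h.T₁_injective).trans
    ((LinearEquiv.ofEq _ _ h.T₁_range).trans
      (LinearEquiv.ofInjective ι (ι_injective h.nondegenerate₂)).symm)

/-- The linear automorphism `a ⊗ b ↦ (a ⊗ 1)Δ(b)` of `A ⊗ A`. -/
def V : A ⊗[ℂ] A ≃ₗ[ℂ] A ⊗[ℂ] A :=
  (LinearEquiv.ofInjective (T₂ Δ) h.T₂_injective).trans
    ((LinearEquiv.ofEq _ _ h.T₂_range).trans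
      (LinearEquiv.ofInjective ι (ι_injective h.nondegenerate₂)).symm)

theorem ι_W_apply (x : A ⊗[ℂ] A) : ι (h.W x) = T₁ Δ x := by
  have := congrArg Subtype.val ((LinearEquiv.ofInjective (ι (A := A ⊗[ℂ] A))
    (ι_injective h.nondegenerate₂)).apply_symm_apply
      (LinearEquiv.ofEq _ _ h.T₁_range (LinearEquiv.ofInjective (T₁ Δ) h.T₁_injective x)))
  exact this

theorem ι_V_apply (x : A ⊗[ℂ] A) : ι (h.V x) = T₂ Δ x := by
  have := congrArg Subtype.val ((LinearEquiv.ofInjective (ι (A := A ⊗[ℂ] A))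
    (ι_injective h.nondegenerate₂)).apply_symm_apply
      (LinearEquiv.ofEq _ _ h.T₂_range (LinearEquiv.ofInjective (T₂ Δ) h.T₂_injective x)))
  exact this

theorem ι_W (a b : A) : ι (h.W (a ⊗ₜ b)) = Δ a * tmul 1 (ι b) := h.ι_W_apply _

theorem ι_V (a b : A) : ι (h.V (a ⊗ₜ b)) = tmul (ι a) 1 * Δ b := h.ι_V_apply _

theorem W_mul_tmul (a b c : A) : h.W ((a * b) ⊗ₜ c) = (Δ a).l (h.W (b ⊗ₜ c)) := by
  apply ι_injective h.nondegenerate₂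
  rw [← mul_ι h.nondegenerate₂, ι_W, ι_W, h.map_mul, mul_assoc]

theorem V_tmul_mul (c a b : A) : h.V (c ⊗ₜ (a * b)) = (Δ b).r (h.V (c ⊗ₜ a)) := by
  apply ι_injective h.nondegenerate₂
  rw [← ι_mul h.nondegenerate₂, ι_V, ι_V, h.map_mul, mul_assoc]

theorem W_tmul_mul (a b c : A) : h.W (a ⊗ₜ (b * c)) =
    LinearMap.lTensor A (LinearMap.mulRight ℂ c) (h.W (a ⊗ₜ b)) := by
  apply ι_injective h.nondegenerate₂
  refine Eq.trans ?_ (ι_mul h.nondegenerate₂ (tmul 1 (ι c)) (h.W (a ⊗ₜ b)))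
  rw [ι_W, ι_W, mul_assoc, tmul_mul_tmul, ι_mul_ι, mul_one]

theorem W_mul (a b p q : A) : h.W (a ⊗ₜ b) * p ⊗ₜ q = (Δ a).l (p ⊗ₜ (b * q)) :=
  congrArg (fun m : M (A ⊗[ℂ] A) => m.l (p ⊗ₜ q)) (h.ι_W a b)

theorem mul_V (a b p q : A) : p ⊗ₜ q * h.V (a ⊗ₜ b) = (Δ b).r ((p * a) ⊗ₜ q) :=
  congrArg (fun m : M (A ⊗[ℂ] A) => m.r (p ⊗ₜ q)) (h.ι_V a b)

theorem V_mul (a b : A) (z : A ⊗[ℂ] A) : h.V (a ⊗ₜ b) * z =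
    LinearMap.rTensor A (LinearMap.mulLeft ℂ a) ((Δ b).l z) :=
  congrArg (fun m : M (A ⊗[ℂ] A) => m.l z) (h.ι_V a b)

/-- Both sides are `(c ⊗ 1)Δ(a)(1 ⊗ b)`. -/
theorem V_W (a b c : A) : LinearMap.lTensor A (LinearMap.mulRight ℂ b) (h.V (c ⊗ₜ a)) =
    LinearMap.rTensor A (LinearMap.mulLeft ℂ c) (h.W (a ⊗ₜ b)) := by
  apply ι_injective h.nondegenerate₂
  refine (ι_mul h.nondegenerate₂ (tmul 1 (ι b)) (h.V (c ⊗ₜ a))).symm.trans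
    (Eq.trans ?_ (mul_ι h.nondegenerate₂ (tmul (ι c) 1) (h.W (a ⊗ₜ b))))
  rw [ι_W, ι_V, mul_assoc]

/-- Both sides are `Δ(q)(b ⊗ d)`. -/
theorem rTensor_mulRight_W (q b d : A) :
    LinearMap.rTensor A (LinearMap.mulRight ℂ b) (h.W (q ⊗ₜ d)) = (Δ q).l (b ⊗ₜ d) := by
  refine h.nondegenerate₂.eq_of_mul_tmul fun r s => ?_
  rw [rTensor_mulRight_mul, h.W_mul, ← M.l_mul h.nondegenerate₂,
    Algebra.TensorProduct.tmul_mul_tmul]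

/-- Both sides are `(p ⊗ q)Δ(b)`. -/
theorem lTensor_mulLeft_V (p b q : A) :
    LinearMap.lTensor A (LinearMap.mulLeft ℂ q) (h.V (p ⊗ₜ b)) = (Δ b).r (p ⊗ₜ q) := by
  refine h.nondegenerate₂.eq_of_tmul_mul fun c d => ?_
  rw [mul_lTensor_mulLeft, h.mul_V, ← M.r_mul h.nondegenerate₂,
    Algebra.TensorProduct.tmul_mul_tmul]

/-! ### Coassociativity in operator form -/

/-- `(id ⊗ Δ)(y)(1 ⊗ 1 ⊗ c)` lies in `A ⊗ A ⊗ A` and equals `W₂₃(y ⊗ c)`. -/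
theorem comulRight_mul (y : A ⊗[ℂ] A) (c : A) :
    comulRight Δ y * tmul 1 (ι c) = ι (op₂₃ h.W.toLinearMap (y ⊗ₜ c)) := by
  induction y with
  | zero => simp
  | add x y hx hy => rw [map_add, add_mul, hx, hy, TensorProduct.add_tmul, map_add, map_add]
  | tmul a b =>
    have h1 : (tmul 1 (ι c) : M ((A ⊗[ℂ] A) ⊗[ℂ] A)) =
        reassoc (tmul 1 (tmul 1 (ι c))) := by
      refine M.ext' (fun x => ?_) (fun x => ?_) <;>
      · obtain ⟨x, rfl⟩ := (TensorProduct.assoc ℂ A A A).symm.surjective x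
        rw [reassoc]
        first | rw [transport_l] | rw [transport_r]
        induction x with
        | zero => simp
        | add x y hx hy => simp only [map_add, hx, hy]
        | tmul p t =>
          induction t with
          | zero => simp
          | add x y hx hy => simp only [TensorProduct.tmul_add, map_add, hx, hy]
          | tmul q s => rfl
    have h2 : comulRight Δ (a ⊗ₜ b) = reassoc (tmul (ι a) (Δ b)) := rfl
    rw [h1, h2, reassoc, reassoc, ← transport_mul, tmul_mul_tmul, mul_one, ← h.ι_W, ← ι_tmul,
      transport_ι]
    rfl

/-- `(a ⊗ 1 ⊗ 1)(Δ ⊗ id)(x)` lies in `A ⊗ A ⊗ A` and equals `V₁₂(a ⊗ x)`. -/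
theorem mul_comulLeft (x : A ⊗[ℂ] A) (a : A) : tmul (tmul (ι a) 1) 1 * comulLeft Δ x =
    ι (op₁₂ h.V.toLinearMap ((TensorProduct.assoc ℂ A A A).symm (a ⊗ₜ x))) := by
  induction x with
  | zero => simp
  | add x y hx hy => rw [map_add, mul_add, hx, hy, TensorProduct.tmul_add, map_add, map_add,
      map_add]
  | tmul b c =>
    have h2 : comulLeft Δ (b ⊗ₜ c) = tmul (Δ b) (ι c) := rfl
    rw [h2, tmul_mul_tmul, one_mul, ← h.ι_V, ← ι_tmul]
    rfl

/-- `(Δ ⊗ id)(y)(1 ⊗ b ⊗ 1)` lies in `A ⊗ A ⊗ A`: it is `W₁₂` applied to `y` with `b` inserted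
in the middle. -/
theorem comulLeft_mul (y : A ⊗[ℂ] A) (b : A) : comulLeft Δ y * tmul (tmul 1 (ι b)) 1 =
    ι (op₁₂ h.W.toLinearMap (TensorProduct.rightComm ℂ A A A (y ⊗ₜ b))) := by
  induction y with
  | zero => simp
  | add x y hx hy => rw [map_add, add_mul, hx, hy, TensorProduct.add_tmul, map_add, map_add,
      map_add]
  | tmul a c =>
    have h2 : comulLeft Δ (a ⊗ₜ c) = tmul (Δ a) (ι c) := rfl
    rw [h2, tmul_mul_tmul, mul_one, ← h.ι_W, ← ι_tmul]
    rfl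

/-- Coassociativity: the Galois maps `V` in the first two legs and `W` in the last two commute. -/
theorem V₁₂_W₂₃ (z : (A ⊗[ℂ] A) ⊗[ℂ] A) :
    op₁₂ h.V.toLinearMap (op₂₃ h.W.toLinearMap z) =
      op₂₃ h.W.toLinearMap (op₁₂ h.V.toLinearMap z) := by
  induction z with
  | zero => simp
  | add x y hx hy => simp only [map_add, hx, hy]
  | tmul t c =>
    induction t with
    | zero => simp
    | add x y hx hy => simp only [TensorProduct.add_tmul, map_add, hx, hy]
    | tmul a b =>
      apply ι_injective h.nondegenerate₃
      rw [op₂₃_tmul, LinearEquiv.coe_coe, ← h.mul_comulLeft, op₁₂_tmul, ← h.comulRight_mul]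
      exact h.coassoc a b c _ _ (h.ι_W b c) (h.ι_V a b)

/-- Coassociativity with a linear map `f` applied to the last two legs: for `t = b ⊗ c` both sides
are `(id ⊗ f)` of `(a ⊗ 1 ⊗ 1)(Δ ⊗ id)(Δ(b)(1 ⊗ c))`. -/
theorem lTensor_comp_W (f : A ⊗[ℂ] A →ₗ[ℂ] A) (a : A) (t : A ⊗[ℂ] A) :
    LinearMap.lTensor A f (TensorProduct.assoc ℂ A A A (op₁₂ h.V.toLinearMap
      ((TensorProduct.assoc ℂ A A A).symm (a ⊗ₜ h.W t)))) =
    LinearMap.lTensor A (f ∘ₗ h.W.toLinearMap) (TensorProduct.assoc ℂ A A A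
      (op₁₂ h.V.toLinearMap ((TensorProduct.assoc ℂ A A A).symm (a ⊗ₜ t)))) := by
  have h1 := h.V₁₂_W₂₃ ((TensorProduct.assoc ℂ A A A).symm (a ⊗ₜ t))
  rw [op₂₃_assoc_symm, LinearEquiv.coe_coe h.W] at h1
  rw [h1, LinearMap.lTensor_comp]
  simp [op₂₃]

end IsMultiplierHopfAlgebra
end Hopf

/-! ### The counit -/

section Counit

variable {A : Type*} [NonUnitalRing A] [Module ℂ A] [IsScalarTower ℂ A A] [SMulCommClass ℂ A A]
variable {Δ : A →ₗ[ℂ] M (A ⊗[ℂ] A)}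

theorem exists_functional [Nontrivial A] : ∃ (a : A) (ω : A →ₗ[ℂ] ℂ), ω a = 1 := by
  obtain ⟨a, ha⟩ := exists_ne (0 : A)
  obtain ⟨ω, hω⟩ := Module.Projective.exists_dual_ne_zero ℂ ha
  exact ⟨(ω a)⁻¹ • a, ω, by simp [hω]⟩

namespace IsMultiplierHopfAlgebra

variable (h : IsMultiplierHopfAlgebra Δ)

/-- The map `id ⊗ E` with `E(b)c = m W⁻¹(b ⊗ c)` sends `(a ⊗ 1)Δ(b)` to `ab ⊗ 1`. -/
theorem lTensor_mul_symm_W (s : A ⊗[ℂ] A) (c : A) :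
    LinearMap.lTensor A (LinearMap.mul' ℂ A ∘ₗ h.W.symm.toLinearMap)
      (TensorProduct.assoc ℂ A A A (h.V s ⊗ₜ c)) = LinearMap.mul' ℂ A s ⊗ₜ c := by
  induction s with
  | zero => simp
  | add x y hx hy => simp only [map_add, TensorProduct.add_tmul, hx, hy]
  | tmul a b =>
    have key : ∀ t : A ⊗[ℂ] A, LinearMap.lTensor A (LinearMap.mul' ℂ A)
        (TensorProduct.assoc ℂ A A A
          (op₁₂ h.V.toLinearMap ((TensorProduct.assoc ℂ A A A).symm (a ⊗ₜ t)))) =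
        LinearMap.rTensor A (LinearMap.mulLeft ℂ a) (h.W t) := by
      intro t
      induction t with
      | zero => simp
      | add x y hx hy => simp only [TensorProduct.tmul_add, map_add, hx, hy]
      | tmul p q =>
        rw [← h.V_W, TensorProduct.assoc_symm_tmul, op₁₂_tmul, LinearEquiv.coe_coe]
        induction h.V (a ⊗ₜ p) with
        | zero => simp
        | add x y hx hy => simp only [TensorProduct.add_tmul, map_add, hx, hy]
        | tmul x y => simp
    have h1 := h.lTensor_comp_W (LinearMap.mul' ℂ A ∘ₗ h.W.symm.toLinearMap) a
      (h.W.symm (b ⊗ₜ c))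
    have h2 : (LinearMap.mul' ℂ A ∘ₗ h.W.symm.toLinearMap) ∘ₗ h.W.toLinearMap =
        LinearMap.mul' ℂ A := by
      ext; simp
    rw [h2, key, LinearEquiv.apply_symm_apply] at h1
    exact h1

include h in
/-- The map `E` of `lTensor_mul_symm_W` is scalar: `m W⁻¹(b ⊗ c)` is a multiple of `c`, with a
factor `ε(b)` depending only on `b`. This factor is the counit. -/
theorem exists_mul_symm_W [Nontrivial A] : ∃ ε : A →ₗ[ℂ] ℂ, ∀ b c : A,
    LinearMap.mul' ℂ A (h.W.symm (b ⊗ₜ c)) = ε b • c := by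
  obtain ⟨a, ω, hω⟩ := exists_functional (A := A)
  refine ⟨ω ∘ₗ LinearMap.mul' ℂ A ∘ₗ h.V.symm.toLinearMap ∘ₗ TensorProduct.mk ℂ A A a,
    fun b c => ?_⟩
  have h1 := congrArg (sliceL ω) (h.lTensor_mul_symm_W (h.V.symm (a ⊗ₜ b)) c)
  rw [LinearEquiv.apply_symm_apply, sliceL_tmul, TensorProduct.assoc_tmul,
    LinearMap.lTensor_tmul, sliceL_tmul, hω, one_smul] at h1
  exact h1

include h in
theorem exists_isCounit [Nontrivial A] : ∃ ε : A →ₗ[ℂ] ℂ, IsCounit Δ ε := by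
  obtain ⟨ε, hε⟩ := h.exists_mul_symm_W
  have hε' : LinearMap.mul' ℂ A ∘ₗ h.W.symm.toLinearMap = sliceL ε :=
    TensorProduct.ext' fun b c => hε b c
  refine ⟨ε, fun a b x hx => ?_, fun a b x hx => ?_⟩
  · obtain rfl : x = h.W (a ⊗ₜ b) := ι_injective h.nondegenerate₂ (hx.trans (h.ι_W a b).symm)
    refine (LinearMap.congr_fun hε' (h.W (a ⊗ₜ b))).symm.trans ?_
    simp
  · obtain rfl : x = h.V (a ⊗ₜ b) := ι_injective h.nondegenerate₂ (hx.trans (h.ι_V a b).symm)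
    obtain ⟨c, ω, hω⟩ := exists_functional (A := A)
    have h1 := congrArg (sliceR ω) (h.lTensor_mul_symm_W (a ⊗ₜ b) c)
    rw [hε', sliceR_tmul, hω, one_smul, LinearMap.mul'_apply] at h1
    rw [← h1]
    change sliceR ε _ = _
    induction h.V (a ⊗ₜ b) with
    | zero => simp
    | add x y hx hy => simp only [TensorProduct.add_tmul, map_add, hx, hy]
    | tmul x y => simp [sliceR_tmul, sliceL_tmul, hω]

include h in
theorem isCounit_counit [Nontrivial A] : IsCounit Δ (counit Δ) :=
  Classical.epsilon_spec h.exists_isCounit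

variable [Nontrivial A]

theorem sliceL_W (z : A ⊗[ℂ] A) : sliceL (counit Δ) (h.W z) = LinearMap.mul' ℂ A z := by
  induction z with
  | zero => simp
  | add x y hx hy => simp only [map_add, hx, hy]
  | tmul a b => exact h.isCounit_counit.1 a b _ (h.ι_W a b)

theorem sliceR_V (z : A ⊗[ℂ] A) : sliceR (counit Δ) (h.V z) = LinearMap.mul' ℂ A z := by
  induction z with
  | zero => simp
  | add x y hx hy => simp only [map_add, hx, hy]
  | tmul a b => exact h.isCounit_counit.2 a b _ (h.ι_V a b)

include h in
theorem exists_counit_eq_one : ∃ a : A, counit Δ a = 1 := by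
  by_contra! hne
  have h0 : ∀ a, counit Δ a = 0 := by
    intro a
    by_contra ha
    exact hne ((counit Δ a)⁻¹ • a) (by simp [ha])
  obtain ⟨x, hx⟩ := exists_ne (0 : A)
  refine hx (h.nondegenerate.1 _ fun b => ?_)
  have h1 := h.sliceL_W (x ⊗ₜ b)
  have h2 : counit Δ = 0 := LinearMap.ext h0
  rw [h2] at h1
  rw [← LinearMap.mul'_apply (R := ℂ), ← h1, sliceL]
  simp

include h in
theorem mul_surjective : Function.Surjective (LinearMap.mul' ℂ A) := by
  intro x
  obtain ⟨a, ha⟩ := h.exists_counit_eq_one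
  refine ⟨h.W.symm (a ⊗ₜ x), ?_⟩
  rw [← h.sliceL_W, LinearEquiv.apply_symm_apply, sliceL_tmul, ha, one_smul]

include h in
/-- Linear maps that agree on products agree, because `A² = A`. -/
theorem hom_ext_mul {E : Type*} [AddCommGroup E] [Module ℂ E] {f g : A →ₗ[ℂ] E}
    (hfg : ∀ a b, f (a * b) = g (a * b)) (x : A) : f x = g x := by
  obtain ⟨z, rfl⟩ := h.mul_surjective x
  induction z with
  | zero => simp
  | add x y hx hy => simp only [map_add, hx, hy]
  | tmul a b => exact hfg a b

include h in
/-- The counit is multiplicative: `(id ⊗ ε)((1 ⊗ q)z) = ε(q)(id ⊗ ε)(z)` holds for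
`z = (p ⊗ 1)Δ(b)`, and these elements span `A ⊗ A`. -/
theorem counit_mul (a b : A) : counit Δ (a * b) = counit Δ a * counit Δ b := by
  have h1 : ∀ (b : A) (y : A ⊗[ℂ] A),
      sliceR (counit Δ) ((Δ b).r y) = sliceR (counit Δ) y * b := by
    intro b y
    obtain ⟨z, rfl⟩ := h.V.surjective y
    induction z with
    | zero => simp
    | add x y hx hy => simp only [map_add, hx, hy, add_mul]
    | tmul c a => rw [← h.V_tmul_mul, sliceR_V, sliceR_V, LinearMap.mul'_apply,
        LinearMap.mul'_apply, mul_assoc]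
  have h2 : ∀ (q : A) (z : A ⊗[ℂ] A),
      sliceR (counit Δ) (LinearMap.lTensor A (LinearMap.mulLeft ℂ q) z) =
        counit Δ q • sliceR (counit Δ) z := by
    intro q z
    obtain ⟨z, rfl⟩ := h.V.surjective z
    induction z with
    | zero => simp
    | add x y hx hy => simp only [map_add, hx, hy, smul_add]
    | tmul p b =>
      rw [h.lTensor_mulLeft_V, h1, sliceR_tmul, sliceR_V, LinearMap.mul'_apply, smul_mul_assoc]
  obtain ⟨c, ω, hω⟩ := exists_functional (A := A)
  have h3 := congrArg ω (h2 a (c ⊗ₜ b))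
  simpa [sliceR_tmul, hω] using h3

/-- `(id ⊗ ε)(Δ(a)(1 ⊗ b)) = ε(b)a`. -/
theorem sliceR_W (z : A ⊗[ℂ] A) : sliceR (counit Δ) (h.W z) = sliceR (counit Δ) z := by
  induction z with
  | zero => simp
  | add x y hx hy => simp only [map_add, hx, hy]
  | tmul a b =>
    refine h.nondegenerate.eq_of_mul_left fun c => ?_
    have h1 := congrArg (sliceR (counit Δ)) (h.V_W a b c)
    have h2 : ∀ z, sliceR (counit Δ) (LinearMap.lTensor A (LinearMap.mulRight ℂ b) z) =
        counit Δ b • sliceR (counit Δ) z := by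
      intro z
      induction z with
      | zero => simp
      | add x y hx hy => simp only [map_add, hx, hy, smul_add]
      | tmul x y =>
        rw [LinearMap.lTensor_tmul, sliceR_tmul, sliceR_tmul, LinearMap.mulRight_apply,
          h.counit_mul, mul_comm, mul_smul]
    have h3 : ∀ z, sliceR (counit Δ) (LinearMap.rTensor A (LinearMap.mulLeft ℂ c) z) =
        c * sliceR (counit Δ) z := by
      intro z
      induction z with
      | zero => simp
      | add x y hx hy => simp only [map_add, hx, hy, mul_add]
      | tmul x y => rw [LinearMap.rTensor_tmul, sliceR_tmul, sliceR_tmul, LinearMap.mulLeft_apply,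
        mul_smul_comm]
    rw [h2, h3, sliceR_V] at h1
    rw [← h1, sliceR_tmul, LinearMap.mul'_apply, mul_smul_comm]

end IsMultiplierHopfAlgebra
end Counit

/-! ### The antipode -/

section Antipode

variable {A : Type*} [NonUnitalRing A] [Module ℂ A] [IsScalarTower ℂ A A] [SMulCommClass ℂ A A]
variable {Δ : A →ₗ[ℂ] M (A ⊗[ℂ] A)}

/-- The map `a ⊗ b ↦ S(a)b`. -/
def antiMul (S : A →ₗ[ℂ] A) : A ⊗[ℂ] A →ₗ[ℂ] A :=
  LinearMap.mul' ℂ A ∘ₗ TensorProduct.map S LinearMap.id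

theorem antiMul_tmul (S : A →ₗ[ℂ] A) (a b : A) : antiMul S (a ⊗ₜ b) = S a * b := rfl

theorem cop_l (a : A) (z : A ⊗[ℂ] A) : (cop Δ a).l (TensorProduct.comm ℂ A A z) =
    TensorProduct.comm ℂ A A ((Δ a).l z) :=
  transport_l _ comm_mul _ _

theorem flip_flip (m : M (A ⊗[ℂ] A)) : flip (flip m) = m := by
  refine M.ext' (fun x => ?_) (fun x => ?_) <;>
  · obtain ⟨x, rfl⟩ := (TensorProduct.comm ℂ A A).surjective x
    obtain ⟨x, rfl⟩ := (TensorProduct.comm ℂ A A).surjective x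
    rw [flip, flip]
    simp only [transport_l, transport_r]
    simp

theorem cop_cop (Δ : A →ₗ[ℂ] M (A ⊗[ℂ] A)) : cop (cop Δ) = Δ :=
  LinearMap.ext fun a => flip_flip (Δ a)

theorem IsRegular.symm (h : IsRegular Δ) : IsRegular (MultiplierHopf.cop Δ) :=
  ⟨h.cop, by rw [cop_cop]; exact h.isMultiplierHopfAlgebra⟩

namespace IsMultiplierHopfAlgebra

variable (h : IsMultiplierHopfAlgebra Δ) [Nontrivial A]

/-- The map `(ε ⊗ id)W⁻¹`, which is to become `c ⊗ b ↦ S(c)b`, is invariant for the action of `A`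
through `Δ`. -/
theorem sliceL_symm_W_comul (b : A) (z : A ⊗[ℂ] A) :
    sliceL (counit Δ) (h.W.symm ((Δ b).l z)) =
      counit Δ b • sliceL (counit Δ) (h.W.symm z) := by
  obtain ⟨z, rfl⟩ := h.W.surjective z
  rw [LinearEquiv.symm_apply_apply]
  induction z with
  | zero => simp
  | add x y hx hy => simp only [map_add, hx, hy, smul_add]
  | tmul c d =>
    rw [← h.W_mul_tmul, LinearEquiv.symm_apply_apply, sliceL_tmul, sliceL_tmul, h.counit_mul,
      mul_smul]

theorem sliceL_symm_W_mul (z : A ⊗[ℂ] A) (b : A) :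
    sliceL (counit Δ) (h.W.symm (LinearMap.lTensor A (LinearMap.mulRight ℂ b) z)) =
      sliceL (counit Δ) (h.W.symm z) * b := by
  obtain ⟨z, rfl⟩ := h.W.surjective z
  rw [LinearEquiv.symm_apply_apply]
  induction z with
  | zero => simp
  | add x y hx hy => simp only [map_add, hx, hy, add_mul]
  | tmul c d =>
    rw [← h.W_tmul_mul, LinearEquiv.symm_apply_apply, sliceL_tmul, sliceL_tmul, smul_mul_assoc]

end IsMultiplierHopfAlgebra

namespace IsRegular

variable (h : IsRegular Δ)

/-- The Galois map `a ⊗ b ↦ Δ(a)(1 ⊗ b)` of a regular multiplier Hopf algebra. -/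
abbrev W : A ⊗[ℂ] A ≃ₗ[ℂ] A ⊗[ℂ] A := h.isMultiplierHopfAlgebra.W

/-- The Galois map `a ⊗ b ↦ (a ⊗ 1)Δ(b)` of a regular multiplier Hopf algebra. -/
abbrev V : A ⊗[ℂ] A ≃ₗ[ℂ] A ⊗[ℂ] A := h.isMultiplierHopfAlgebra.V

include h in
theorem nondegenerate : NondegenerateProduct A := h.isMultiplierHopfAlgebra.nondegenerate

include h in
theorem nondegenerate₂ : NondegenerateProduct (A ⊗[ℂ] A) := h.isMultiplierHopfAlgebra.nondegenerate₂

/-- Regularity puts `Δ(a)(c ⊗ 1)` into `A ⊗ A`. -/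
theorem comm_W_cop (a c b : A) : LinearMap.lTensor A (LinearMap.mulRight ℂ b)
    (TensorProduct.comm ℂ A A (h.cop.W (a ⊗ₜ c))) = (Δ a).l (c ⊗ₜ b) := by
  have h1 : ∀ (z : A ⊗[ℂ] A) (p q : A), TensorProduct.comm ℂ A A z * p ⊗ₜ q =
      TensorProduct.comm ℂ A A (z * q ⊗ₜ p) := fun z p q => by simp [comm_mul]
  refine h.nondegenerate₂.eq_of_mul_tmul fun p q => ?_
  have h2 := cop_l (Δ := Δ) a ((c * p) ⊗ₜ (b * q))
  rw [TensorProduct.comm_tmul] at h2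
  rw [lTensor_mulRight_mul, h1, h.cop.W_mul, h2, ← M.l_mul h.nondegenerate₂,
    Algebra.TensorProduct.tmul_mul_tmul]
  exact (TensorProduct.comm ℂ A A).symm_apply_apply _

variable [Nontrivial A]

include h in
theorem exists_isAntipode : ∃ S : A →ₗ[ℂ] A, IsAntipode Δ S := by
  have H := h.isMultiplierHopfAlgebra
  obtain ⟨a₀, ha₀⟩ := H.exists_counit_eq_one
  -- `S(c) = S(a₁c)a₂` for `ε(a) = 1`, and `Δ(a)(c ⊗ 1)` lies in `A ⊗ A`
  let S : A →ₗ[ℂ] A := sliceL (counit Δ) ∘ₗ H.W.symm.toLinearMap ∘ₗ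
    (TensorProduct.comm ℂ A A).toLinearMap ∘ₗ h.cop.W.toLinearMap ∘ₗ TensorProduct.mk ℂ A A a₀
  have hS : ∀ c b, S c * b = sliceL (counit Δ) (H.W.symm (c ⊗ₜ b)) := by
    intro c b
    change sliceL (counit Δ) (H.W.symm (TensorProduct.comm ℂ A A (h.cop.W (a₀ ⊗ₜ c)))) * b = _
    rw [← H.sliceL_symm_W_mul, h.comm_W_cop, H.sliceL_symm_W_comul, ha₀, one_smul]
  have hS' : antiMul S = sliceL (counit Δ) ∘ₗ H.W.symm.toLinearMap :=
    TensorProduct.ext' fun c b => hS c b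
  refine ⟨S, fun a b x hx => ?_, fun a b x hx => ?_⟩
  · obtain rfl : x = H.W (a ⊗ₜ b) := ι_injective H.nondegenerate₂ (hx.trans (H.ι_W a b).symm)
    refine (LinearMap.congr_fun hS' (H.W (a ⊗ₜ b))).trans ?_
    simp [sliceL_tmul]
  · obtain rfl : x = H.V (a ⊗ₜ b) := ι_injective H.nondegenerate₂ (hx.trans (H.ι_V a b).symm)
    refine H.nondegenerate.eq_of_mul_right fun c => ?_
    have h1 : ∀ y : A ⊗[ℂ] A,
        LinearMap.mul' ℂ A (TensorProduct.map LinearMap.id S y) * c =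
        LinearMap.mul' ℂ A (LinearMap.lTensor A (antiMul S)
          (TensorProduct.assoc ℂ A A A (y ⊗ₜ c))) := by
      intro y
      induction y with
      | zero => simp
      | add x y hx hy => simp only [TensorProduct.add_tmul, map_add, add_mul, hx, hy]
      | tmul x y => simp [antiMul_tmul, mul_assoc]
    have h2 : ∀ t : A ⊗[ℂ] A, LinearMap.mul' ℂ A (LinearMap.lTensor A (sliceL (counit Δ))
        (TensorProduct.assoc ℂ A A A
          (op₁₂ H.V.toLinearMap ((TensorProduct.assoc ℂ A A A).symm (a ⊗ₜ t))))) =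
        a * LinearMap.mul' ℂ A t := by
      intro t
      induction t with
      | zero => simp
      | add x y hx hy => simp only [TensorProduct.tmul_add, map_add, mul_add, hx, hy]
      | tmul p q =>
        have h3 : ∀ y : A ⊗[ℂ] A, LinearMap.mul' ℂ A (LinearMap.lTensor A (sliceL (counit Δ))
            (TensorProduct.assoc ℂ A A A (y ⊗ₜ q))) = sliceR (counit Δ) y * q := by
          intro y
          induction y with
          | zero => simp
          | add x y hx hy => simp only [TensorProduct.add_tmul, map_add, add_mul, hx, hy]
          | tmul x y =>
            rw [TensorProduct.assoc_tmul, LinearMap.lTensor_tmul, sliceL_tmul, sliceR_tmul,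
              LinearMap.mul'_apply, mul_smul_comm, smul_mul_assoc]
        rw [TensorProduct.assoc_symm_tmul, op₁₂_tmul, LinearEquiv.coe_coe, h3, H.sliceR_V,
          LinearMap.mul'_apply, LinearMap.mul'_apply, mul_assoc]
    have h4 := H.lTensor_comp_W (antiMul S) a (H.W.symm (b ⊗ₜ c))
    have h5 : antiMul S ∘ₗ H.W.toLinearMap = sliceL (counit Δ) := by
      rw [hS']; ext; simp
    rw [h5, LinearEquiv.apply_symm_apply, TensorProduct.assoc_symm_tmul, op₁₂_tmul] at h4
    rw [h1, ← LinearEquiv.coe_coe H.V, h4, h2, ← H.sliceL_W, LinearEquiv.apply_symm_apply,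
      sliceL_tmul, mul_smul_comm, smul_mul_assoc]

include h in
theorem isAntipode_antipode : IsAntipode Δ (antipode Δ) :=
  Classical.epsilon_spec h.exists_isAntipode

theorem antiMul_W (z : A ⊗[ℂ] A) : antiMul (antipode Δ) (h.W z) = sliceL (counit Δ) z := by
  induction z with
  | zero => simp
  | add x y hx hy => simp only [map_add, hx, hy]
  | tmul a b => exact h.isAntipode_antipode.1 a b _ (h.isMultiplierHopfAlgebra.ι_W a b)

theorem mul_antipode_V (z : A ⊗[ℂ] A) : LinearMap.mul' ℂ A
    (TensorProduct.map LinearMap.id (antipode Δ) (h.V z)) = sliceR (counit Δ) z := by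
  induction z with
  | zero => simp
  | add x y hx hy => simp only [map_add, hx, hy]
  | tmul a b => exact h.isAntipode_antipode.2 a b _ (h.isMultiplierHopfAlgebra.ι_V a b)

include h in
/-- `S(b₁x)b₂y = ε(b)S(x)y`: the map `x ⊗ y ↦ S(x)y` is invariant for the action of `A` through
`Δ`. -/
theorem antiMul_comul (b : A) (z : A ⊗[ℂ] A) : antiMul (antipode Δ) ((Δ b).l z) =
    counit Δ b • antiMul (antipode Δ) z := by
  have h1 : ∀ z, antiMul (antipode Δ) z = sliceL (counit Δ) (h.W.symm z) := fun z => by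
    rw [← h.antiMul_W, LinearEquiv.apply_symm_apply]
  rw [h1, h1, IsMultiplierHopfAlgebra.sliceL_symm_W_comul]

include h in
/-- A map on `A ⊗ A` that is invariant for the action of `A` through `Δ` turns multiplication by
`b` in the first leg into multiplication by `S(b)` in the second leg. -/
theorem apply_mul_tmul_of_invariant {E : Type*} [AddCommGroup E] [Module ℂ E]
    (F : A ⊗[ℂ] A →ₗ[ℂ] E) (hF : ∀ b z, F ((Δ b).l z) = counit Δ b • F z) (a b c : A) :
    F ((b * a) ⊗ₜ c) = F (a ⊗ₜ (antipode Δ b * c)) := by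
  have key : F ∘ₗ LinearMap.rTensor A (LinearMap.mulRight ℂ a) =
      F ∘ₗ TensorProduct.mk ℂ A A a ∘ₗ antiMul (antipode Δ) := by
    refine (LinearMap.cancel_right (g := h.W.toLinearMap) h.W.surjective).1 ?_
    refine TensorProduct.ext' fun x y => ?_
    simp only [LinearMap.comp_apply, LinearEquiv.coe_coe, TensorProduct.mk_apply]
    rw [IsMultiplierHopfAlgebra.rTensor_mulRight_W, hF, h.antiMul_W, sliceL_tmul,
      TensorProduct.tmul_smul, map_smul]
  exact LinearMap.congr_fun key (b ⊗ₜ c)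

include h in
theorem antipode_mul (a b : A) : antipode Δ (a * b) = antipode Δ b * antipode Δ a :=
  h.nondegenerate.eq_of_mul_right fun c => by
    have h1 := h.apply_mul_tmul_of_invariant (antiMul (antipode Δ)) h.antiMul_comul b a c
    rw [antiMul_tmul, antiMul_tmul] at h1
    rw [h1, mul_assoc]

include h in
/-- Left multiplications by elements `S(c)` separate points. Surjectivity of `S` is not needed for
this, and is proved from it. -/
theorem eq_zero_of_antipode_mul (x : A) (hx : ∀ c, antipode Δ c * x = 0) : x = 0 := by
  obtain ⟨b, hb⟩ := h.isMultiplierHopfAlgebra.exists_counit_eq_one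
  refine h.nondegenerate.2 _ fun a => ?_
  have h1 := h.mul_antipode_V (a ⊗ₜ b)
  rw [sliceR_tmul, hb, one_smul] at h1
  rw [← h1]
  induction h.V (a ⊗ₜ b) with
  | zero => simp
  | add x y hx hy => simp only [map_add, add_mul, hx, hy, add_zero]
  | tmul p q => simp [mul_assoc, hx]

include h in
/-- `Δ` and `Δᶜᵒᵖ` have the same counit. -/
theorem counit_cop : counit (MultiplierHopf.cop Δ) = counit Δ := by
  have H := h.isMultiplierHopfAlgebra
  have h1 : sliceL (counit Δ) ∘ₗ h.cop.W.toLinearMap = LinearMap.mul' ℂ A := by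
    refine TensorProduct.ext' fun a b => h.nondegenerate.eq_of_mul_left fun c => ?_
    have h2 : LinearMap.rTensor A (LinearMap.mulRight ℂ b) (H.V (c ⊗ₜ a)) =
        LinearMap.rTensor A (LinearMap.mulLeft ℂ c)
          (TensorProduct.comm ℂ A A (h.cop.W (a ⊗ₜ b))) := by
      refine h.nondegenerate₂.eq_of_mul_tmul fun p q => ?_
      have h3 := cop_l (Δ := Δ) a ((b * p) ⊗ₜ q)
      rw [TensorProduct.comm_tmul] at h3
      have h4 : TensorProduct.comm ℂ A A (h.cop.W (a ⊗ₜ b)) * p ⊗ₜ q =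
          TensorProduct.comm ℂ A A (h.cop.W (a ⊗ₜ b) * q ⊗ₜ p) := by simp [comm_mul]
      rw [rTensor_mulRight_mul, H.V_mul, rTensor_mulLeft_mul, h4, h.cop.W_mul, h3]
      exact congrArg _ ((TensorProduct.comm ℂ A A).symm_apply_apply _).symm
    have h5 : ∀ z, sliceR (counit Δ) (LinearMap.rTensor A (LinearMap.mulRight ℂ b) z) =
        sliceR (counit Δ) z * b := by
      intro z
      induction z with
      | zero => simp
      | add x y hx hy => simp only [map_add, hx, hy, add_mul]
      | tmul x y => rw [LinearMap.rTensor_tmul, sliceR_tmul, sliceR_tmul,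
          LinearMap.mulRight_apply, smul_mul_assoc]
    have h6 : ∀ z, sliceR (counit Δ) (LinearMap.rTensor A (LinearMap.mulLeft ℂ c)
        (TensorProduct.comm ℂ A A z)) = c * sliceL (counit Δ) z := by
      intro z
      induction z with
      | zero => simp
      | add x y hx hy => simp only [map_add, hx, hy, mul_add]
      | tmul x y => rw [TensorProduct.comm_tmul, LinearMap.rTensor_tmul, sliceR_tmul, sliceL_tmul,
          LinearMap.mulLeft_apply, mul_smul_comm]
    have h7 := congrArg (sliceR (counit Δ)) h2
    rw [h5, h6, H.sliceR_V, LinearMap.mul'_apply] at h7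
    rw [LinearMap.comp_apply, LinearEquiv.coe_coe, ← h7, LinearMap.mul'_apply, mul_assoc]
  have h8 : sliceL (counit (MultiplierHopf.cop Δ)) = sliceL (counit Δ) := by
    refine (LinearMap.cancel_right (g := h.cop.W.toLinearMap) h.cop.W.surjective).1 ?_
    rw [h1]
    exact LinearMap.ext fun z => h.cop.sliceL_W z
  obtain ⟨x, ω, hω⟩ := exists_functional (A := A)
  ext a
  have h9 := congrArg ω (LinearMap.congr_fun h8 (a ⊗ₜ x))
  simpa [sliceL_tmul, hω] using h9

include h in
/-- The map `x ⊗ y ↦ S'(y)x`, with `S'` the antipode of `Δᶜᵒᵖ`, is `Δ`-invariant. -/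
theorem antiMul_cop_comul (b : A) (z : A ⊗[ℂ] A) :
    antiMul (antipode (MultiplierHopf.cop Δ)) (TensorProduct.comm ℂ A A ((Δ b).l z)) =
      counit Δ b • antiMul (antipode (MultiplierHopf.cop Δ)) (TensorProduct.comm ℂ A A z) := by
  rw [← cop_l, h.symm.antiMul_comul, h.counit_cop]

include h in
/-- The antipode of `Δᶜᵒᵖ` is inverse to `S`: this is `apply_mul_tmul_of_invariant` for the
invariant map `x ⊗ y ↦ S'(y)x`. -/
theorem antipode_cop_antipode (b : A) : antipode (MultiplierHopf.cop Δ) (antipode Δ b) = b := by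
  refine h.nondegenerate.eq_of_mul_right fun a => sub_eq_zero.1 ?_
  refine h.symm.eq_zero_of_antipode_mul _ fun c => ?_
  have h1 := h.apply_mul_tmul_of_invariant
    (antiMul (antipode (MultiplierHopf.cop Δ)) ∘ₗ (TensorProduct.comm ℂ A A).toLinearMap)
    h.antiMul_cop_comul a b c
  simp only [LinearMap.comp_apply, LinearEquiv.coe_coe, TensorProduct.comm_tmul, antiMul_tmul,
    h.symm.antipode_mul] at h1
  rw [mul_sub, h1, mul_assoc, sub_self]

include h in
theorem antipode_antipode_cop (b : A) : antipode Δ (antipode (MultiplierHopf.cop Δ) b) = b := by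
  have h1 := h.symm.antipode_cop_antipode b
  rwa [cop_cop] at h1

include h in
theorem antipode_bijective : Function.Bijective (antipode Δ) :=
  Function.bijective_iff_has_inverse.2
    ⟨antipode (MultiplierHopf.cop Δ), h.antipode_cop_antipode, h.antipode_antipode_cop⟩

include h in
theorem antipodeM_spec (m : M A) (a : A) :
    antipodeM Δ m * ι (antipode Δ a) = ι (antipode Δ (m.r a)) ∧
      ι (antipode Δ a) * antipodeM Δ m = ι (antipode Δ (m.l a)) :=
  Classical.epsilon_spec (existsUnique_extensionAnti h.nondegenerate (antipode Δ)
    h.antipode_mul h.antipode_bijective).exists m a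

include h in
theorem antipodeM_l (m : M A) (a : A) :
    (antipodeM Δ m).l (antipode Δ a) = antipode Δ (m.r a) := by
  apply ι_injective h.nondegenerate
  rw [← mul_ι h.nondegenerate, (h.antipodeM_spec m a).1]

include h in
theorem antipodeM_r (m : M A) (a : A) :
    (antipodeM Δ m).r (antipode Δ a) = antipode Δ (m.l a) := by
  apply ι_injective h.nondegenerate
  rw [← ι_mul h.nondegenerate, (h.antipodeM_spec m a).2]

end IsRegular
end Antipode

/-! ### Non-degenerate homomorphisms and the extension of `Δ` to multipliers -/

section Nondegenerate

variable {A : Type*} [NonUnitalRing A] [Module ℂ A] [IsScalarTower ℂ A A] [SMulCommClass ℂ A A]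
variable {B : Type*} [NonUnitalRing B] [Module ℂ B] [IsScalarTower ℂ B B] [SMulCommClass ℂ B B]
variable {C : Type*} [NonUnitalRing C] [Module ℂ C] [IsScalarTower ℂ C C] [SMulCommClass ℂ C C]
variable {D : Type*} [NonUnitalRing D] [Module ℂ D] [IsScalarTower ℂ D D] [SMulCommClass ℂ D D]

/-- A non-degenerate homomorphism `φ : A → M(B)`: a homomorphism such that both `φ(A)B` and
`Bφ(A)` span `B`. -/
structure IsNondegenerateHom (φ : A →ₗ[ℂ] M B) : Prop where
  map_mul : ∀ a b, φ (a * b) = φ a * φ b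
  span_l : Submodule.span ℂ {x : B | ∃ a b, (φ a).l b = x} = ⊤
  span_r : Submodule.span ℂ {x : B | ∃ a b, (φ a).r b = x} = ⊤

theorem IsNondegenerateHom.extend_spec {φ : A →ₗ[ℂ] M B} (hφ : IsNondegenerateHom φ)
    (hB : NondegenerateProduct B) (m : M A) (a : A) :
    extend φ m * φ a = φ (m.l a) ∧ φ a * extend φ m = φ (m.r a) :=
  Classical.epsilon_spec
    (existsUnique_extension hB φ hφ.map_mul hφ.span_l hφ.span_r).exists m a

theorem span_map_eq_top {κ κ' U U' V V' : Type*} [AddCommGroup U] [Module ℂ U] [AddCommGroup U']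
    [Module ℂ U'] [AddCommGroup V] [Module ℂ V] [AddCommGroup V'] [Module ℂ V']
    (f : κ → U →ₗ[ℂ] U') (g : κ' → V →ₗ[ℂ] V')
    (hf : Submodule.span ℂ {x | ∃ i b, f i b = x} = ⊤)
    (hg : Submodule.span ℂ {x | ∃ i b, g i b = x} = ⊤) :
    Submodule.span ℂ {x : U' ⊗[ℂ] V' | ∃ i j b, TensorProduct.map (f i) (g j) b = x} = ⊤ := by
  rw [eq_top_iff]
  rintro x -
  induction x with
  | zero => exact zero_mem _
  | add x y hx hy => exact add_mem hx hy
  | tmul p q =>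
    have hp : p ∈ Submodule.span ℂ {x | ∃ i b, f i b = x} := hf ▸ Submodule.mem_top
    have hq : q ∈ Submodule.span ℂ {x | ∃ i b, g i b = x} := hg ▸ Submodule.mem_top
    induction hp using Submodule.span_induction with
    | zero => simp
    | add x y _ _ hx hy => rw [TensorProduct.add_tmul]; exact add_mem hx hy
    | smul c x _ hx => rw [← TensorProduct.smul_tmul']; exact Submodule.smul_mem _ _ hx
    | mem x hx =>
      obtain ⟨i, b, rfl⟩ := hx
      induction hq using Submodule.span_induction with
      | zero => simp
      | add x y _ _ hx hy => rw [TensorProduct.tmul_add]; exact add_mem hx hy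
      | smul c x _ hx => rw [TensorProduct.tmul_smul]; exact Submodule.smul_mem _ _ hx
      | mem y hy =>
        obtain ⟨j, d, rfl⟩ := hy
        exact Submodule.subset_span ⟨i, j, b ⊗ₜ d, rfl⟩

theorem IsNondegenerateHom.tensorMap {φ : A →ₗ[ℂ] M C} {ψ : B →ₗ[ℂ] M D}
    (hφ : IsNondegenerateHom φ) (hψ : IsNondegenerateHom ψ) :
    IsNondegenerateHom (tensorMap φ ψ) where
  map_mul x y := by
    induction x with
    | zero => simp
    | add x x' hx hx' => simp only [add_mul, map_add, hx, hx']
    | tmul a b =>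
      induction y with
      | zero => simp
      | add y y' hy hy' => simp only [mul_add, map_add, hy, hy']
      | tmul a' b' =>
        have ht : ∀ a b, MultiplierHopf.tensorMap φ ψ (a ⊗ₜ b) = tmul (φ a) (ψ b) :=
          fun _ _ => rfl
        rw [Algebra.TensorProduct.tmul_mul_tmul, ht, ht, ht, tmul_mul_tmul, hφ.map_mul, hψ.map_mul]
  span_l := by
    rw [eq_top_iff, ← span_map_eq_top (fun a => (φ a).l) (fun b => (ψ b).l) hφ.span_l hψ.span_l]
    refine Submodule.span_mono ?_
    rintro _ ⟨a, b, z, rfl⟩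
    exact ⟨a ⊗ₜ b, z, rfl⟩
  span_r := by
    rw [eq_top_iff, ← span_map_eq_top (fun a => (φ a).r) (fun b => (ψ b).r) hφ.span_r hψ.span_r]
    refine Submodule.span_mono ?_
    rintro _ ⟨a, b, z, rfl⟩
    exact ⟨a ⊗ₜ b, z, rfl⟩

theorem IsNondegenerateHom.transport {φ : A →ₗ[ℂ] M B} {φ' : A →ₗ[ℂ] M C}
    (hφ : IsNondegenerateHom φ) (e : B ≃ₗ[ℂ] C) (he : ∀ x y, e (x * y) = e x * e y)
    (h : ∀ a, φ' a = MultiplierHopf.transport e he (φ a)) : IsNondegenerateHom φ' where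
  map_mul a b := by rw [h, h, h, hφ.map_mul, transport_mul]
  span_l := by
    rw [eq_top_iff, ← LinearEquiv.range e, LinearMap.range_eq_map, ← hφ.span_l,
      Submodule.map_span]
    refine Submodule.span_mono ?_
    rintro _ ⟨_, ⟨a, b, rfl⟩, rfl⟩
    exact ⟨a, e b, by rw [h, transport_l]; rfl⟩
  span_r := by
    rw [eq_top_iff, ← LinearEquiv.range e, LinearMap.range_eq_map, ← hφ.span_r,
      Submodule.map_span]
    refine Submodule.span_mono ?_
    rintro _ ⟨_, ⟨a, b, rfl⟩, rfl⟩
    exact ⟨a, e b, by rw [h, transport_r]; rfl⟩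

end Nondegenerate

section Comul

variable {A : Type*} [NonUnitalRing A] [Module ℂ A] [IsScalarTower ℂ A A] [SMulCommClass ℂ A A]
variable {Δ : A →ₗ[ℂ] M (A ⊗[ℂ] A)}

namespace IsMultiplierHopfAlgebra

variable (h : IsMultiplierHopfAlgebra Δ)

variable [Nontrivial A]

include h in
theorem isNondegenerateHom_ι : IsNondegenerateHom (ι (A := A)) where
  map_mul a b := (ι_mul_ι a b).symm
  span_l := by
    rw [eq_top_iff]
    rintro x -
    obtain ⟨z, rfl⟩ := h.mul_surjective x
    induction z with
    | zero => simp
    | add x y hx hy => rw [map_add]; exact add_mem hx hy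
    | tmul a b => exact Submodule.subset_span ⟨a, b, rfl⟩
  span_r := by
    rw [eq_top_iff]
    rintro x -
    obtain ⟨z, rfl⟩ := h.mul_surjective x
    induction z with
    | zero => simp
    | add x y hx hy => rw [map_add]; exact add_mem hx hy
    | tmul a b => exact Submodule.subset_span ⟨b, a, rfl⟩

include h in
theorem isNondegenerateHom_comul : IsNondegenerateHom Δ where
  map_mul := h.map_mul
  span_l := by
    rw [eq_top_iff]
    rintro x -
    induction x with
    | zero => exact zero_mem _
    | add x y hx hy => exact add_mem hx hy
    | tmul x q =>
      obtain ⟨z, rfl⟩ := h.mul_surjective x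
      induction z with
      | zero => simp
      | add x y hx hy => rw [map_add, TensorProduct.add_tmul]; exact add_mem hx hy
      | tmul p b =>
        have h1 : LinearMap.mul' ℂ A (p ⊗ₜ b) ⊗ₜ[ℂ] q =
            LinearMap.rTensor A (LinearMap.mulRight ℂ b) (p ⊗ₜ q) := rfl
        rw [h1, ← h.W.apply_symm_apply (p ⊗ₜ q)]
        induction h.W.symm (p ⊗ₜ q) with
        | zero => simp
        | add x y hx hy => rw [map_add, map_add]; exact add_mem hx hy
        | tmul x y =>
          rw [h.rTensor_mulRight_W]
          exact Submodule.subset_span ⟨x, b ⊗ₜ y, rfl⟩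
  span_r := by
    rw [eq_top_iff]
    rintro x -
    induction x with
    | zero => exact zero_mem _
    | add x y hx hy => exact add_mem hx hy
    | tmul p x =>
      obtain ⟨z, rfl⟩ := h.mul_surjective x
      induction z with
      | zero => simp
      | add x y hx hy => rw [map_add, TensorProduct.tmul_add]; exact add_mem hx hy
      | tmul b q =>
        have h1 : p ⊗ₜ[ℂ] LinearMap.mul' ℂ A (b ⊗ₜ q) =
            LinearMap.lTensor A (LinearMap.mulLeft ℂ b) (p ⊗ₜ q) := rfl
        rw [h1, ← h.V.apply_symm_apply (p ⊗ₜ q)]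
        induction h.V.symm (p ⊗ₜ q) with
        | zero => simp
        | add x y hx hy => rw [map_add, map_add]; exact add_mem hx hy
        | tmul x y =>
          rw [h.lTensor_mulLeft_V]
          exact Submodule.subset_span ⟨y, x ⊗ₜ b, rfl⟩

include h in
theorem isNondegenerateHom_comulLeft : IsNondegenerateHom (comulLeft Δ) :=
  h.isNondegenerateHom_comul.tensorMap h.isNondegenerateHom_ι

include h in
theorem isNondegenerateHom_comulRight : IsNondegenerateHom (comulRight Δ) :=
  (h.isNondegenerateHom_ι.tensorMap h.isNondegenerateHom_comul).transport
    (TensorProduct.assoc ℂ A A A).symm assoc_symm_mul fun _ => rfl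

/-- On `M(A)`, the extended comultiplication is `Δ(m) = W(m ⊗ 1)W⁻¹`. -/
theorem extend_comul_l (m : M A) (z : A ⊗[ℂ] A) :
    (extend Δ m).l (h.W z) = h.W (LinearMap.rTensor A m.l z) := by
  induction z with
  | zero => simp
  | add x y hx hy => simp only [map_add, hx, hy]
  | tmul a b =>
    apply ι_injective h.nondegenerate₂
    rw [← mul_ι h.nondegenerate₂, LinearMap.rTensor_tmul, ι_W, ι_W, ← mul_assoc,
      (h.isNondegenerateHom_comul.extend_spec h.nondegenerate₂ m a).1]

theorem extend_comul_r (m : M A) (z : A ⊗[ℂ] A) :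
    (extend Δ m).r (h.V z) = h.V (LinearMap.lTensor A m.r z) := by
  induction z with
  | zero => simp
  | add x y hx hy => simp only [map_add, hx, hy]
  | tmul a b =>
    apply ι_injective h.nondegenerate₂
    rw [← ι_mul h.nondegenerate₂, LinearMap.lTensor_tmul, ι_V, ι_V, mul_assoc,
      (h.isNondegenerateHom_comul.extend_spec h.nondegenerate₂ m b).2]

/-- The extended map `Δ ⊗ id` is `m ↦ W₁₂m₁₃W₁₂⁻¹`. -/
theorem extend_comulLeft_l (m : M (A ⊗[ℂ] A)) (z : (A ⊗[ℂ] A) ⊗[ℂ] A) :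
    (extend (comulLeft Δ) m).l (op₁₂ h.W.toLinearMap z) =
      op₁₂ h.W.toLinearMap (op₁₃ m.l z) := by
  obtain ⟨z, rfl⟩ := (TensorProduct.rightComm ℂ A A A).surjective z
  induction z with
  | zero => simp
  | add x y hx hy => simp only [map_add, hx, hy]
  | tmul y b =>
    apply ι_injective h.nondegenerate₃
    rw [← mul_ι h.nondegenerate₃, op₁₃_rightComm, ← h.comulLeft_mul, ← h.comulLeft_mul,
      ← mul_assoc, (h.isNondegenerateHom_comulLeft.extend_spec h.nondegenerate₃ m y).1]

/-- The extended map `id ⊗ Δ` is `m ↦ W₂₃m₁₂W₂₃⁻¹`. -/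
theorem extend_comulRight_l (m : M (A ⊗[ℂ] A)) (z : (A ⊗[ℂ] A) ⊗[ℂ] A) :
    (extend (comulRight Δ) m).l (op₂₃ h.W.toLinearMap z) =
      op₂₃ h.W.toLinearMap (op₁₂ m.l z) := by
  induction z with
  | zero => simp
  | add x y hx hy => simp only [map_add, hx, hy]
  | tmul y c =>
    apply ι_injective h.nondegenerate₃
    rw [← mul_ι h.nondegenerate₃, op₁₂_tmul, ← h.comulRight_mul, ← h.comulRight_mul,
      ← mul_assoc, (h.isNondegenerateHom_comulRight.extend_spec h.nondegenerate₃ m y).1]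

include h in
theorem extend_comul_mul (m n : M A) : extend Δ (m * n) = extend Δ m * extend Δ n := by
  refine M.eq_of_l h.nondegenerate₂ fun z => ?_
  obtain ⟨z, rfl⟩ := h.W.surjective z
  rw [M.mul_l_apply, h.extend_comul_l, h.extend_comul_l, h.extend_comul_l, M.l_comp,
    LinearMap.rTensor_comp_apply]

/-! ### The pentagon equation -/

/-- The map `q ↦ Δ(q)t`. -/
def comulApply (Δ : A →ₗ[ℂ] M (A ⊗[ℂ] A)) (t : A ⊗[ℂ] A) : A →ₗ[ℂ] A ⊗[ℂ] A where
  toFun q := (Δ q).l t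
  map_add' a b := by rw [map_add]; rfl
  map_smul' c a := by rw [map_smul]; rfl

theorem comulApply_apply (t : A ⊗[ℂ] A) (q : A) : comulApply Δ t q = (Δ q).l t := rfl

/-- Coassociativity in terms of `W` alone: `W₂₃W₁₂ = W₁₂W₁₃W₂₃`. After multiplication by
`c ⊗ 1 ⊗ 1` both sides can be written in terms of `V₁₂`, and `V₁₂_W₂₃` applies. -/
theorem pentagon (z : (A ⊗[ℂ] A) ⊗[ℂ] A) :
    op₂₃ h.W.toLinearMap (op₁₂ h.W.toLinearMap z) =
      op₁₂ h.W.toLinearMap (op₁₃ h.W.toLinearMap (op₂₃ h.W.toLinearMap z)) := by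
  induction z with
  | zero => simp
  | add x y hx hy => simp only [map_add, hx, hy]
  | tmul z d =>
  induction z with
  | zero => simp
  | add x y hx hy => simp only [TensorProduct.add_tmul, map_add, hx, hy]
  | tmul a b =>
  -- it suffices to compare both sides after multiplication by `c ⊗ 1 ⊗ 1`
  refine sub_eq_zero.1 (eq_zero_of_rTensor
    (fun c : A => LinearMap.rTensor A (LinearMap.mulLeft ℂ c))
    (fun u hu => eq_zero_of_rTensor (fun c : A => LinearMap.mulLeft ℂ c)
      (fun v hv => h.nondegenerate.2 v hv) u hu) _ fun c => ?_)
  rw [map_sub, sub_eq_zero]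
  have h23 : ∀ (X : A ⊗[ℂ] A →ₗ[ℂ] A ⊗[ℂ] A) z,
      LinearMap.rTensor A (LinearMap.rTensor A (LinearMap.mulLeft ℂ c)) (op₂₃ X z) =
        op₂₃ X (LinearMap.rTensor A (LinearMap.rTensor A (LinearMap.mulLeft ℂ c)) z) := by
    intro X z
    induction z with
    | zero => simp
    | add x y hx hy => simp only [map_add, hx, hy]
    | tmul z s =>
      induction z with
      | zero => simp
      | add x y hx hy => simp only [TensorProduct.add_tmul, map_add, hx, hy]
      | tmul p q =>
        rw [op₂₃_tmul, LinearMap.rTensor_tmul, LinearMap.rTensor_tmul, op₂₃_tmul]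
        induction X (q ⊗ₜ s) with
        | zero => simp
        | add x y hx hy => simp only [TensorProduct.tmul_add, map_add, hx, hy]
        | tmul x y => simp
  have hL : LinearMap.rTensor A (LinearMap.rTensor A (LinearMap.mulLeft ℂ c))
      (op₂₃ h.W.toLinearMap (op₁₂ h.W.toLinearMap ((a ⊗ₜ b) ⊗ₜ d))) =
      (TensorProduct.assoc ℂ A A A).symm
        (LinearMap.lTensor A (comulApply Δ (h.W (b ⊗ₜ d))) (h.V (c ⊗ₜ a))) := by
    rw [h23, op₁₂_tmul, LinearMap.rTensor_tmul, LinearEquiv.coe_coe, ← h.V_W]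
    induction h.V (c ⊗ₜ a) with
    | zero => simp
    | add x y hx hy => simp only [TensorProduct.add_tmul, map_add, hx, hy]
    | tmul p q =>
      rw [LinearMap.lTensor_tmul, LinearMap.mulRight_apply, op₂₃_tmul, LinearEquiv.coe_coe,
        h.W_mul_tmul, LinearMap.lTensor_tmul, comulApply_apply]
  have hR : ∀ t : A ⊗[ℂ] A, LinearMap.rTensor A (LinearMap.rTensor A (LinearMap.mulLeft ℂ c))
      (op₁₂ h.W.toLinearMap (op₁₃ h.W.toLinearMap
        ((TensorProduct.assoc ℂ A A A).symm (a ⊗ₜ t)))) =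
      (TensorProduct.assoc ℂ A A A).symm
        (LinearMap.lTensor A (comulApply Δ t) (h.V (c ⊗ₜ a))) := by
    intro t
    have hadd : ∀ x y, comulApply Δ (x + y) = comulApply Δ x + comulApply Δ y := fun x y =>
      LinearMap.ext fun q => map_add (Δ q).l x y
    have hzero : comulApply Δ 0 = 0 := LinearMap.ext fun q => map_zero (Δ q).l
    induction t with
    | zero => simp [hzero]
    | add x y hx hy =>
      simp only [TensorProduct.tmul_add, map_add, hx, hy, hadd, LinearMap.lTensor_add,
        LinearMap.add_apply]
    | tmul b d =>
      have hC : ∀ s : A ⊗[ℂ] A,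
          LinearMap.rTensor A (LinearMap.rTensor A (LinearMap.mulLeft ℂ c))
            (op₁₂ h.W.toLinearMap (TensorProduct.rightComm ℂ A A A (s ⊗ₜ b))) =
          LinearMap.rTensor A (LinearMap.lTensor A (LinearMap.mulRight ℂ b))
            (op₁₂ h.V.toLinearMap ((TensorProduct.assoc ℂ A A A).symm (c ⊗ₜ s))) := by
        intro s
        induction s with
        | zero => simp
        | add x y hx hy =>
          simp only [TensorProduct.tmul_add, TensorProduct.add_tmul, map_add, hx, hy]
        | tmul x y =>
          rw [TensorProduct.rightComm_tmul, TensorProduct.assoc_symm_tmul, op₁₂_tmul, op₁₂_tmul,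
            LinearMap.rTensor_tmul, LinearMap.rTensor_tmul, LinearEquiv.coe_coe,
            LinearEquiv.coe_coe, h.V_W]
      rw [TensorProduct.assoc_symm_tmul, op₁₃_tmul, hC, LinearEquiv.coe_coe,
        ← LinearEquiv.coe_coe h.W, ← op₂₃_tmul, h.V₁₂_W₂₃, op₁₂_tmul, LinearEquiv.coe_coe]
      induction h.V (c ⊗ₜ a) with
      | zero => simp
      | add x y hx hy => simp only [TensorProduct.add_tmul, map_add, hx, hy]
      | tmul p q =>
        rw [op₂₃_tmul, LinearEquiv.coe_coe, LinearMap.lTensor_tmul, comulApply_apply,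
          ← h.rTensor_mulRight_W]
        induction h.W (q ⊗ₜ d) with
        | zero => simp
        | add x y hx hy => simp only [TensorProduct.tmul_add, map_add, hx, hy]
        | tmul x y => simp
  rw [hL, op₂₃_tmul, hR, LinearEquiv.coe_coe]

end IsMultiplierHopfAlgebra
end Comul

/-! ### Applying maps to two of three legs -/

section ThreeLegs

variable {A : Type*} [NonUnitalRing A] [Module ℂ A] [IsScalarTower ℂ A A] [SMulCommClass ℂ A A]

theorem M.l_bijective_of_isUnit {m : M A} (hm : IsUnit m) : Function.Bijective m.l := by
  obtain ⟨u, rfl⟩ := hm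
  refine Function.bijective_iff_has_inverse.2 ⟨((u⁻¹ : (M A)ˣ) : M A).l, fun x => ?_, fun x => ?_⟩
  · rw [← M.mul_l_apply, Units.inv_mul, M.one_l]
  · rw [← M.mul_l_apply, Units.mul_inv, M.one_l]

/-- The map `f` applied to the first two legs. -/
def contract₁₂ (f : A ⊗[ℂ] A →ₗ[ℂ] A) : (A ⊗[ℂ] A) ⊗[ℂ] A →ₗ[ℂ] A ⊗[ℂ] A :=
  LinearMap.rTensor A f

/-- The map `f` applied to the last two legs. -/
def contract₂₃ (f : A ⊗[ℂ] A →ₗ[ℂ] A) : (A ⊗[ℂ] A) ⊗[ℂ] A →ₗ[ℂ] A ⊗[ℂ] A :=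
  LinearMap.lTensor A f ∘ₗ (TensorProduct.assoc ℂ A A A).toLinearMap

theorem contract₁₂_tmul (f : A ⊗[ℂ] A →ₗ[ℂ] A) (z : A ⊗[ℂ] A) (c : A) :
    contract₁₂ f (z ⊗ₜ c) = f z ⊗ₜ c := rfl

theorem contract₂₃_tmul (f : A ⊗[ℂ] A →ₗ[ℂ] A) (a b c : A) :
    contract₂₃ f ((a ⊗ₜ b) ⊗ₜ c) = a ⊗ₜ f (b ⊗ₜ c) := rfl

theorem contract₁₂_op₁₂ (f : A ⊗[ℂ] A →ₗ[ℂ] A) (X : A ⊗[ℂ] A →ₗ[ℂ] A ⊗[ℂ] A)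
    (z : (A ⊗[ℂ] A) ⊗[ℂ] A) : contract₁₂ f (op₁₂ X z) = contract₁₂ (f ∘ₗ X) z := by
  rw [contract₁₂, contract₁₂, op₁₂, LinearMap.rTensor_comp_apply]

theorem contract₂₃_op₂₃ (f : A ⊗[ℂ] A →ₗ[ℂ] A) (X : A ⊗[ℂ] A →ₗ[ℂ] A ⊗[ℂ] A)
    (z : (A ⊗[ℂ] A) ⊗[ℂ] A) : contract₂₃ f (op₂₃ X z) = contract₂₃ (f ∘ₗ X) z := by
  simp [contract₂₃, op₂₃, LinearMap.lTensor_comp]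

theorem contract₁₂_sliceL_op₁₃ (ω : A →ₗ[ℂ] ℂ) (e : A →ₗ[ℂ] A)
    (X : A ⊗[ℂ] A →ₗ[ℂ] A ⊗[ℂ] A) (hX : ∀ a b, sliceL ω (X (a ⊗ₜ b)) = ω a • e b)
    (z : (A ⊗[ℂ] A) ⊗[ℂ] A) : contract₁₂ (sliceL ω) (op₁₃ X z) =
      LinearMap.lTensor A e (contract₁₂ (sliceL ω) z) := by
  induction z using tensor₃_induction with
  | h0 => simp
  | hadd x y hx hy => simp only [map_add, hx, hy]
  | htmul p q s =>
    have h1 : ∀ t : A ⊗[ℂ] A, contract₁₂ (sliceL ω) (TensorProduct.rightComm ℂ A A A (t ⊗ₜ q)) =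
        q ⊗ₜ sliceL ω t := by
      intro t
      induction t with
      | zero => simp
      | add x y hx hy => simp only [TensorProduct.add_tmul, map_add, hx, hy, TensorProduct.tmul_add]
      | tmul x y =>
        rw [TensorProduct.rightComm_tmul, contract₁₂_tmul, sliceL_tmul, sliceL_tmul,
          TensorProduct.smul_tmul]
    rw [op₁₃_tmul, h1, hX, contract₁₂_tmul, sliceL_tmul, LinearMap.lTensor_tmul,
      TensorProduct.smul_tmul]

theorem contract₁₂_sliceL_op₂₃ (ω : A →ₗ[ℂ] ℂ) (X : A ⊗[ℂ] A →ₗ[ℂ] A ⊗[ℂ] A)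
    (z : (A ⊗[ℂ] A) ⊗[ℂ] A) : contract₁₂ (sliceL ω) (op₂₃ X z) =
      X (contract₁₂ (sliceL ω) z) := by
  induction z using tensor₃_induction with
  | h0 => simp
  | hadd x y hx hy => simp only [map_add, hx, hy]
  | htmul p q s =>
    rw [op₂₃_tmul, contract₁₂_tmul, sliceL_tmul, ← TensorProduct.smul_tmul', map_smul]
    induction X (q ⊗ₜ s) with
    | zero => simp
    | add x y hx hy => simp only [TensorProduct.tmul_add, map_add, hx, hy, smul_add]
    | tmul x y =>
      rw [TensorProduct.assoc_symm_tmul, contract₁₂_tmul, sliceL_tmul, TensorProduct.smul_tmul']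

theorem contract₂₃_sliceL_op₁₂ (ω : A →ₗ[ℂ] ℂ) (e : A →ₗ[ℂ] A)
    (X : A ⊗[ℂ] A →ₗ[ℂ] A ⊗[ℂ] A) (hX : ∀ a b, sliceR ω (X (a ⊗ₜ b)) = ω b • e a)
    (z : (A ⊗[ℂ] A) ⊗[ℂ] A) : contract₂₃ (sliceL ω) (op₁₂ X z) =
      LinearMap.rTensor A e (contract₂₃ (sliceL ω) z) := by
  induction z using tensor₃_induction with
  | h0 => simp
  | hadd x y hx hy => simp only [map_add, hx, hy]
  | htmul p q s =>
    have h1 : ∀ t : A ⊗[ℂ] A, contract₂₃ (sliceL ω) (t ⊗ₜ s) = sliceR ω t ⊗ₜ s := by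
      intro t
      induction t with
      | zero => simp
      | add x y hx hy => simp only [TensorProduct.add_tmul, map_add, hx, hy]
      | tmul x y => rw [contract₂₃_tmul, sliceL_tmul, sliceR_tmul, TensorProduct.smul_tmul]
    rw [op₁₂_tmul, h1, hX, contract₂₃_tmul, sliceL_tmul, LinearMap.rTensor_tmul,
      TensorProduct.smul_tmul]

theorem contract₂₃_sliceL_op₁₃ (ω : A →ₗ[ℂ] ℂ) (X : A ⊗[ℂ] A →ₗ[ℂ] A ⊗[ℂ] A)
    (z : (A ⊗[ℂ] A) ⊗[ℂ] A) : contract₂₃ (sliceL ω) (op₁₃ X z) =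
      X (contract₂₃ (sliceL ω) z) := by
  induction z using tensor₃_induction with
  | h0 => simp
  | hadd x y hx hy => simp only [map_add, hx, hy]
  | htmul p q s =>
    rw [op₁₃_tmul, contract₂₃_tmul, sliceL_tmul, TensorProduct.tmul_smul, map_smul]
    induction X (p ⊗ₜ s) with
    | zero => simp
    | add x y hx hy => simp only [TensorProduct.add_tmul, map_add, hx, hy, smul_add]
    | tmul x y =>
      rw [TensorProduct.rightComm_tmul, contract₂₃_tmul, sliceL_tmul, TensorProduct.tmul_smul]

/-- The flip as a linear operator on `A ⊗ A`. -/
abbrev swap (A : Type*) [AddCommGroup A] [Module ℂ A] : A ⊗[ℂ] A →ₗ[ℂ] A ⊗[ℂ] A :=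
  (TensorProduct.comm ℂ A A).toLinearMap

theorem swap_op₁₃ (X : A ⊗[ℂ] A →ₗ[ℂ] A ⊗[ℂ] A) (z : (A ⊗[ℂ] A) ⊗[ℂ] A) :
    op₁₂ (swap A) (op₁₃ X z) = op₂₃ X (op₁₂ (swap A) z) := by
  induction z using tensor₃_induction with
  | h0 => simp
  | hadd x y hx hy => simp only [map_add, hx, hy]
  | htmul p q s =>
    rw [op₁₃_tmul, op₁₂_tmul, LinearEquiv.coe_coe, TensorProduct.comm_tmul, op₂₃_tmul]
    induction X (p ⊗ₜ s) with
    | zero => simp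
    | add x y hx hy => simp only [TensorProduct.add_tmul, TensorProduct.tmul_add, map_add, hx, hy]
    | tmul x y => simp [op₁₂_tmul]

theorem swap_op₂₃ (X : A ⊗[ℂ] A →ₗ[ℂ] A ⊗[ℂ] A) (z : (A ⊗[ℂ] A) ⊗[ℂ] A) :
    op₁₂ (swap A) (op₂₃ X z) = op₁₃ X (op₁₂ (swap A) z) := by
  induction z using tensor₃_induction with
  | h0 => simp
  | hadd x y hx hy => simp only [map_add, hx, hy]
  | htmul p q s =>
    rw [op₂₃_tmul, op₁₂_tmul, LinearEquiv.coe_coe, TensorProduct.comm_tmul, op₁₃_tmul]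
    induction X (q ⊗ₜ s) with
    | zero => simp
    | add x y hx hy => simp only [TensorProduct.add_tmul, TensorProduct.tmul_add, map_add, hx, hy]
    | tmul x y => simp [op₁₂_tmul]

theorem op₁₂_comp_apply (X Y : A ⊗[ℂ] A →ₗ[ℂ] A ⊗[ℂ] A) (z : (A ⊗[ℂ] A) ⊗[ℂ] A) :
    op₁₂ (X ∘ₗ Y) z = op₁₂ X (op₁₂ Y z) := LinearMap.rTensor_comp_apply _ _ _ _

theorem op₁₂_surjective {X : A ⊗[ℂ] A →ₗ[ℂ] A ⊗[ℂ] A} (hX : Function.Surjective X) :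
    Function.Surjective (op₁₂ X) := LinearMap.rTensor_surjective A hX

theorem op₂₃_surjective {X : A ⊗[ℂ] A →ₗ[ℂ] A ⊗[ℂ] A} (hX : Function.Surjective X) :
    Function.Surjective (op₂₃ X) :=
  (TensorProduct.assoc ℂ A A A).symm.surjective.comp
    ((LinearMap.lTensor_surjective A hX).comp (TensorProduct.assoc ℂ A A A).surjective)

/-- An operator commuting with all left multiplications in its first leg commutes with left
multiplication by any multiplier acting in that leg and another one. -/
theorem op₁₂_op₁₃_comm (hA : NondegenerateProduct A) (B : A ⊗[ℂ] A →ₗ[ℂ] A ⊗[ℂ] A)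
    (hB : ∀ d z, B (LinearMap.rTensor A (LinearMap.mulLeft ℂ d) z) =
      LinearMap.rTensor A (LinearMap.mulLeft ℂ d) (B z))
    (m : M (A ⊗[ℂ] A)) (z : (A ⊗[ℂ] A) ⊗[ℂ] A) :
    op₁₂ B (op₁₃ m.l z) = op₁₃ m.l (op₁₂ B z) := by
  let K : A → A → (A ⊗[ℂ] A) ⊗[ℂ] A →ₗ[ℂ] (A ⊗[ℂ] A) ⊗[ℂ] A := fun d f =>
    TensorProduct.map (LinearMap.rTensor A (LinearMap.mulLeft ℂ d)) (LinearMap.mulLeft ℂ f)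
  have hK : ∀ d f z, K d f (op₁₂ B z) = op₁₂ B (K d f z) := by
    intro d f z
    induction z with
    | zero => simp
    | add x y hx hy => simp only [map_add, hx, hy]
    | tmul t s =>
      simp only [K, op₁₂_tmul, TensorProduct.map_tmul, hB]
  have hrc : ∀ d f (t : A ⊗[ℂ] A) (q : A), K d f (TensorProduct.rightComm ℂ A A A (t ⊗ₜ q)) =
      TensorProduct.rightComm ℂ A A A ((d ⊗ₜ f * t) ⊗ₜ q) := by
    intro d f t q
    induction t with
    | zero => simp
    | add x y hx hy => simp only [TensorProduct.add_tmul, mul_add, map_add, hx, hy]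
    | tmul x y => simp [K]
  have hKm : ∀ d f z, K d f (op₁₃ m.l z) =
      op₁₃ (LinearMap.mulLeft ℂ (m.r (d ⊗ₜ f))) z := by
    intro d f z
    induction z using tensor₃_induction with
    | h0 => simp
    | hadd x y hx hy => simp only [map_add, hx, hy]
    | htmul p q s => rw [op₁₃_tmul, op₁₃_tmul, hrc, M.mul_l, LinearMap.mulLeft_apply]
  have hw : ∀ (w : A ⊗[ℂ] A) z, op₁₂ B (op₁₃ (LinearMap.mulLeft ℂ w) z) =
      op₁₃ (LinearMap.mulLeft ℂ w) (op₁₂ B z) := by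
    intro w z
    have hadd : ∀ (x y : A ⊗[ℂ] A) z, op₁₃ (LinearMap.mulLeft ℂ (x + y)) z =
        op₁₃ (LinearMap.mulLeft ℂ x) z + op₁₃ (LinearMap.mulLeft ℂ y) z := by
      intro x y z
      induction z using tensor₃_induction with
      | h0 => simp
      | hadd x y hx hy => simp only [map_add, hx, hy]; abel
      | htmul p q s => simp [op₁₃_tmul, add_mul, TensorProduct.add_tmul]
    have hzero : ∀ z, op₁₃ (LinearMap.mulLeft ℂ (0 : A ⊗[ℂ] A)) z = 0 := by
      intro z
      induction z using tensor₃_induction with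
      | h0 => simp
      | hadd x y hx hy => simp only [map_add, hx, hy, add_zero]
      | htmul p q s => simp [op₁₃_tmul]
    have hpure : ∀ d f z, op₁₃ (LinearMap.mulLeft ℂ (d ⊗ₜ[ℂ] f)) z = K d f z := by
      intro d f z
      induction z using tensor₃_induction with
      | h0 => simp
      | hadd x y hx hy => simp only [map_add, hx, hy]
      | htmul p q s => simp [op₁₃_tmul, K]
    induction w with
    | zero => rw [hzero, hzero, map_zero]
    | add x y hx hy => simp only [hadd, map_add, hx, hy]
    | tmul d f => rw [hpure, hpure, hK]
  refine sub_eq_zero.1 (eq_zero_of_map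
    (fun c : A => LinearMap.rTensor A (LinearMap.mulLeft ℂ c))
    (fun u hu => eq_zero_of_rTensor (fun c : A => LinearMap.mulLeft ℂ c)
      (fun v hv => hA.2 v hv) u hu)
    (fun c : A => LinearMap.mulLeft ℂ c) (fun v hv => hA.2 v hv) _ fun d f => ?_)
  change K d f _ = 0
  rw [map_sub, sub_eq_zero, hK, hKm, hKm, hw]

end ThreeLegs

/-! ### Slicing multipliers with the counit -/

namespace IsRegular

variable {A : Type*} [NonUnitalRing A] [Module ℂ A] [IsScalarTower ℂ A A] [SMulCommClass ℂ A A]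
variable {Δ : A →ₗ[ℂ] M (A ⊗[ℂ] A)} (h : IsRegular Δ) [Nontrivial A]

include h in
theorem sliceL_mul (x y : A ⊗[ℂ] A) :
    sliceL (counit Δ) (x * y) = sliceL (counit Δ) x * sliceL (counit Δ) y := by
  induction x with
  | zero => simp
  | add x x' hx hx' => simp only [add_mul, map_add, hx, hx']
  | tmul a b =>
    induction y with
    | zero => simp
    | add y y' hy hy' => simp only [mul_add, map_add, hy, hy']
    | tmul c d =>
      rw [Algebra.TensorProduct.tmul_mul_tmul, sliceL_tmul, sliceL_tmul, sliceL_tmul,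
        h.isMultiplierHopfAlgebra.counit_mul, smul_mul_smul_comm]

include h in
theorem sliceR_mul (x y : A ⊗[ℂ] A) :
    sliceR (counit Δ) (x * y) = sliceR (counit Δ) x * sliceR (counit Δ) y := by
  induction x with
  | zero => simp
  | add x x' hx hx' => simp only [add_mul, map_add, hx, hx']
  | tmul a b =>
    induction y with
    | zero => simp
    | add y y' hy hy' => simp only [mul_add, map_add, hy, hy']
    | tmul c d =>
      rw [Algebra.TensorProduct.tmul_mul_tmul, sliceR_tmul, sliceR_tmul, sliceR_tmul,
        h.isMultiplierHopfAlgebra.counit_mul, smul_mul_smul_comm]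

include h in
/-- The counit can be applied in the first leg of any multiplier of `A ⊗ A`. -/
theorem exists_sliceL (m : M (A ⊗[ℂ] A)) :
    ∃ e : A →ₗ[ℂ] A, ∀ a b, sliceL (counit Δ) (m.l (a ⊗ₜ b)) = counit Δ a • e b := by
  obtain ⟨a₀, ha₀⟩ := h.isMultiplierHopfAlgebra.exists_counit_eq_one
  refine ⟨sliceL (counit Δ) ∘ₗ m.l ∘ₗ TensorProduct.mk ℂ A A a₀, fun a b => ?_⟩
  refine h.nondegenerate.eq_of_mul_left fun f => ?_
  have h1 : ∀ a, f * sliceL (counit Δ) (m.l (a ⊗ₜ b)) =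
      counit Δ a • (sliceL (counit Δ) (m.r (a₀ ⊗ₜ f)) * b) := by
    intro a
    have h2 := congrArg (sliceL (counit Δ)) (M.mul_l m (a₀ ⊗ₜ f) (a ⊗ₜ b))
    rwa [h.sliceL_mul, h.sliceL_mul, sliceL_tmul, sliceL_tmul, ha₀, one_smul,
      mul_smul_comm] at h2
  simp only [LinearMap.comp_apply, TensorProduct.mk_apply]
  rw [h1, mul_smul_comm, h1, ha₀, one_smul]

include h in
theorem exists_sliceR (m : M (A ⊗[ℂ] A)) :
    ∃ e : A →ₗ[ℂ] A, ∀ a b, sliceR (counit Δ) (m.l (a ⊗ₜ b)) = counit Δ b • e a := by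
  obtain ⟨a₀, ha₀⟩ := h.isMultiplierHopfAlgebra.exists_counit_eq_one
  refine ⟨sliceR (counit Δ) ∘ₗ m.l ∘ₗ (TensorProduct.mk ℂ A A).flip a₀, fun a b => ?_⟩
  refine h.nondegenerate.eq_of_mul_left fun f => ?_
  have h1 : ∀ b, f * sliceR (counit Δ) (m.l (a ⊗ₜ b)) =
      counit Δ b • (sliceR (counit Δ) (m.r (f ⊗ₜ a₀)) * a) := by
    intro b
    have h2 := congrArg (sliceR (counit Δ)) (M.mul_l m (f ⊗ₜ a₀) (a ⊗ₜ b))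
    rwa [h.sliceR_mul, h.sliceR_mul, sliceR_tmul, sliceR_tmul, ha₀, one_smul,
      mul_smul_comm] at h2
  simp only [LinearMap.comp_apply, TensorProduct.mk_apply, LinearMap.flip_apply]
  rw [h1, mul_smul_comm, h1, ha₀, one_smul]

include h in
theorem antiMul_comp_W :
    antiMul (antipode Δ) ∘ₗ h.W.toLinearMap = sliceL (counit Δ) :=
  LinearMap.ext fun z => h.antiMul_W z

include h in
/-- With `θ(a ⊗ b) = S(a)b`: `θ₂₃W₁₂W₁₃ = θ₂₃`. The pentagon equation reduces this to
`(id ⊗ ε)W = id ⊗ ε`. -/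
theorem contract₂₃_antiMul_W (z : (A ⊗[ℂ] A) ⊗[ℂ] A) :
    contract₂₃ (antiMul (antipode Δ))
      (op₁₂ h.W.toLinearMap (op₁₃ h.W.toLinearMap z)) =
      contract₂₃ (antiMul (antipode Δ)) z := by
  obtain ⟨z, rfl⟩ := op₂₃_surjective (X := h.W.toLinearMap) h.W.surjective z
  rw [← h.isMultiplierHopfAlgebra.pentagon, contract₂₃_op₂₃, contract₂₃_op₂₃, h.antiMul_comp_W,
    contract₂₃_sliceL_op₁₂ _ LinearMap.id _
      (fun a b => h.isMultiplierHopfAlgebra.sliceR_W (a ⊗ₜ b)), LinearMap.rTensor_id,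
    LinearMap.id_apply]

end IsRegular

/-! ### The `R`-matrix in three legs -/

namespace IsRMatrix

variable {A : Type*} [NonUnitalRing A] [Module ℂ A] [IsScalarTower ℂ A A] [SMulCommClass ℂ A A]
variable {Δ : A →ₗ[ℂ] M (A ⊗[ℂ] A)} {R : M (A ⊗[ℂ] A)}
variable (hR : IsRMatrix Δ R) (h : IsRegular Δ) [Nontrivial A]

theorem leg12_l (R : M (A ⊗[ℂ] A)) : (leg12 R).l = op₁₂ R.l := rfl

theorem leg13_l (R : M (A ⊗[ℂ] A)) : (leg13 R).l = op₁₃ R.l := rfl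

theorem leg23_l (R : M (A ⊗[ℂ] A)) : (leg23 R).l = op₂₃ R.l := rfl

include hR in
/-- `(Δ ⊗ id)(R) = R¹³R²³`, as an identity of operators. -/
theorem comul_id_op (z : (A ⊗[ℂ] A) ⊗[ℂ] A) :
    op₁₂ h.W.toLinearMap (op₁₃ R.l z) = op₁₃ R.l (op₂₃ R.l (op₁₂ h.W.toLinearMap z)) := by
  rw [← h.isMultiplierHopfAlgebra.extend_comulLeft_l, hR.comul_id, M.mul_l_apply, leg13_l, leg23_l]

include hR in
/-- `(id ⊗ Δ)(R) = R¹³R¹²`, as an identity of operators. -/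
theorem id_comul_op (z : (A ⊗[ℂ] A) ⊗[ℂ] A) :
    op₂₃ h.W.toLinearMap (op₁₂ R.l z) = op₁₃ R.l (op₁₂ R.l (op₂₃ h.W.toLinearMap z)) := by
  rw [← h.isMultiplierHopfAlgebra.extend_comulRight_l, hR.id_comul, M.mul_l_apply, leg13_l,
    leg12_l]

/-! ### The counit in a leg of the `R`-matrix -/

include hR h in
/-- `(ε ⊗ id)(R) = 1`: applying `ε` to the first leg of `(Δ ⊗ id)(R) = R¹³R²³` gives `R = eR` with
`e = (ε ⊗ id)(R)` in the second leg, and `R` is invertible. -/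
theorem sliceL_l (a b : A) : sliceL (counit Δ) (R.l (a ⊗ₜ b)) = counit Δ a • b := by
  obtain ⟨e, he⟩ := h.exists_sliceL R
  suffices hb : ∀ b, e b = b by rw [he, hb]
  have H := h.isMultiplierHopfAlgebra
  have hW : sliceL (counit Δ) ∘ₗ h.W.toLinearMap = LinearMap.mul' ℂ A :=
    LinearMap.ext fun z => H.sliceL_W z
  have h1 : ∀ a b c : A, R.l ((a * b) ⊗ₜ c) = LinearMap.lTensor A e (R.l ((a * b) ⊗ₜ c)) := by
    intro a b c
    have h2 := congrArg (contract₁₂ (sliceL (counit Δ))) (hR.comul_id_op h ((a ⊗ₜ b) ⊗ₜ c))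
    rw [contract₁₂_op₁₂, hW, contract₁₂_sliceL_op₁₃ _ e _ he, contract₁₂_sliceL_op₂₃,
      contract₁₂_op₁₂, hW, contract₁₂_tmul, LinearMap.mul'_apply] at h2
    rw [← h2, op₁₃_tmul]
    have h3 : ∀ t : A ⊗[ℂ] A, contract₁₂ (LinearMap.mul' ℂ A)
        (TensorProduct.rightComm ℂ A A A (t ⊗ₜ b)) =
        LinearMap.rTensor A (LinearMap.mulRight ℂ b) t := by
      intro t
      induction t with
      | zero => simp
      | add x y hx hy => simp only [TensorProduct.add_tmul, map_add, hx, hy]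
      | tmul x y => simp [contract₁₂_tmul]
    rw [h3]
    refine h.nondegenerate₂.eq_of_mul_tmul fun p q => ?_
    rw [rTensor_mulRight_mul, ← M.l_mul h.nondegenerate₂, ← M.l_mul h.nondegenerate₂,
      Algebra.TensorProduct.tmul_mul_tmul, Algebra.TensorProduct.tmul_mul_tmul, mul_assoc]
  have h2 : ∀ x c : A, R.l (x ⊗ₜ c) = LinearMap.lTensor A e (R.l (x ⊗ₜ c)) := by
    intro x c
    exact H.hom_ext_mul (f := R.l ∘ₗ (TensorProduct.mk ℂ A A).flip c)
      (g := LinearMap.lTensor A e ∘ₗ R.l ∘ₗ (TensorProduct.mk ℂ A A).flip c)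
      (fun a b => h1 a b c) x
  have h3 : R.l = LinearMap.lTensor A e ∘ₗ R.l := TensorProduct.ext' h2
  obtain ⟨x, ω, hω⟩ := exists_functional (A := A)
  intro b
  obtain ⟨y, hy⟩ := (M.l_bijective_of_isUnit hR.isUnit).2 (x ⊗ₜ b)
  have h4 := congrArg (sliceL ω) (LinearMap.congr_fun h3 y)
  rw [LinearMap.comp_apply, hy, LinearMap.lTensor_tmul, sliceL_tmul, sliceL_tmul, hω, one_smul,
    one_smul] at h4
  exact h4.symm

include hR h in
/-- `(id ⊗ ε)(R) = 1`, from `(id ⊗ Δ)(R) = R¹³R¹²`. -/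
theorem sliceR_l (a b : A) : sliceR (counit Δ) (R.l (a ⊗ₜ b)) = counit Δ b • a := by
  obtain ⟨e, he⟩ := h.exists_sliceR R
  suffices hb : ∀ b, e b = b by rw [he, hb]
  have H := h.isMultiplierHopfAlgebra
  have hW : sliceL (counit Δ) ∘ₗ h.W.toLinearMap = LinearMap.mul' ℂ A :=
    LinearMap.ext fun z => H.sliceL_W z
  have h1 : ∀ a b c : A, R.l (a ⊗ₜ (b * c)) = R.l (LinearMap.rTensor A e (a ⊗ₜ (b * c))) := by
    intro a b c
    have h2 := congrArg (contract₂₃ (sliceL (counit Δ))) (hR.id_comul_op h ((a ⊗ₜ b) ⊗ₜ c))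
    rw [contract₂₃_op₂₃, hW, contract₂₃_sliceL_op₁₃, contract₂₃_sliceL_op₁₂ _ e _ he,
      contract₂₃_op₂₃, hW, contract₂₃_tmul, LinearMap.mul'_apply] at h2
    rw [← h2, op₁₂_tmul]
    have h3 : ∀ t : A ⊗[ℂ] A, contract₂₃ (LinearMap.mul' ℂ A) (t ⊗ₜ c) =
        LinearMap.lTensor A (LinearMap.mulRight ℂ c) t := by
      intro t
      induction t with
      | zero => simp
      | add x y hx hy => simp only [TensorProduct.add_tmul, map_add, hx, hy]
      | tmul x y => simp [contract₂₃_tmul]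
    rw [h3]
    refine h.nondegenerate₂.eq_of_mul_tmul fun p q => ?_
    rw [lTensor_mulRight_mul, ← M.l_mul h.nondegenerate₂, ← M.l_mul h.nondegenerate₂,
      Algebra.TensorProduct.tmul_mul_tmul, Algebra.TensorProduct.tmul_mul_tmul, mul_assoc]
  have h2 : ∀ a x : A, R.l (a ⊗ₜ x) = R.l (LinearMap.rTensor A e (a ⊗ₜ x)) := by
    intro a x
    exact H.hom_ext_mul (f := R.l ∘ₗ TensorProduct.mk ℂ A A a)
      (g := R.l ∘ₗ LinearMap.rTensor A e ∘ₗ TensorProduct.mk ℂ A A a)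
      (fun b c => h1 a b c) x
  obtain ⟨x, ω, hω⟩ := exists_functional (A := A)
  intro a
  have h4 := congrArg (sliceR ω) ((M.l_bijective_of_isUnit hR.isUnit).1 (h2 a x))
  rw [LinearMap.rTensor_tmul, sliceR_tmul, sliceR_tmul, hω, one_smul, one_smul] at h4
  exact h4.symm

/-! ### The antipode in a leg of the `R`-matrix -/

include hR h in
/-- With `θ(a ⊗ b) = S(a)b`: `θ₁₂R₁₃R₂₃ = θ₁₂`, that is, `(S ⊗ id)(R)` is the inverse of `R`. -/
theorem contract₁₂_antiMul (z : (A ⊗[ℂ] A) ⊗[ℂ] A) :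
    contract₁₂ (antiMul (antipode Δ)) (op₁₃ R.l (op₂₃ R.l z)) =
      contract₁₂ (antiMul (antipode Δ)) z := by
  obtain ⟨z, rfl⟩ := op₁₂_surjective (X := h.W.toLinearMap) h.W.surjective z
  rw [← hR.comul_id_op h, contract₁₂_op₁₂, contract₁₂_op₁₂, h.antiMul_comp_W,
    contract₁₂_sliceL_op₁₃ _ LinearMap.id _ (hR.sliceL_l h), LinearMap.lTensor_id,
    LinearMap.id_apply]

include hR h in
/-- With `θ(a ⊗ b) = S(a)b`: `θ₂₃R₁₃R₁₂ = θ₂₃`, that is, `(id ⊗ S)(R⁻¹) = R`. -/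
theorem contract₂₃_antiMul (z : (A ⊗[ℂ] A) ⊗[ℂ] A) :
    contract₂₃ (antiMul (antipode Δ)) (op₁₃ R.l (op₁₂ R.l z)) =
      contract₂₃ (antiMul (antipode Δ)) z := by
  obtain ⟨z, rfl⟩ := op₂₃_surjective (X := h.W.toLinearMap) h.W.surjective z
  rw [← hR.id_comul_op h, contract₂₃_op₂₃, contract₂₃_op₂₃, h.antiMul_comp_W,
    contract₂₃_sliceL_op₁₂ _ LinearMap.id _ (hR.sliceR_l h), LinearMap.rTensor_id,
    LinearMap.id_apply]

/-! ### The Yang-Baxter equation -/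

include hR h in
/-- The Yang-Baxter equation `R₁₂R₁₃R₂₃ = R₂₃R₁₃R₁₂`, by conjugating `(Δ ⊗ id)(R) = R¹³R²³` with
`R₁₂`. Since `RΔ(d) = Δᶜᵒᵖ(d)R`, one has `RW = σWB` with an operator `B` commuting with left
multiplications in the first leg, so `B₁₂` commutes with `R₁₃`. -/
theorem yang_baxter (z : (A ⊗[ℂ] A) ⊗[ℂ] A) :
    op₁₂ R.l (op₁₃ R.l (op₂₃ R.l z)) = op₂₃ R.l (op₁₃ R.l (op₁₂ R.l z)) := by
  let B : A ⊗[ℂ] A →ₗ[ℂ] A ⊗[ℂ] A := h.W.symm.toLinearMap ∘ₗ swap A ∘ₗ R.l ∘ₗ h.W.toLinearMap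
  have hRW : ∀ z, R.l (h.W z) = swap A (h.W (B z)) := by
    intro z
    simp only [B, LinearMap.comp_apply, LinearEquiv.coe_coe, LinearEquiv.apply_symm_apply]
    exact ((TensorProduct.comm ℂ A A).symm_apply_apply _).symm
  have hWl : ∀ d z, h.W (LinearMap.rTensor A (LinearMap.mulLeft ℂ d) z) = (Δ d).l (h.W z) := by
    intro d z
    induction z with
    | zero => simp
    | add x y hx hy => simp only [map_add, hx, hy]
    | tmul a b => rw [← IsMultiplierHopfAlgebra.W_mul_tmul]; rfl
  have hB : ∀ d z, B (LinearMap.rTensor A (LinearMap.mulLeft ℂ d) z) =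
      LinearMap.rTensor A (LinearMap.mulLeft ℂ d) (B z) := by
    intro d z
    apply h.W.injective
    apply (TensorProduct.comm ℂ A A).injective
    change swap A (h.W _) = swap A (h.W _)
    rw [← hRW, hWl, hWl, ← M.mul_l_apply, hR.mul_comul, M.mul_l_apply, hRW, LinearEquiv.coe_coe,
      cop_l]
  have hRW' : ∀ z, op₁₂ R.l (op₁₂ h.W.toLinearMap z) =
      op₁₂ (swap A) (op₁₂ h.W.toLinearMap (op₁₂ B z)) := by
    intro z
    rw [← op₁₂_comp_apply, ← op₁₂_comp_apply, ← op₁₂_comp_apply]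
    congr 2
    exact LinearMap.ext hRW
  obtain ⟨z, rfl⟩ := op₁₂_surjective (X := h.W.toLinearMap) h.W.surjective z
  rw [← hR.comul_id_op h, hRW', hRW', op₁₂_op₁₃_comm h.nondegenerate B hB, hR.comul_id_op h,
    swap_op₁₃, swap_op₂₃]

end IsRMatrix

/-! ### Invariance of the `R`-matrix under the antipode -/

section

variable {A : Type*} [NonUnitalRing A] [Module ℂ A] [IsScalarTower ℂ A A] [SMulCommClass ℂ A A]

theorem M.l_rTensor_mulRight (hA : NondegenerateProduct (A ⊗[ℂ] A)) (m : M (A ⊗[ℂ] A)) (b : A)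
    (z : A ⊗[ℂ] A) : m.l (LinearMap.rTensor A (LinearMap.mulRight ℂ b) z) =
      LinearMap.rTensor A (LinearMap.mulRight ℂ b) (m.l z) :=
  hA.eq_of_mul_tmul fun p q => by
    rw [rTensor_mulRight_mul, ← M.l_mul hA, ← M.l_mul hA, rTensor_mulRight_mul]

theorem M.inv_l_l (u : (M A)ˣ) (x : A) : ((u⁻¹ : (M A)ˣ) : M A).l ((u : M A).l x) = x := by
  rw [← M.mul_l_apply, Units.inv_mul, M.one_l]

theorem M.l_inv_l (u : (M A)ˣ) (x : A) : (u : M A).l (((u⁻¹ : (M A)ˣ) : M A).l x) = x := by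
  rw [← M.mul_l_apply, Units.mul_inv, M.one_l]

theorem M.r_inv_r (u : (M A)ˣ) (x : A) : (u : M A).r (((u⁻¹ : (M A)ˣ) : M A).r x) = x := by
  rw [← M.mul_r_apply, Units.inv_mul, M.one_r]

theorem rTensor_lTensor_comm {U V U' V' : Type*} [AddCommGroup U] [Module ℂ U] [AddCommGroup V]
    [Module ℂ V] [AddCommGroup U'] [Module ℂ U'] [AddCommGroup V'] [Module ℂ V']
    (f : U →ₗ[ℂ] U') (g : V →ₗ[ℂ] V') (z : U ⊗[ℂ] V) :
    LinearMap.rTensor V' f (LinearMap.lTensor U g z) =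
      LinearMap.lTensor U' g (LinearMap.rTensor V f z) := by
  rw [← LinearMap.comp_apply, ← LinearMap.comp_apply, LinearMap.rTensor_comp_lTensor,
    LinearMap.lTensor_comp_rTensor]

end

namespace IsRMatrix

variable {A : Type*} [NonUnitalRing A] [Module ℂ A] [IsScalarTower ℂ A A] [SMulCommClass ℂ A A]
variable {Δ : A →ₗ[ℂ] M (A ⊗[ℂ] A)} {R : M (A ⊗[ℂ] A)}
variable (hR : IsRMatrix Δ R) (h : IsRegular Δ) [Nontrivial A]

/-- The `R`-matrix as a unit of `M(A ⊗ A)`. -/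
def unit : (M (A ⊗[ℂ] A))ˣ := hR.isUnit.unit

theorem coe_unit : (hR.unit : M (A ⊗[ℂ] A)) = R := hR.isUnit.unit_spec

include hR in
theorem l_inv_l (z : A ⊗[ℂ] A) : R.l ((hR.unit⁻¹ : (M (A ⊗[ℂ] A))ˣ).1.l z) = z := by
  have := M.l_inv_l hR.unit z
  rwa [hR.coe_unit] at this

include hR in
theorem inv_l_l (z : A ⊗[ℂ] A) : (hR.unit⁻¹ : (M (A ⊗[ℂ] A))ˣ).1.l (R.l z) = z := by
  have := M.inv_l_l hR.unit z
  rwa [hR.coe_unit] at this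

include h in
/-- `(S ⊗ id)(R(a ⊗ c))(b ⊗ 1) = (S(a) ⊗ 1)R⁻¹(b ⊗ c)`. -/
theorem rTensor_antipode (a b c : A) :
    LinearMap.rTensor A (LinearMap.mulRight ℂ b)
      (LinearMap.rTensor A (antipode Δ) (R.l (a ⊗ₜ c))) =
    LinearMap.rTensor A (LinearMap.mulLeft ℂ (antipode Δ a))
      ((hR.unit⁻¹ : (M (A ⊗[ℂ] A))ˣ).1.l (b ⊗ₜ c)) := by
  have h1 := hR.contract₁₂_antiMul h
    (op₂₃ (hR.unit⁻¹ : (M (A ⊗[ℂ] A))ˣ).1.l ((a ⊗ₜ b) ⊗ₜ c))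
  rw [op₂₃_tmul, op₂₃_assoc_symm, hR.l_inv_l, TensorProduct.assoc_symm_tmul, op₁₃_tmul] at h1
  have h2 : ∀ t : A ⊗[ℂ] A, contract₁₂ (antiMul (antipode Δ))
      (TensorProduct.rightComm ℂ A A A (t ⊗ₜ b)) =
      LinearMap.rTensor A (LinearMap.mulRight ℂ b) (LinearMap.rTensor A (antipode Δ) t) := by
    intro t
    induction t with
    | zero => simp
    | add x y hx hy => simp only [TensorProduct.add_tmul, map_add, hx, hy]
    | tmul x y => simp [contract₁₂_tmul, antiMul_tmul]
  have h3 : ∀ t : A ⊗[ℂ] A, contract₁₂ (antiMul (antipode Δ))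
      ((TensorProduct.assoc ℂ A A A).symm (a ⊗ₜ t)) =
      LinearMap.rTensor A (LinearMap.mulLeft ℂ (antipode Δ a)) t := by
    intro t
    induction t with
    | zero => simp
    | add x y hx hy => simp only [TensorProduct.tmul_add, map_add, hx, hy]
    | tmul x y => simp [contract₁₂_tmul, antiMul_tmul]
  rw [← h2, h1, h3]

include h in
/-- `(id ⊗ S)(R⁻¹(a ⊗ b))(1 ⊗ c) = (1 ⊗ S(b))R(a ⊗ c)`. -/
theorem lTensor_antipode (a b c : A) :
    LinearMap.lTensor A (LinearMap.mulRight ℂ c) (LinearMap.lTensor A (antipode Δ)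
      ((hR.unit⁻¹ : (M (A ⊗[ℂ] A))ˣ).1.l (a ⊗ₜ b))) =
    LinearMap.lTensor A (LinearMap.mulLeft ℂ (antipode Δ b)) (R.l (a ⊗ₜ c)) := by
  have h1 := hR.contract₂₃_antiMul h
    (op₁₂ (hR.unit⁻¹ : (M (A ⊗[ℂ] A))ˣ).1.l ((a ⊗ₜ b) ⊗ₜ c))
  rw [op₁₂_tmul, op₁₂_tmul, hR.l_inv_l, op₁₃_tmul] at h1
  have h2 : ∀ t : A ⊗[ℂ] A, contract₂₃ (antiMul (antipode Δ))
      (TensorProduct.rightComm ℂ A A A (t ⊗ₜ b)) =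
      LinearMap.lTensor A (LinearMap.mulLeft ℂ (antipode Δ b)) t := by
    intro t
    induction t with
    | zero => simp
    | add x y hx hy => simp only [TensorProduct.add_tmul, map_add, hx, hy]
    | tmul x y => simp [contract₂₃_tmul, antiMul_tmul]
  have h3 : ∀ t : A ⊗[ℂ] A, contract₂₃ (antiMul (antipode Δ)) (t ⊗ₜ c) =
      LinearMap.lTensor A (LinearMap.mulRight ℂ c) (LinearMap.lTensor A (antipode Δ) t) := by
    intro t
    induction t with
    | zero => simp
    | add x y hx hy => simp only [TensorProduct.add_tmul, map_add, hx, hy]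
    | tmul x y => simp [contract₂₃_tmul, antiMul_tmul]
  rw [← h2, h1, h3]

include hR h in
/-- `(S ⊗ S)(R) = R`, for the anti-automorphism `S ⊗ S` of `A ⊗ A`. -/
theorem r_map_antipode (z : A ⊗[ℂ] A) :
    R.r (TensorProduct.map (antipode Δ) (antipode Δ) z) =
      TensorProduct.map (antipode Δ) (antipode Δ) (R.l z) := by
  have key : ∀ z, TensorProduct.map (antipode Δ) (antipode Δ)
      ((hR.unit⁻¹ : (M (A ⊗[ℂ] A))ˣ).1.l z) =
      (hR.unit⁻¹ : (M (A ⊗[ℂ] A))ˣ).1.r (TensorProduct.map (antipode Δ) (antipode Δ) z) := by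
    intro z
    induction z with
    | zero => simp
    | add x y hx hy => simp only [map_add, hx, hy]
    | tmul a b =>
      refine h.nondegenerate₂.eq_of_mul_tmul fun p q => ?_
      rw [TensorProduct.map_tmul, ← M.mul_l, tmul_mul_eq_map, mul_tmul_eq_map,
        ← LinearMap.rTensor_comp_lTensor, ← LinearMap.rTensor_comp_lTensor,
        ← LinearMap.rTensor_comp_lTensor, LinearMap.comp_apply, LinearMap.comp_apply,
        LinearMap.comp_apply, ← rTensor_lTensor_comm (antipode Δ), hR.lTensor_antipode h,
        rTensor_lTensor_comm, rTensor_lTensor_comm, hR.rTensor_antipode h,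
        rTensor_lTensor_comm]
  have h1 := congrArg R.r (key (R.l z))
  have h2 := M.r_inv_r hR.unit (TensorProduct.map (antipode Δ) (antipode Δ) (R.l z))
  rw [hR.coe_unit] at h2
  rw [hR.inv_l_l, h2] at h1
  exact h1

/-! ### The Drinfeld multiplier -/

/-- The map `A ⊗ M(A) → A`, `x ⊗ m ↦ S(m)x`. -/
def antipodeMMul (Δ : A →ₗ[ℂ] M (A ⊗[ℂ] A)) : A ⊗[ℂ] M A →ₗ[ℂ] A :=
  TensorProduct.lift (LinearMap.mk₂ ℂ (fun x m => (antipodeM Δ m).l x)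
    (fun x y m => map_add _ x y) (fun c x m => map_smul _ c x)
    (fun x m n => by rw [map_add]; rfl) (fun c x m => by rw [map_smul]; rfl))

theorem antipodeMMul_tmul (x : A) (m : M A) :
    antipodeMMul Δ (x ⊗ₜ m) = (antipodeM Δ m).l x := rfl

/-- The map `A ⊗ M(A) → A ⊗ A`, `x ⊗ m ↦ x ⊗ mc`. -/
def mulSnd (c : A) : A ⊗[ℂ] M A →ₗ[ℂ] A ⊗[ℂ] A :=
  LinearMap.lTensor A { toFun := fun m : M A => m.l c, map_add' := fun _ _ => rfl,
                        map_smul' := fun _ _ => rfl }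

theorem mulSnd_tmul (c x : A) (m : M A) : mulSnd c (x ⊗ₜ m) = x ⊗ₜ m.l c := rfl

include h in
theorem mul_antipodeM (t : A ⊗[ℂ] M A) : LinearMap.mul' ℂ (M A)
    (TensorProduct.map (antipodeM Δ) ι (TensorProduct.comm ℂ A (M A) t)) =
      ι (antipodeMMul Δ t) := by
  induction t with
  | zero => simp
  | add x y hx hy => simp only [map_add, hx, hy]
  | tmul x m =>
    rw [TensorProduct.comm_tmul, TensorProduct.map_tmul, LinearMap.mul'_apply,
      mul_ι h.nondegenerate, antipodeMMul_tmul]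

include h in
theorem antipode_mul_antipodeMMul (t : A ⊗[ℂ] M A) (c : A) : antipode Δ c * antipodeMMul Δ t =
    antiMul (antipode Δ) (swap A (mulSnd c t)) := by
  induction t with
  | zero => simp
  | add x y hx hy => simp only [map_add, mul_add, hx, hy]
  | tmul x m =>
    rw [antipodeMMul_tmul, M.mul_l, h.antipodeM_r, mulSnd_tmul]
    rfl

include h in
/-- If `R(a ⊗ 1)` is represented by `t ∈ A ⊗ M(A)`, then `t(1 ⊗ c) = R(a ⊗ c)`. -/
theorem mulSnd_eq (a : A) (t : A ⊗[ℂ] M A) (ht : legs t = R * tmul (ι a) 1) (c : A) :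
    mulSnd c t = R.l (a ⊗ₜ c) := by
  refine sub_eq_zero.1 (eq_zero_of_rTensor (fun b : A => LinearMap.mulRight ℂ b)
    (fun u hu => h.nondegenerate.1 u hu) _ fun b => ?_)
  rw [map_sub, sub_eq_zero, ← M.l_rTensor_mulRight h.nondegenerate₂]
  have h1 : ∀ t : A ⊗[ℂ] M A, (legs t).l (b ⊗ₜ c) =
      LinearMap.rTensor A (LinearMap.mulRight ℂ b) (mulSnd c t) := by
    intro t
    induction t with
    | zero => rw [map_zero, map_zero, map_zero]; rfl
    | add x y hx hy => rw [map_add, map_add, map_add, ← hx, ← hy]; rfl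
    | tmul x m => rfl
  rw [← h1, ht]
  rfl

include hR h in
/-- The linear map `L(a) = ∑ S(R⁽²⁾)R⁽¹⁾a`. The formula `S(c)L(a) = ∑ S(R⁽²⁾c)R⁽¹⁾a`, whose right
side is defined for `R(a ⊗ c) ∈ A ⊗ A`, shows that `L` is well defined and linear. -/
theorem exists_drinfeldMap : ∃ L : A →ₗ[ℂ] A,
    (∀ a c, antipode Δ c * L a = antiMul (antipode Δ) (swap A (R.l (a ⊗ₜ c)))) ∧
    ∀ a, ∃ t, legs t = R * tmul (ι a) 1 ∧ L a = antipodeMMul Δ t := by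
  choose t ht using hR.mul_mem
  have h1 : ∀ a c, antipode Δ c * antipodeMMul Δ (t a) =
      antiMul (antipode Δ) (swap A (R.l (a ⊗ₜ c))) := fun a c => by
    rw [antipode_mul_antipodeMMul h, mulSnd_eq h a _ (ht a)]
  have h2 : ∀ x y, (∀ c, antipode Δ c * x = antipode Δ c * y) → x = y := fun x y hxy =>
    sub_eq_zero.1 (h.eq_zero_of_antipode_mul _ fun c => by rw [mul_sub, hxy, sub_self])
  refine ⟨{ toFun := fun a => antipodeMMul Δ (t a), map_add' := fun a b => ?_,
            map_smul' := fun r a => ?_ }, h1, fun a => ⟨t a, ht a, rfl⟩⟩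
  · refine h2 _ _ fun c => ?_
    rw [mul_add, h1, h1, h1, TensorProduct.add_tmul, map_add, map_add, map_add]
  · refine h2 _ _ fun c => ?_
    rw [RingHom.id_apply, mul_smul_comm, h1, h1, ← TensorProduct.smul_tmul', map_smul, map_smul,
      map_smul]

include hR h in
/-- The Drinfeld multiplier exists, is invertible, and implements `S²`. -/
theorem exists_drinfeld : ∃ u : M A, IsDrinfeldMultiplier Δ R u ∧ IsUnit u ∧
    (∀ a c, antipode Δ c * u.l a = antiMul (antipode Δ) (swap A (R.l (a ⊗ₜ c)))) ∧
    ∀ a, u.l a = u.r (antipode Δ (antipode Δ a)) := by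
  have H := h.isMultiplierHopfAlgebra
  obtain ⟨L, hL, hLt⟩ := hR.exists_drinfeldMap h
  have hcancel : ∀ x y, (∀ c, antipode Δ c * x = antipode Δ c * y) → x = y := fun x y hxy =>
    sub_eq_zero.1 (h.eq_zero_of_antipode_mul _ fun c => by rw [mul_sub, hxy, sub_self])
  -- `x ⊗ y ↦ S(R⁽²⁾y)R⁽¹⁾x` is `Δ`-invariant because `RΔ(b) = Δᶜᵒᵖ(b)R`; hence `L` is `S²`-linear
  have hLl : ∀ b a, L (b * a) = antipode Δ (antipode Δ b) * L a := by
    intro b a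
    refine hcancel _ _ fun c => ?_
    have hinv : ∀ b z, (antiMul (antipode Δ) ∘ₗ swap A ∘ₗ R.l) ((Δ b).l z) =
        counit Δ b • (antiMul (antipode Δ) ∘ₗ swap A ∘ₗ R.l) z := by
      intro b z
      simp only [LinearMap.comp_apply, LinearEquiv.coe_coe]
      have h1 : TensorProduct.comm ℂ A A ((cop Δ b).l (R.l z)) =
          (Δ b).l (TensorProduct.comm ℂ A A (R.l z)) := by
        have h2 := cop_l (Δ := cop Δ) b (R.l z)
        rw [cop_cop] at h2
        exact h2.symm
      rw [← M.mul_l_apply, hR.mul_comul, M.mul_l_apply, h1, h.antiMul_comul]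
    have h3 := h.apply_mul_tmul_of_invariant _ hinv a b c
    simp only [LinearMap.comp_apply] at h3
    rw [← mul_assoc, ← h.antipode_mul, hL, hL, h3]
  have hLr : ∀ a b, L (a * b) = L a * b := by
    intro a b
    refine hcancel _ _ fun c => ?_
    have h1 : (a * b) ⊗ₜ[ℂ] c = LinearMap.rTensor A (LinearMap.mulRight ℂ b) (a ⊗ₜ c) := rfl
    rw [← mul_assoc, hL, hL, h1, M.l_rTensor_mulRight h.nondegenerate₂]
    induction R.l (a ⊗ₜ c) with
    | zero => simp
    | add x y hx hy => simp only [map_add, add_mul, hx, hy]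
    | tmul x y => simp [antiMul_tmul, mul_assoc]
  -- `L(S⁻¹(d)c) = ∑ S(R⁽²⁾d)R⁽¹⁾c`, and the right side is surjective as a map of `c ⊗ d`
  have hsurj : Function.Surjective L := by
    have h1 : L ∘ₗ antiMul (antipode (cop Δ)) ∘ₗ swap A =
        antiMul (antipode Δ) ∘ₗ swap A ∘ₗ R.l := by
      refine TensorProduct.ext' fun c d => ?_
      simp only [LinearMap.comp_apply]
      rw [← hL, LinearEquiv.coe_coe, TensorProduct.comm_tmul, antiMul_tmul, hLl,
        h.antipode_antipode_cop]
    have h2 : Function.Surjective (antiMul (antipode Δ) ∘ₗ swap A ∘ₗ R.l) := by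
      refine Function.Surjective.comp (g := antiMul (antipode Δ)) ?_
        ((TensorProduct.comm ℂ A A).surjective.comp (M.l_bijective_of_isUnit hR.isUnit).2)
      intro x
      obtain ⟨a, ha⟩ := H.exists_counit_eq_one
      exact ⟨h.W (a ⊗ₜ x), by rw [h.antiMul_W, sliceL_tmul, ha, one_smul]⟩
    rw [← h1] at h2
    exact Function.Surjective.of_comp h2
  -- `F` sends `x ⊗ c` to `∑ S⁻¹(yᵢ)xᵢ`, where `R⁻¹(x ⊗ c) = ∑ xᵢ ⊗ yᵢ`, and recovers `S⁻¹(c)a`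
  -- as `F(L(a) ⊗ c)`
  have hinj : Function.Injective L := by
    rw [injective_iff_map_eq_zero]
    intro a ha
    let F : A ⊗[ℂ] A →ₗ[ℂ] A :=
      antiMul (antipode (cop Δ)) ∘ₗ swap A ∘ₗ (hR.unit⁻¹ : (M (A ⊗[ℂ] A))ˣ).1.l
    have hFR : ∀ z, F (R.l z) = antiMul (antipode (cop Δ)) (swap A z) := fun z => by
      simp only [F, LinearMap.comp_apply, hR.inv_l_l]
    have hF : ∀ b x c, F ((antipode Δ b * x) ⊗ₜ c) = F (x ⊗ₜ (b * c)) := by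
      intro b x c
      have hinv : ∀ b z, F ((cop Δ b).l z) = counit (cop Δ) b • F z := by
        intro b z
        obtain ⟨z, rfl⟩ := (M.l_bijective_of_isUnit hR.isUnit).2 z
        rw [← M.mul_l_apply, ← hR.mul_comul, M.mul_l_apply, hFR, hFR, h.counit_cop,
          LinearEquiv.coe_coe, h.antiMul_cop_comul]
      have h1 := h.symm.apply_mul_tmul_of_invariant F hinv x (antipode Δ b) c
      rwa [h.antipode_cop_antipode] at h1
    have hFm : ∀ (m : M A) x c, F ((antipodeM Δ m).l x ⊗ₜ c) = F (x ⊗ₜ m.l c) := by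
      intro m x c
      refine H.hom_ext_mul (f := F ∘ₗ (TensorProduct.mk ℂ A A).flip c ∘ₗ (antipodeM Δ m).l)
        (g := F ∘ₗ (TensorProduct.mk ℂ A A).flip (m.l c)) (fun b y => ?_) x
      obtain ⟨b, rfl⟩ := h.antipode_bijective.2 b
      simp only [LinearMap.comp_apply, LinearMap.flip_apply, TensorProduct.mk_apply]
      rw [M.l_mul h.nondegenerate, h.antipodeM_l, hF, hF, M.mul_l]
    obtain ⟨t, ht, hta⟩ := hLt a
    have hFt : ∀ (t : A ⊗[ℂ] M A) c, F (antipodeMMul Δ t ⊗ₜ c) = F (mulSnd c t) := by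
      intro t c
      induction t with
      | zero => simp
      | add x y hx hy => simp only [TensorProduct.add_tmul, map_add, hx, hy]
      | tmul x m => rw [antipodeMMul_tmul, mulSnd_tmul, hFm]
    refine h.symm.eq_zero_of_antipode_mul a fun c => ?_
    have h1 := hFt t c
    rw [← hta, ha, TensorProduct.zero_tmul, map_zero, mulSnd_eq h a t ht, hFR] at h1
    exact h1.symm
  let u : M A := M.mk L (L ∘ₗ antipode (cop Δ) ∘ₗ antipode (cop Δ)) (by
    intro a b
    simp only [LinearMap.comp_apply]
    rw [← hLr, hLl, h.antipode_antipode_cop, h.antipode_antipode_cop])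
  refine ⟨u, fun a t ht => ?_, ?_, hL, fun a => ?_⟩
  · rw [mul_antipodeM h]
    congr 1
    refine hcancel _ _ fun c => ?_
    rw [antipode_mul_antipodeMMul h, mulSnd_eq h a t ht]
    exact hL a c
  · have hS' : Function.Bijective (antipode (cop Δ)) := h.symm.antipode_bijective
    exact M.isUnit_of_bijective u ⟨hinj, hsurj⟩
      (Function.Bijective.comp (g := L) ⟨hinj, hsurj⟩ (hS'.comp hS'))
  · change L a = L (antipode (cop Δ) (antipode (cop Δ) (antipode Δ (antipode Δ a))))
    rw [h.antipode_cop_antipode, h.antipode_cop_antipode]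

include hR h in
theorem drinfeld_unique {u u' : M A} (hu : IsDrinfeldMultiplier Δ R u)
    (hu' : IsDrinfeldMultiplier Δ R u') : u' = u := by
  refine M.eq_of_l h.nondegenerate fun a => ?_
  obtain ⟨t, ht⟩ := hR.mul_mem a
  exact ι_injective h.nondegenerate ((hu' a t ht).trans (hu a t ht).symm)

end IsRMatrix

/-! ### Operators acting in two of several legs -/

section MultiLegs

variable {A : Type*} [AddCommGroup A] [Module ℂ A]
variable {E : Type*} [AddCommGroup E] [Module ℂ E]
variable {κ : Type*} [dec : DecidableEq κ]

/-- A multilinear map as a function of its arguments in the legs `i` and `j`. -/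
def pairLegs (f : MultilinearMap ℂ (fun _ : κ => A) E) (v : κ → A) {i j : κ} (hij : i ≠ j) :
    A ⊗[ℂ] A →ₗ[ℂ] E :=
  TensorProduct.lift (LinearMap.mk₂ ℂ
    (fun x y => f (Function.update (Function.update v i x) j y))
    (fun x x' y => by
      simp only [Function.update_comm hij]; exact f.map_update_add _ _ _ _)
    (fun c x y => by
      simp only [Function.update_comm hij]; exact f.map_update_smul _ _ _ _)
    (fun x y y' => f.map_update_add _ _ _ _)
    (fun c x y => f.map_update_smul _ _ _ _))

theorem pairLegs_tmul (f : MultilinearMap ℂ (fun _ : κ => A) E) (v : κ → A) {i j : κ}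
    (hij : i ≠ j) (x y : A) : pairLegs f v hij (x ⊗ₜ y) =
      f (Function.update (Function.update v i x) j y) := rfl

theorem pairLegs_self (f : MultilinearMap ℂ (fun _ : κ => A) E) (v : κ → A) {i j : κ}
    (hij : i ≠ j) : pairLegs f v hij (v i ⊗ₜ v j) = f v := by
  rw [pairLegs_tmul, Function.update_eq_self, Function.update_eq_self]

theorem pairLegs_update_left (f : MultilinearMap ℂ (fun _ : κ => A) E) (v : κ → A) {i j : κ}
    (hij : i ≠ j) (x : A) : pairLegs f (Function.update v i x) hij = pairLegs f v hij := by
  refine TensorProduct.ext' fun a b => ?_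
  rw [pairLegs_tmul, pairLegs_tmul, Function.update_idem]

theorem pairLegs_update_right (f : MultilinearMap ℂ (fun _ : κ => A) E) (v : κ → A) {i j : κ}
    (hij : i ≠ j) (x : A) : pairLegs f (Function.update v j x) hij = pairLegs f v hij := by
  refine TensorProduct.ext' fun a b => ?_
  rw [pairLegs_tmul, pairLegs_tmul, Function.update_comm hij, Function.update_idem,
    Function.update_comm hij]

theorem pairLegs_update_add (f : MultilinearMap ℂ (fun _ : κ => A) E) (v : κ → A) {i j k : κ}
    (hij : i ≠ j) (hik : i ≠ k) (hjk : j ≠ k) (x y : A) :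
    pairLegs f (Function.update v k (x + y)) hij =
      pairLegs f (Function.update v k x) hij + pairLegs f (Function.update v k y) hij := by
  refine TensorProduct.ext' fun a b => ?_
  simp only [LinearMap.add_apply, pairLegs_tmul, Function.update_comm hik.symm,
    Function.update_comm hjk.symm]
  exact f.map_update_add _ _ _ _

theorem pairLegs_update_smul (f : MultilinearMap ℂ (fun _ : κ => A) E) (v : κ → A) {i j k : κ}
    (hij : i ≠ j) (hik : i ≠ k) (hjk : j ≠ k) (c : ℂ) (x : A) :
    pairLegs f (Function.update v k (c • x)) hij =
      c • pairLegs f (Function.update v k x) hij := by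
  refine TensorProduct.ext' fun a b => ?_
  simp only [LinearMap.smul_apply, pairLegs_tmul, Function.update_comm hik.symm,
    Function.update_comm hjk.symm]
  exact f.map_update_smul _ _ _ _

/-- The multilinear map `f ∘ Xᵢⱼ`, where `Xᵢⱼ` is the operator `X` acting in the legs `i`, `j`. -/
def onLegs (X : A ⊗[ℂ] A →ₗ[ℂ] A ⊗[ℂ] A) {i j : κ} (hij : i ≠ j)
    (f : MultilinearMap ℂ (fun _ : κ => A) E) : MultilinearMap ℂ (fun _ : κ => A) E where
  toFun v := pairLegs f v hij (X (v i ⊗ₜ v j))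
  map_update_add' {inst} v k x y := by
    obtain rfl := Subsingleton.elim inst dec
    rcases eq_or_ne i k with rfl | hik
    · simp only [pairLegs_update_left, Function.update_self, Function.update_of_ne hij.symm,
        TensorProduct.add_tmul, map_add]
    · rcases eq_or_ne j k with rfl | hjk
      · simp only [pairLegs_update_right, Function.update_self, Function.update_of_ne hij,
          TensorProduct.tmul_add, map_add]
      · rw [pairLegs_update_add f v hij hik hjk]
        simp only [Function.update_of_ne hik, Function.update_of_ne hjk, LinearMap.add_apply]
  map_update_smul' {inst} v k c x := by
    obtain rfl := Subsingleton.elim inst dec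
    rcases eq_or_ne i k with rfl | hik
    · simp only [pairLegs_update_left, Function.update_self, Function.update_of_ne hij.symm,
        ← TensorProduct.smul_tmul', map_smul]
    · rcases eq_or_ne j k with rfl | hjk
      · simp only [pairLegs_update_right, Function.update_self, Function.update_of_ne hij,
          TensorProduct.tmul_smul, map_smul]
      · rw [pairLegs_update_smul f v hij hik hjk]
        simp only [Function.update_of_ne hik, Function.update_of_ne hjk, LinearMap.smul_apply]

theorem onLegs_apply (X : A ⊗[ℂ] A →ₗ[ℂ] A ⊗[ℂ] A) {i j : κ} (hij : i ≠ j)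
    (f : MultilinearMap ℂ (fun _ : κ => A) E) (v : κ → A) :
    onLegs X hij f v = pairLegs f v hij (X (v i ⊗ₜ v j)) := rfl

/-- To evaluate `f ∘ Xᵢⱼ`, express `f` in the legs `i` and `j` through a linear map `g`. -/
theorem onLegs_apply_of_eq (X : A ⊗[ℂ] A →ₗ[ℂ] A ⊗[ℂ] A) {i j : κ} (hij : i ≠ j)
    (f : MultilinearMap ℂ (fun _ : κ => A) E) (v : κ → A) (g : A ⊗[ℂ] A →ₗ[ℂ] E)
    (hg : ∀ x y, f (Function.update (Function.update v i x) j y) = g (x ⊗ₜ y)) :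
    onLegs X hij f v = g (X (v i ⊗ₜ v j)) := by
  have : pairLegs f v hij = g := TensorProduct.ext' hg
  rw [onLegs_apply, this]

theorem onLegs_injective {X : A ⊗[ℂ] A →ₗ[ℂ] A ⊗[ℂ] A} (hX : Function.Surjective X) {i j : κ}
    (hij : i ≠ j) {f g : MultilinearMap ℂ (fun _ : κ => A) E}
    (h : onLegs X hij f = onLegs X hij g) : f = g := by
  have h1 : ∀ (f : MultilinearMap ℂ (fun _ : κ => A) E) v,
      pairLegs (onLegs X hij f) v hij = pairLegs f v hij ∘ₗ X := by
    intro f v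
    refine TensorProduct.ext' fun x y => ?_
    rw [pairLegs_tmul, onLegs_apply, pairLegs_update_right, pairLegs_update_left,
      Function.update_self, Function.update_of_ne hij, Function.update_self, LinearMap.comp_apply]
  ext v
  have h2 := h1 f v
  rw [h, h1, LinearMap.cancel_right hX] at h2
  rw [← pairLegs_self f v hij, ← h2, pairLegs_self]

/-- A multilinear map as a function of its arguments in the legs `i`, `j` and `k`. -/
def tripleLegs (f : MultilinearMap ℂ (fun _ : κ => A) E) (v : κ → A) {i j k : κ} (hij : i ≠ j)
    (hik : i ≠ k) (hjk : j ≠ k) : (A ⊗[ℂ] A) ⊗[ℂ] A →ₗ[ℂ] E :=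
  TensorProduct.lift (LinearMap.mk₂ ℂ (fun t z => pairLegs f (Function.update v k z) hij t)
    (fun t t' z => map_add _ t t') (fun c t z => map_smul _ c t)
    (fun t z z' => by rw [pairLegs_update_add f v hij hik hjk]; rfl)
    (fun c t z => by rw [pairLegs_update_smul f v hij hik hjk]; rfl))

theorem tripleLegs_tmul (f : MultilinearMap ℂ (fun _ : κ => A) E) (v : κ → A) {i j k : κ}
    (hij : i ≠ j) (hik : i ≠ k) (hjk : j ≠ k) (t : A ⊗[ℂ] A) (z : A) :
    tripleLegs f v hij hik hjk (t ⊗ₜ z) = pairLegs f (Function.update v k z) hij t := rfl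

variable (f : MultilinearMap ℂ (fun _ : κ => A) E) (v : κ → A) {i j k : κ}
    (hij : i ≠ j) (hik : i ≠ k) (hjk : j ≠ k)

theorem tripleLegs_self : tripleLegs f v hij hik hjk ((v i ⊗ₜ v j) ⊗ₜ v k) = f v := by
  rw [tripleLegs_tmul, Function.update_eq_self, pairLegs_self]

theorem tripleLegs_onLegs₁₂ (X : A ⊗[ℂ] A →ₗ[ℂ] A ⊗[ℂ] A) (t : (A ⊗[ℂ] A) ⊗[ℂ] A) :
    tripleLegs (onLegs X hij f) v hij hik hjk t =
      tripleLegs f v hij hik hjk (op₁₂ X t) := by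
  induction t using tensor₃_induction with
  | h0 => simp
  | hadd x y hx hy => simp only [map_add, hx, hy]
  | htmul x y z =>
    rw [op₁₂_tmul, tripleLegs_tmul, tripleLegs_tmul, pairLegs_tmul, onLegs_apply,
      pairLegs_update_right, pairLegs_update_left, Function.update_self,
      Function.update_of_ne hij, Function.update_self]

theorem update_rotate {i j k : κ} (hik : i ≠ k) (hjk : j ≠ k) (x y z : A) :
    Function.update (Function.update (Function.update v k z) i x) j y =
      Function.update (Function.update (Function.update v i x) j y) k z := by
  rw [Function.update_comm hik.symm, Function.update_comm hjk.symm]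

theorem tripleLegs_onLegs₁₃ (X : A ⊗[ℂ] A →ₗ[ℂ] A ⊗[ℂ] A) (t : (A ⊗[ℂ] A) ⊗[ℂ] A) :
    tripleLegs (onLegs X hik f) v hij hik hjk t =
      tripleLegs f v hij hik hjk (op₁₃ X t) := by
  induction t using tensor₃_induction with
  | h0 => simp
  | hadd x y hx hy => simp only [map_add, hx, hy]
  | htmul x y z =>
    rw [op₁₃_tmul, tripleLegs_tmul, pairLegs_tmul, update_rotate v hik hjk,
      Function.update_comm hij, onLegs_apply, Function.update_self, Function.update_of_ne hik, Function.update_self,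
      pairLegs_update_right, pairLegs_update_left]
    induction X (x ⊗ₜ z) with
    | zero => simp
    | add x y hx hy => simp only [TensorProduct.add_tmul, map_add, hx, hy]
    | tmul p q =>
      rw [TensorProduct.rightComm_tmul, tripleLegs_tmul, pairLegs_tmul, pairLegs_tmul,
        update_rotate v hik hjk, Function.update_comm hij]

theorem tripleLegs_onLegs₂₃ (X : A ⊗[ℂ] A →ₗ[ℂ] A ⊗[ℂ] A) (t : (A ⊗[ℂ] A) ⊗[ℂ] A) :
    tripleLegs (onLegs X hjk f) v hij hik hjk t =
      tripleLegs f v hij hik hjk (op₂₃ X t) := by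
  induction t using tensor₃_induction with
  | h0 => simp
  | hadd x y hx hy => simp only [map_add, hx, hy]
  | htmul x y z =>
    rw [op₂₃_tmul, tripleLegs_tmul, pairLegs_tmul, update_rotate v hik hjk,
      onLegs_apply, Function.update_self,
      Function.update_of_ne hjk, Function.update_self, pairLegs_update_right,
      pairLegs_update_left]
    induction X (y ⊗ₜ z) with
    | zero => simp
    | add x y hx hy => simp only [TensorProduct.tmul_add, map_add, hx, hy]
    | tmul p q =>
      rw [TensorProduct.assoc_symm_tmul, tripleLegs_tmul, pairLegs_tmul, pairLegs_tmul,
        update_rotate v hik hjk]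

/-- The multilinear map in four arguments determined by a bilinear map on `A ⊗ A`, evaluated at
the first two and the last two arguments. -/
def fourLegs (β : A ⊗[ℂ] A →ₗ[ℂ] A ⊗[ℂ] A →ₗ[ℂ] E) :
    MultilinearMap ℂ (fun _ : Fin 4 => A) E where
  toFun v := β (v 0 ⊗ₜ v 1) (v 2 ⊗ₜ v 3)
  map_update_add' {inst} v k x y := by
    obtain rfl := Subsingleton.elim inst (instDecidableEqFin 4)
    fin_cases k <;>
      simp [TensorProduct.add_tmul, TensorProduct.tmul_add]
  map_update_smul' {inst} v k c x := by
    obtain rfl := Subsingleton.elim inst (instDecidableEqFin 4)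
    fin_cases k <;>
      simp [TensorProduct.tmul_smul, ← TensorProduct.smul_tmul']

theorem fourLegs_apply (β : A ⊗[ℂ] A →ₗ[ℂ] A ⊗[ℂ] A →ₗ[ℂ] E) (v : Fin 4 → A) :
    fourLegs β v = β (v 0 ⊗ₜ v 1) (v 2 ⊗ₜ v 3) := rfl

theorem onLegs_fourLegs₁₂ (X : A ⊗[ℂ] A →ₗ[ℂ] A ⊗[ℂ] A) (h : (0 : Fin 4) ≠ 1)
    (β : A ⊗[ℂ] A →ₗ[ℂ] A ⊗[ℂ] A →ₗ[ℂ] E) :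
    onLegs X h (fourLegs β) = fourLegs (β ∘ₗ X) := by
  ext v
  refine onLegs_apply_of_eq X h _ v (β.flip (v 2 ⊗ₜ v 3)) fun x y => ?_
  simp [fourLegs_apply]

theorem onLegs_fourLegs₃₄ (X : A ⊗[ℂ] A →ₗ[ℂ] A ⊗[ℂ] A) (h : (2 : Fin 4) ≠ 3)
    (β : A ⊗[ℂ] A →ₗ[ℂ] A ⊗[ℂ] A →ₗ[ℂ] E) :
    onLegs X h (fourLegs β) = fourLegs (β.compl₂ X) := by
  ext v
  refine onLegs_apply_of_eq X h _ v (β (v 0 ⊗ₜ v 1)) fun x y => ?_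
  simp [fourLegs_apply]

theorem fourLegs_ext {β γ : A ⊗[ℂ] A →ₗ[ℂ] A ⊗[ℂ] A →ₗ[ℂ] E}
    (h : fourLegs β = fourLegs γ) : β = γ := by
  ext a b c d
  exact congrArg (fun f : MultilinearMap ℂ (fun _ : Fin 4 => A) E => f ![a, b, c, d]) h

end MultiLegs

/-! ### Relations between leg operators

Since `onLegs` acts by precomposition, the operators of a product appear in reverse order. -/

section LegRelations

theorem eq_of_tripleLegs {A E κ : Type*} [AddCommGroup A] [Module ℂ A] [AddCommGroup E]
    [Module ℂ E] [DecidableEq κ] {f g : MultilinearMap ℂ (fun _ : κ => A) E} {i j k : κ}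
    (hij : i ≠ j) (hik : i ≠ k) (hjk : j ≠ k)
    (h : ∀ v t, tripleLegs f v hij hik hjk t = tripleLegs g v hij hik hjk t) : f = g := by
  ext v
  rw [← tripleLegs_self f v hij hik hjk, h, tripleLegs_self]

variable {A : Type*} [NonUnitalRing A] [Module ℂ A] [IsScalarTower ℂ A A] [SMulCommClass ℂ A A]
variable {Δ : A →ₗ[ℂ] M (A ⊗[ℂ] A)} {R : M (A ⊗[ℂ] A)}
variable (hR : IsRMatrix Δ R) (h : IsRegular Δ) [Nontrivial A]
variable {E : Type*} [AddCommGroup E] [Module ℂ E]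
variable {κ : Type*} [DecidableEq κ] {i j k : κ} (hij : i ≠ j) (hik : i ≠ k) (hjk : j ≠ k)
  (f : MultilinearMap ℂ (fun _ : κ => A) E)

/-- The multilinear map `f` depends on its arguments `y`, `z` in the legs `j`, `k` only through
`S(y)z`. -/
def FactorsThroughAntipode (Δ : A →ₗ[ℂ] M (A ⊗[ℂ] A)) (i j k : κ)
    (f : MultilinearMap ℂ (fun _ : κ => A) E) : Prop :=
  ∀ v, ∃ g : A ⊗[ℂ] A →ₗ[ℂ] E, ∀ x y z,
    f (Function.update (Function.update (Function.update v i x) j y) k z) =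
      g (x ⊗ₜ (antipode Δ y * z))

include hij hik hjk in
theorem FactorsThroughAntipode.tripleLegs {f : MultilinearMap ℂ (fun _ : κ => A) E}
    (hf : FactorsThroughAntipode Δ i j k f) (v : κ → A) : ∃ g : A ⊗[ℂ] A →ₗ[ℂ] E, ∀ t,
      tripleLegs f v hij hik hjk t = g (contract₂₃ (antiMul (antipode Δ)) t) := by
  obtain ⟨g, hg⟩ := hf v
  refine ⟨g, fun t => ?_⟩
  induction t using tensor₃_induction with
  | h0 => simp
  | hadd x y hx hy => simp only [map_add, hx, hy]
  | htmul x y z =>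
    rw [tripleLegs_tmul, pairLegs_tmul, update_rotate v hik hjk, hg, contract₂₃_tmul,
      antiMul_tmul]

include hR hik in
/-- `WᵢⱼRᵢₖ = RᵢₖRⱼₖWᵢⱼ`. -/
theorem IsRMatrix.onLegs_comul_id :
    onLegs R.l hik (onLegs h.W.toLinearMap hij f) =
      onLegs h.W.toLinearMap hij (onLegs R.l hjk (onLegs R.l hik f)) :=
  eq_of_tripleLegs hij hik hjk fun v t => by
    rw [tripleLegs_onLegs₁₃, tripleLegs_onLegs₁₂, tripleLegs_onLegs₁₂, tripleLegs_onLegs₂₃,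
      tripleLegs_onLegs₁₃, hR.comul_id_op h]

include hR hik in
/-- `WⱼₖRᵢⱼ = RᵢₖRᵢⱼWⱼₖ`. -/
theorem IsRMatrix.onLegs_id_comul :
    onLegs R.l hij (onLegs h.W.toLinearMap hjk f) =
      onLegs h.W.toLinearMap hjk (onLegs R.l hij (onLegs R.l hik f)) :=
  eq_of_tripleLegs hij hik hjk fun v t => by
    rw [tripleLegs_onLegs₁₂, tripleLegs_onLegs₂₃, tripleLegs_onLegs₂₃, tripleLegs_onLegs₁₂,
      tripleLegs_onLegs₁₃, hR.id_comul_op h]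

include hR h in
theorem IsRMatrix.onLegs_yang_baxter :
    onLegs R.l hjk (onLegs R.l hik (onLegs R.l hij f)) =
      onLegs R.l hij (onLegs R.l hik (onLegs R.l hjk f)) :=
  eq_of_tripleLegs hij hik hjk fun v t => by
    rw [tripleLegs_onLegs₂₃, tripleLegs_onLegs₁₃, tripleLegs_onLegs₁₂, tripleLegs_onLegs₁₂,
      tripleLegs_onLegs₁₃, tripleLegs_onLegs₂₃, hR.yang_baxter h]

include hR h hjk in
/-- A map depending on `y`, `z` only through `S(y)z` absorbs `RᵢₖRᵢⱼ`. -/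
theorem IsRMatrix.onLegs_of_factors {f : MultilinearMap ℂ (fun _ : κ => A) E}
    (hf : FactorsThroughAntipode Δ i j k f) : onLegs R.l hij (onLegs R.l hik f) = f :=
  eq_of_tripleLegs hij hik hjk fun v t => by
    obtain ⟨g, hg⟩ := hf.tripleLegs hij hik hjk v
    rw [tripleLegs_onLegs₁₂, tripleLegs_onLegs₁₃, hg, hg, hR.contract₂₃_antiMul h]

include hik in
/-- `WⱼₖWᵢⱼ = WᵢⱼWᵢₖWⱼₖ`. -/
theorem IsRegular.onLegs_pentagon :
    onLegs h.W.toLinearMap hij (onLegs h.W.toLinearMap hjk f) =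
      onLegs h.W.toLinearMap hjk (onLegs h.W.toLinearMap hik (onLegs h.W.toLinearMap hij f)) :=
  eq_of_tripleLegs hij hik hjk fun v t => by
    rw [tripleLegs_onLegs₁₂, tripleLegs_onLegs₂₃, tripleLegs_onLegs₂₃, tripleLegs_onLegs₁₃,
      tripleLegs_onLegs₁₂, h.isMultiplierHopfAlgebra.pentagon]

include hjk in
/-- A map depending on `y`, `z` only through `S(y)z` absorbs `WᵢⱼWᵢₖ`. -/
theorem IsRegular.onLegs_of_factors {f : MultilinearMap ℂ (fun _ : κ => A) E}
    (hf : FactorsThroughAntipode Δ i j k f) :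
    onLegs h.W.toLinearMap hik (onLegs h.W.toLinearMap hij f) = f :=
  eq_of_tripleLegs hij hik hjk fun v t => by
    obtain ⟨g, hg⟩ := hf.tripleLegs hij hik hjk v
    rw [tripleLegs_onLegs₁₃, tripleLegs_onLegs₁₂, hg, hg, h.contract₂₃_antiMul_W]

end LegRelations

/-! ### The antipode and the comultiplication -/

section AntipodeComul

variable {A : Type*} [NonUnitalRing A] [Module ℂ A] [IsScalarTower ℂ A A] [SMulCommClass ℂ A A]
variable {Δ : A →ₗ[ℂ] M (A ⊗[ℂ] A)}

/-- The anti-automorphism `(S ⊗ S)σ` of `A ⊗ A`. -/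
def antipodeFlip (Δ : A →ₗ[ℂ] M (A ⊗[ℂ] A)) : A ⊗[ℂ] A →ₗ[ℂ] A ⊗[ℂ] A :=
  TensorProduct.map (antipode Δ) (antipode Δ) ∘ₗ swap A

theorem antipodeFlip_tmul (a b : A) :
    antipodeFlip Δ (a ⊗ₜ b) = antipode Δ b ⊗ₜ antipode Δ a := rfl

/-- The four-argument map `p, q, r, s ↦ S(s)p ⊗ S(r)q`. -/
def antipodePairing (Δ : A →ₗ[ℂ] M (A ⊗[ℂ] A)) :
    A ⊗[ℂ] A →ₗ[ℂ] A ⊗[ℂ] A →ₗ[ℂ] A ⊗[ℂ] A :=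
  (LinearMap.mul ℂ (A ⊗[ℂ] A)).flip.compl₂ (antipodeFlip Δ)

theorem antipodePairing_apply (z w : A ⊗[ℂ] A) :
    antipodePairing Δ z w = antipodeFlip Δ w * z := rfl

theorem antipodePairing_tmul (p q r s : A) : antipodePairing Δ (p ⊗ₜ q) (r ⊗ₜ s) =
    (antipode Δ s * p) ⊗ₜ (antipode Δ r * q) := by
  rw [antipodePairing_apply, antipodeFlip_tmul, Algebra.TensorProduct.tmul_mul_tmul]

theorem factors_antipodePairing (Δ : A →ₗ[ℂ] M (A ⊗[ℂ] A)) :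
    FactorsThroughAntipode Δ (2 : Fin 4) 3 0 (fourLegs (antipodePairing Δ)) := by
  intro v
  refine ⟨TensorProduct.map LinearMap.id
    (LinearMap.mulRight ℂ (v 1) ∘ₗ antipode Δ) ∘ₗ swap A, fun x y z => ?_⟩
  simp [fourLegs_apply, antipodePairing_tmul]

theorem factors_antipodePairing' (Δ : A →ₗ[ℂ] M (A ⊗[ℂ] A)) :
    FactorsThroughAntipode Δ (1 : Fin 4) 3 0 (fourLegs (antipodePairing Δ)) := by
  intro v
  refine ⟨TensorProduct.map LinearMap.id
    (LinearMap.mulLeft ℂ (antipode Δ (v 2))) ∘ₗ swap A, fun x y z => ?_⟩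
  simp [fourLegs_apply, antipodePairing_tmul]

namespace IsRegular

variable (h : IsRegular Δ) [Nontrivial A]

theorem V_antipode_mul_W (p q r s : A) :
    h.V (antipode Δ s ⊗ₜ antipode Δ r) * h.W (p ⊗ₜ q) =
      LinearMap.rTensor A (LinearMap.mulLeft ℂ (antipode Δ s))
        (h.W ((antipode Δ r * p) ⊗ₜ q)) := by
  rw [IsMultiplierHopfAlgebra.V_mul, ← IsMultiplierHopfAlgebra.W_mul_tmul]

/-- The antipode flips the comultiplication: `Δ(S(a)) = (S ⊗ S)σΔ(a)`, with both sides multiplied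
by `S(b) ⊗ 1`. -/
theorem antipodeFlip_W (w : A ⊗[ℂ] A) :
    antipodeFlip Δ (h.W w) = h.V (antipodeFlip Δ w) := by
  have h01 : (0 : Fin 4) ≠ 1 := by decide
  have h23 : (2 : Fin 4) ≠ 3 := by decide
  have h20 : (2 : Fin 4) ≠ 0 := by decide
  have h21 : (2 : Fin 4) ≠ 1 := by decide
  have h30 : (3 : Fin 4) ≠ 0 := by decide
  let γ : A ⊗[ℂ] A →ₗ[ℂ] A ⊗[ℂ] A →ₗ[ℂ] A ⊗[ℂ] A :=
    (LinearMap.mul ℂ (A ⊗[ℂ] A)).flip.compl₁₂ h.W.toLinearMap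
      (h.V.toLinearMap ∘ₗ antipodeFlip Δ)
  have hγ : ∀ z w, γ z w = h.V (antipodeFlip Δ w) * h.W z := fun _ _ => rfl
  have key : onLegs h.W.toLinearMap h01
      (onLegs h.W.toLinearMap h23 (fourLegs (antipodePairing Δ))) = fourLegs γ := by
    -- both sides agree after precomposition with `W` in the legs of `S(r)` and `p`
    refine onLegs_injective h.W.surjective h20 ?_
    rw [h.onLegs_pentagon h20 h21 h01, h.onLegs_of_factors h23 h20 h30
      (factors_antipodePairing Δ)]
    ext v
    have hL : ∀ v : Fin 4 → A, onLegs h.W.toLinearMap h21 (fourLegs (antipodePairing Δ)) v =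
        counit Δ (v 2) • LinearMap.rTensor A (LinearMap.mulLeft ℂ (antipode Δ (v 3)))
          (v 0 ⊗ₜ v 1) := by
      intro v
      rw [onLegs_apply_of_eq h.W.toLinearMap h21 _ v
        (TensorProduct.mk ℂ A A (antipode Δ (v 3) * v 0) ∘ₗ antiMul (antipode Δ))
        (fun x y => by simp [fourLegs_apply, antipodePairing_tmul, antiMul_tmul])]
      rw [LinearMap.comp_apply, LinearEquiv.coe_coe, h.antiMul_W, sliceL_tmul, map_smul]
      rfl
    rw [onLegs_apply_of_eq h.W.toLinearMap h01 _ v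
      (counit Δ (v 2) • LinearMap.rTensor A (LinearMap.mulLeft ℂ (antipode Δ (v 3))))
      (fun x y => by rw [hL]; simp)]
    rw [onLegs_apply_of_eq h.W.toLinearMap h20 _ v
      (LinearMap.rTensor A (LinearMap.mulLeft ℂ (antipode Δ (v 3))) ∘ₗ h.W.toLinearMap ∘ₗ
        (TensorProduct.mk ℂ A A).flip (v 1) ∘ₗ antiMul (antipode Δ))
      (fun x y => by
        rw [fourLegs_apply, hγ, antipodeFlip_tmul, h.V_antipode_mul_W]
        simp [antiMul_tmul])]
    simp only [LinearMap.comp_apply, LinearEquiv.coe_coe, h.antiMul_W, sliceL_tmul, map_smul,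
      LinearMap.smul_apply, LinearMap.flip_apply, TensorProduct.mk_apply]
  rw [onLegs_fourLegs₃₄, onLegs_fourLegs₁₂] at key
  refine h.nondegenerate₂.eq_of_mul_right fun z => ?_
  obtain ⟨z, rfl⟩ := h.W.surjective z
  exact congrArg (fun β => β z w) (fourLegs_ext key)

end IsRegular
end AntipodeComul

/-! ### The comultiplication of the Drinfeld multiplier -/

section DrinfeldComul

variable {A : Type*} [NonUnitalRing A] [Module ℂ A] [IsScalarTower ℂ A A] [SMulCommClass ℂ A A]
variable {Δ : A →ₗ[ℂ] M (A ⊗[ℂ] A)} {R : M (A ⊗[ℂ] A)}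
variable (hR : IsRMatrix Δ R) (h : IsRegular Δ) [Nontrivial A]

theorem flip_mul (m n : M (A ⊗[ℂ] A)) : flip (m * n) = flip m * flip n :=
  transport_mul _ comm_mul _ _

theorem flip_l (m : M (A ⊗[ℂ] A)) (z : A ⊗[ℂ] A) :
    (flip m).l (swap A z) = swap A (m.l z) := transport_l _ comm_mul m z

theorem flip_r (m : M (A ⊗[ℂ] A)) (z : A ⊗[ℂ] A) :
    (flip m).r (swap A z) = swap A (m.r z) := transport_r _ comm_mul m z

theorem swap_swap (z : A ⊗[ℂ] A) : swap A (swap A z) = z :=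
  (TensorProduct.comm ℂ A A).symm_apply_apply z

include hR in
/-- `σ(R)R` commutes with `Δ(a)`. -/
theorem IsRMatrix.flip_mul_comul (a : A) : flip R * R * Δ a = Δ a * (flip R * R) := by
  have h1 : flip R * cop Δ a = Δ a * flip R := by
    have h2 := congrArg flip (hR.mul_comul a)
    rw [flip_mul, flip_mul] at h2
    have h3 : flip (cop Δ a) = Δ a := flip_flip (Δ a)
    rw [h3] at h2
    exact h2
  rw [mul_assoc, hR.mul_comul, ← mul_assoc, h1, mul_assoc]

include h in
theorem IsRegular.commute_extend {Z : M (A ⊗[ℂ] A)} (hZ : ∀ a, Z * Δ a = Δ a * Z) (m : M A) :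
    Z * extend Δ m = extend Δ m * Z := by
  have H := h.isMultiplierHopfAlgebra
  have h1 : ∀ a, Z * extend Δ m * Δ a = extend Δ m * Z * Δ a := by
    intro a
    rw [mul_assoc, (H.isNondegenerateHom_comul.extend_spec h.nondegenerate₂ m a).1, hZ,
      ← (H.isNondegenerateHom_comul.extend_spec h.nondegenerate₂ m a).1, mul_assoc, mul_assoc,
      hZ]
  refine M.eq_of_l h.nondegenerate₂ fun z => ?_
  obtain ⟨z, rfl⟩ := h.W.surjective z
  induction z with
  | zero => simp
  | add x y hx hy => simp only [map_add, hx, hy]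
  | tmul a b =>
    apply ι_injective h.nondegenerate₂
    rw [← mul_ι h.nondegenerate₂, ← mul_ι h.nondegenerate₂, H.ι_W, ← mul_assoc, h1, mul_assoc]

include hR h in
/-- `σ(R)RΔ(u) = u ⊗ u`. With `f(p, q, r, s) = S(s)p ⊗ S(r)q`, both sides, applied to
`Δ(p)(1 ⊗ q)` and multiplied from the left by `(S(s) ⊗ 1)Δ(S(r))`, are values of `f` composed with
leg operators, and the claim is `f R₂₁R₁₂W₁₂W₃₄R₁₃ = f R₁₄R₂₃W₁₂W₃₄`. -/
theorem IsRMatrix.flip_mul_extend_drinfeld (u : M A)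
    (hu : ∀ a c, antipode Δ c * u.l a = antiMul (antipode Δ) (swap A (R.l (a ⊗ₜ c)))) :
    flip R * R * extend Δ u = tmul u u := by
  have H := h.isMultiplierHopfAlgebra
  have h01 : (0 : Fin 4) ≠ 1 := by decide
  have h10 : (1 : Fin 4) ≠ 0 := by decide
  have h02 : (0 : Fin 4) ≠ 2 := by decide
  have h03 : (0 : Fin 4) ≠ 3 := by decide
  have h12 : (1 : Fin 4) ≠ 2 := by decide
  have h13 : (1 : Fin 4) ≠ 3 := by decide
  have h21 : (2 : Fin 4) ≠ 1 := by decide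
  have h23 : (2 : Fin 4) ≠ 3 := by decide
  have h30 : (3 : Fin 4) ≠ 0 := by decide
  set Z := flip R * R with hZ
  set f := fourLegs (antipodePairing Δ) with hf
  -- `f ∘ R₁₄` is `f` evaluated at `up, q, r, s`, and `f ∘ R₁₄R₂₃` is `f` at `up, uq, r, s`
  have hf03 : onLegs R.l h03 f =
      fourLegs (antipodePairing Δ ∘ₗ LinearMap.rTensor A u.l) := by
    ext v
    rw [onLegs_apply_of_eq R.l h03 f v
      ((TensorProduct.mk ℂ A A).flip (antipode Δ (v 2) * v 1) ∘ₗ antiMul (antipode Δ) ∘ₗ swap A)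
      (fun x y => by simp [hf, fourLegs_apply, antipodePairing_tmul, antiMul_tmul])]
    simp only [LinearMap.comp_apply, ← hu]
    rw [fourLegs_apply, LinearMap.comp_apply, LinearMap.rTensor_tmul, antipodePairing_tmul]
    rfl
  have hf0312 : onLegs R.l h12 (onLegs R.l h03 f) =
      fourLegs (antipodePairing Δ ∘ₗ (tmul u u).l) := by
    ext v
    rw [hf03, onLegs_apply_of_eq R.l h12 _ v
      (TensorProduct.mk ℂ A A (antipode Δ (v 3) * u.l (v 0)) ∘ₗ antiMul (antipode Δ) ∘ₗ swap A)
      (fun x y => by simp [fourLegs_apply, antipodePairing_tmul, antiMul_tmul])]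
    simp only [LinearMap.comp_apply, ← hu]
    rw [fourLegs_apply, LinearMap.comp_apply, tmul_l, TensorProduct.map_tmul,
      antipodePairing_tmul]
    rfl
  have hfac : FactorsThroughAntipode Δ (0 : Fin 4) 2 1 (onLegs R.l h03 f) := by
    intro v
    rw [hf03]
    refine ⟨LinearMap.rTensor A (LinearMap.mulLeft ℂ (antipode Δ (v 3)) ∘ₗ u.l),
      fun x y z => ?_⟩
    simp [fourLegs_apply, antipodePairing_tmul]
  -- `f ∘ R₂₁R₁₂`
  have hfZ : onLegs R.l h01 (onLegs R.l h10 f) = fourLegs (antipodePairing Δ ∘ₗ Z.l) := by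
    have h1 : onLegs R.l h10 f = fourLegs (antipodePairing Δ ∘ₗ (flip R).l) := by
      ext v
      rw [onLegs_apply_of_eq R.l h10 f v
        ((antipodePairing Δ).flip (v 2 ⊗ₜ v 3) ∘ₗ swap A)
        (fun x y => by simp [hf, fourLegs_apply])]
      rw [LinearMap.comp_apply, ← flip_l]
      rfl
    rw [h1, onLegs_fourLegs₁₂]
    rfl
  -- `f R₂₁R₁₂W₁₂W₃₄R₁₃ = f R₁₄R₂₃W₁₂W₃₄`: moving `R₁₃` to the left of `W₃₄` and `W₁₂` leaves
  -- `f R₂₁R₁₂R₁₄R₂₄R₁₃R₂₃`; here `R₁₂R₁₄R₂₄ = R₂₄R₁₄R₁₂`, then `f` absorbs `R₂₁` and `R₂₄`, and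
  -- `f R₁₄` absorbs `R₁₂` and `R₁₃`
  have hword : onLegs R.l h02 (onLegs h.W.toLinearMap h23 (onLegs h.W.toLinearMap h01
      (onLegs R.l h01 (onLegs R.l h10 f)))) =
      onLegs h.W.toLinearMap h23 (onLegs h.W.toLinearMap h01
        (onLegs R.l h12 (onLegs R.l h03 f))) := by
    rw [hR.onLegs_id_comul h h02 h03 h23, hR.onLegs_comul_id h h01 h03 h13,
      hR.onLegs_comul_id h h01 h02 h12, hR.onLegs_yang_baxter h h01 h03 h13,
      hR.onLegs_of_factors h h13 h10 h30 (factors_antipodePairing' Δ),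
      hR.onLegs_of_factors h h02 h01 h21 hfac]
  rw [hf0312, hfZ, onLegs_fourLegs₁₂, onLegs_fourLegs₁₂, onLegs_fourLegs₃₄,
    onLegs_fourLegs₃₄] at hword
  have hLHS : ∀ p q r s, onLegs R.l h02 (fourLegs
      (((antipodePairing Δ ∘ₗ Z.l) ∘ₗ h.W.toLinearMap).compl₂ h.W.toLinearMap)) ![p, q, r, s] =
      h.V (antipode Δ s ⊗ₜ antipode Δ r) * Z.l (h.W (u.l p ⊗ₜ q)) := by
    intro p q r s
    have hVZ : ∀ x y, h.V (antipode Δ s ⊗ₜ antipode Δ y) * Z.l (h.W (x ⊗ₜ q)) =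
        LinearMap.rTensor A (LinearMap.mulLeft ℂ (antipode Δ s))
          (Z.l (h.W ((antipode Δ y * x) ⊗ₜ q))) := by
      intro x y
      rw [H.V_mul, ← M.mul_l_apply, ← hR.flip_mul_comul, M.mul_l_apply, ← H.W_mul_tmul]
    rw [onLegs_apply_of_eq R.l h02 _ ![p, q, r, s]
      (LinearMap.rTensor A (LinearMap.mulLeft ℂ (antipode Δ s)) ∘ₗ Z.l ∘ₗ h.W.toLinearMap ∘ₗ
        (TensorProduct.mk ℂ A A).flip q ∘ₗ antiMul (antipode Δ) ∘ₗ swap A)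
      (fun x y => by
        simp [fourLegs_apply, antipodePairing_apply, antiMul_tmul]
        rw [h.antipodeFlip_W, antipodeFlip_tmul, hVZ])]
    simp only [LinearMap.comp_apply]
    rw [← hu, hVZ]
    rfl
  refine M.eq_of_l h.nondegenerate₂ fun z => ?_
  obtain ⟨z, rfl⟩ := h.W.surjective z
  induction z with
  | zero => simp
  | add x y hx hy => simp only [map_add, hx, hy]
  | tmul p q =>
    refine h.nondegenerate₂.eq_of_mul_left fun w => ?_
    obtain ⟨w, rfl⟩ := h.V.surjective w
    induction w with
    | zero => simp
    | add x y hx hy => simp only [map_add, add_mul, hx, hy]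
    | tmul s r =>
      obtain ⟨s, rfl⟩ := h.antipode_bijective.2 s
      obtain ⟨r, rfl⟩ := h.antipode_bijective.2 r
      have h1 := hLHS p q r s
      rw [hword] at h1
      rw [M.mul_l_apply, H.extend_comul_l, LinearMap.rTensor_tmul, ← h1, ← antipodeFlip_tmul,
        ← h.antipodeFlip_W]
      rfl

/-- The multipliers `m` and `n` correspond to each other under the anti-automorphism
`(S ⊗ S)σ`. -/
def IsAntipodeImage (Δ : A →ₗ[ℂ] M (A ⊗[ℂ] A)) (m n : M (A ⊗[ℂ] A)) : Prop :=
  ∀ z, n.r (antipodeFlip Δ z) = antipodeFlip Δ (m.l z)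

theorem IsAntipodeImage.mul {m n m' n' : M (A ⊗[ℂ] A)} (hm : IsAntipodeImage Δ m n)
    (hm' : IsAntipodeImage Δ m' n') : IsAntipodeImage Δ (m * m') (n' * n) := fun z => by
  rw [M.mul_r_apply, hm' z, hm, M.mul_l_apply]

include h in
theorem IsAntipodeImage.unique {m n n' : M (A ⊗[ℂ] A)} (hn : IsAntipodeImage Δ m n)
    (hn' : IsAntipodeImage Δ m n') : n = n' := by
  refine M.eq_of_r h.nondegenerate₂ fun z => ?_
  have hs : Function.Surjective (antipodeFlip Δ) :=
    (TensorProduct.map_surjective h.antipode_bijective.2 h.antipode_bijective.2).comp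
      (TensorProduct.comm ℂ A A).surjective
  obtain ⟨z, rfl⟩ := hs z
  rw [hn, hn']

include h in
theorem IsRegular.isAntipodeImage_tmul (m n : M A) :
    IsAntipodeImage Δ (tmul m n) (tmul (antipodeM Δ n) (antipodeM Δ m)) := by
  intro z
  induction z with
  | zero => simp
  | add x y hx hy => simp only [map_add, hx, hy]
  | tmul a b =>
    rw [antipodeFlip_tmul, tmul_r, tmul_l, TensorProduct.map_tmul, TensorProduct.map_tmul,
      antipodeFlip_tmul, h.antipodeM_r, h.antipodeM_r]

include h in
theorem IsRegular.isAntipodeImage_extend (m : M A) :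
    IsAntipodeImage Δ (extend Δ m) (extend Δ (antipodeM Δ m)) := by
  intro z
  obtain ⟨z, rfl⟩ := h.W.surjective z
  induction z with
  | zero => simp
  | add x y hx hy => simp only [map_add, hx, hy]
  | tmul a b =>
    rw [h.antipodeFlip_W, h.isMultiplierHopfAlgebra.extend_comul_r,
      h.isMultiplierHopfAlgebra.extend_comul_l, h.antipodeFlip_W, antipodeFlip_tmul,
      LinearMap.lTensor_tmul, h.antipodeM_r, LinearMap.rTensor_tmul, antipodeFlip_tmul]

theorem swap_map_antipode (z : A ⊗[ℂ] A) :
    swap A (TensorProduct.map (antipode Δ) (antipode Δ) z) = antipodeFlip Δ z := by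
  induction z with
  | zero => simp
  | add x y hx hy => simp only [map_add, hx, hy]
  | tmul a b => rfl

include hR h in
theorem IsRMatrix.isAntipodeImage : IsAntipodeImage Δ R (flip R) := by
  intro z
  rw [← swap_map_antipode, flip_r, hR.r_map_antipode h, swap_map_antipode]

include hR h in
theorem IsRMatrix.isAntipodeImage_flip : IsAntipodeImage Δ (flip R) R := by
  intro z
  obtain ⟨z, rfl⟩ := (TensorProduct.comm ℂ A A).surjective z
  change R.r (antipodeFlip Δ (swap A z)) = antipodeFlip Δ ((flip R).l (swap A z))
  have h1 : ∀ z, antipodeFlip Δ (swap A z) =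
      TensorProduct.map (antipode Δ) (antipode Δ) z := fun z => by
    rw [antipodeFlip, LinearMap.comp_apply, swap_swap]
  rw [flip_l, h1, h1, hR.r_map_antipode h]

end DrinfeldComul

/-! ### The grouplike multiplier -/

section Main

/-- The counit and the antipode are constructed by slicing with functionals that take the value one,
so the case `A = 0` is treated separately. -/
theorem exists_drinfeld_grouplike {A : Type*} [NonUnitalRing A] [Module ℂ A] [IsScalarTower ℂ A A]
    [SMulCommClass ℂ A A] [Nontrivial A] {Δ : A →ₗ[ℂ] M (A ⊗[ℂ] A)} (h : IsRegular Δ)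
    {R : M (A ⊗[ℂ] A)} (hR : IsRMatrix Δ R) :
    ∃ u v : (M A)ˣ, IsDrinfeldMultiplier Δ R (u : M A) ∧
      (∀ u' : M A, IsDrinfeldMultiplier Δ R u' → u' = u) ∧
      (v : M A) = antipodeM Δ u ∧
      flip R * R * extend Δ (u : M A) = tmul (u : M A) (u : M A) ∧
      extend Δ (u : M A) * (flip R * R) = tmul (u : M A) (u : M A) ∧
      IsGrouplike Δ (u * v⁻¹) ∧
      ∀ a : A, ι (antipode Δ (antipode Δ (antipode Δ (antipode Δ a)))) =
        ((u * v⁻¹ : (M A)ˣ) : M A) * ι a * (((u * v⁻¹)⁻¹ : (M A)ˣ) : M A) := by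
  have H := h.isMultiplierHopfAlgebra
  obtain ⟨_, hDr, ⟨u, rfl⟩, hu, hS2⟩ := hR.exists_drinfeld h
  have hvu : IsUnit (antipodeM Δ (u : M A)) := by
    have hb := h.antipode_bijective
    have hrb : Function.Bijective (u : M A).r := by
      have hc : (u : M A).l = (u : M A).r ∘ₗ antipode Δ ∘ₗ antipode Δ := LinearMap.ext hS2
      have h1 := M.l_bijective_of_isUnit u.isUnit
      rw [hc] at h1
      exact (Function.Bijective.of_comp_iff _ (hb.comp hb)).1 h1
    refine M.isUnit_of_bijective _ ?_ ?_
    · have h2 : (antipodeM Δ (u : M A)).l ∘ antipode Δ = antipode Δ ∘ (u : M A).r :=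
        funext fun a => h.antipodeM_l _ a
      exact (Function.Bijective.of_comp_iff _ hb).1 (h2 ▸ hb.comp hrb)
    · have h2 : (antipodeM Δ (u : M A)).r ∘ antipode Δ = antipode Δ ∘ (u : M A).l :=
        funext fun a => h.antipodeM_r _ a
      exact (Function.Bijective.of_comp_iff _ hb).1
        (h2 ▸ hb.comp (M.l_bijective_of_isUnit u.isUnit))
  obtain ⟨v, hv⟩ := hvu
  have hΔu := hR.flip_mul_extend_drinfeld h (u : M A) hu
  have hΔu' : extend Δ (u : M A) * (flip R * R) = tmul (u : M A) (u : M A) := by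
    rw [← h.commute_extend hR.flip_mul_comul, hΔu]
  refine ⟨u, v, hDr, fun u' hu' => hR.drinfeld_unique h hDr hu', hv, hΔu, hΔu', ?_, fun a => ?_⟩
  · -- `(S ⊗ S)σ` maps `σ(R)RΔ(u) = u ⊗ u` to `Δ(S(u))σ(R)R = S(u) ⊗ S(u)`
    have hΔv : extend Δ (v : M A) * (flip R * R) = tmul (v : M A) (v : M A) := by
      have h1 := ((hR.isAntipodeImage_flip h).mul (hR.isAntipodeImage h)).mul
        (h.isAntipodeImage_extend (u : M A))
      rw [hΔu] at h1
      rw [hv]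
      exact h1.unique h (h.isAntipodeImage_tmul _ _)
    have hext : extend Δ ((u * v⁻¹ : (M A)ˣ) : M A) * extend Δ (v : M A) =
        extend Δ (u : M A) := by
      rw [← H.extend_comul_mul, ← Units.val_mul, inv_mul_cancel_right]
    have hvinv : tmul (v : M A) (v : M A) *
        tmul ((v⁻¹ : (M A)ˣ) : M A) ((v⁻¹ : (M A)ˣ) : M A) = 1 := by
      rw [tmul_mul_tmul, Units.mul_inv, tmul_one_one]
    rw [IsGrouplike]
    calc extend Δ ((u * v⁻¹ : (M A)ˣ) : M A)
        = extend Δ ((u * v⁻¹ : (M A)ˣ) : M A) * (tmul (v : M A) (v : M A) *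
            tmul ((v⁻¹ : (M A)ˣ) : M A) ((v⁻¹ : (M A)ˣ) : M A)) := by rw [hvinv, mul_one]
      _ = tmul (u : M A) (u : M A) *
            tmul ((v⁻¹ : (M A)ˣ) : M A) ((v⁻¹ : (M A)ˣ) : M A) := by
          rw [← hΔv, ← mul_assoc, ← mul_assoc, hext, hΔu']
      _ = _ := by rw [tmul_mul_tmul, ← Units.val_mul]
  · have hua : ∀ a, (u : M A) * ι a = ι (antipode Δ (antipode Δ a)) * u := fun a => by
      rw [mul_ι h.nondegenerate, ι_mul h.nondegenerate, hS2]
    have hva : ∀ a, ι a * (v : M A) = v * ι (antipode Δ (antipode Δ a)) := fun a => by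
      obtain ⟨a, rfl⟩ := h.antipode_bijective.2 a
      rw [mul_ι h.nondegenerate, ι_mul h.nondegenerate, hv, h.antipodeM_r, h.antipodeM_l, hS2]
    have hva' : ((v⁻¹ : (M A)ˣ) : M A) * ι a * v = ι (antipode Δ (antipode Δ a)) := by
      rw [mul_assoc, hva, Units.inv_mul_cancel_left]
    have hua' : ∀ b, ι (antipode Δ (antipode Δ b)) = (u : M A) * ι b * (u⁻¹ : (M A)ˣ) :=
      fun b => by rw [hua, Units.mul_inv_cancel_right]
    rw [hua', ← hva', mul_inv_rev, inv_inv, Units.val_mul, Units.val_mul]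
    simp only [mul_assoc]

end Main

end
end MultiplierHopf

theorem proposition2p6 {A : Type*} [NonUnitalRing A] [Module ℂ A] [IsScalarTower ℂ A A]
    [SMulCommClass ℂ A A] (Δ : A →ₗ[ℂ] MultiplierHopf.M (A ⊗[ℂ] A))
    (hΔ : MultiplierHopf.IsRegular Δ) (R : MultiplierHopf.M (A ⊗[ℂ] A))
    (hR : MultiplierHopf.IsRMatrix Δ R) :
    ∃ u v : (MultiplierHopf.M A)ˣ,
      MultiplierHopf.IsDrinfeldMultiplier Δ R (u : MultiplierHopf.M A) ∧
      (∀ u' : MultiplierHopf.M A, MultiplierHopf.IsDrinfeldMultiplier Δ R u' → u' = u) ∧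
      (v : MultiplierHopf.M A) = MultiplierHopf.antipodeM Δ u ∧
      MultiplierHopf.flip R * R * MultiplierHopf.extend Δ (u : MultiplierHopf.M A) =
        MultiplierHopf.tmul (u : MultiplierHopf.M A) (u : MultiplierHopf.M A) ∧
      MultiplierHopf.extend Δ (u : MultiplierHopf.M A) * (MultiplierHopf.flip R * R) =
        MultiplierHopf.tmul (u : MultiplierHopf.M A) (u : MultiplierHopf.M A) ∧
      MultiplierHopf.IsGrouplike Δ (u * v⁻¹) ∧
      ∀ a : A,
        MultiplierHopf.ι (MultiplierHopf.antipode Δ (MultiplierHopf.antipode Δ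
          (MultiplierHopf.antipode Δ (MultiplierHopf.antipode Δ a)))) =
        ((u * v⁻¹ : (MultiplierHopf.M A)ˣ) : MultiplierHopf.M A) * MultiplierHopf.ι a *
          (((u * v⁻¹)⁻¹ : (MultiplierHopf.M A)ˣ) : MultiplierHopf.M A) := by
  rcases subsingleton_or_nontrivial A with hA | hA
  · -- all multiplier algebras of the zero algebra are zero
    have hM : ∀ {B : Type _} [NonUnitalRing B] [Module ℂ B] [IsScalarTower ℂ B B]
        [SMulCommClass ℂ B B] [Subsingleton B], Subsingleton (MultiplierHopf.M B) :=
      ⟨fun m n => MultiplierHopf.M.ext' (fun _ => Subsingleton.elim _ _)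
        (fun _ => Subsingleton.elim _ _)⟩
    have hAA : Subsingleton (A ⊗[ℂ] A) := inferInstance
    have h1 : Subsingleton (MultiplierHopf.M A) := hM
    have h2 : Subsingleton (MultiplierHopf.M (A ⊗[ℂ] A)) := hM
    exact ⟨1, 1, fun _ _ _ => Subsingleton.elim _ _, fun _ _ => Subsingleton.elim _ _,
      Subsingleton.elim _ _, Subsingleton.elim _ _, Subsingleton.elim _ _,
      Subsingleton.elim _ _, fun _ => Subsingleton.elim _ _⟩
  · exact MultiplierHopf.exists_drinfeld_grouplike hΔ hR
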